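/- Let $\gamma\in C_0^\infty((-1,1))$ be real valued with $\|\gamma\|_{L^\infty}<1$. Put $E=(0,\infty)\times(0,1)$ and $V=(-1,1)\times(0,1)$, with points $(s,u)$, and for $0<\delta\le\varepsilon$ let $$\tilde{\mathbb H}_\varepsilon=L^2(E)\oplus L^2(E)\oplus L^2(V,\varepsilon\,ds\,du),\qquad \|\Psi\|_{\tilde{\mathbb H}_\varepsilon}^2=\|\psi_1\|_{L^2(E)}^2+\|\psi_2\|_{L^2(E)}^2+\varepsilon\|\psi_v\|_{L^2(V)}^2 .$$ Let $\tilde H_{\delta,\varepsilon}$ be the operator in $\tilde{\mathbb H}_\varepsilon$ whose domain $D(\tilde H_{\delta,\varepsilon})$ consists of all $\Psi=(\psi_1,\psi_2,\psi_v)\in\tilde{\mathbb H}_\varepsilon$ such that $\partial_s\psi,\partial_u\psi,\partial_s^2\psi,\partial_u^2\psi$ are in $L^2$ for each component $\psi$, with (in the sense of traces) $\psi_1=\psi_2=\psi_v=0$ at $u=0,1$ and $$\psi_1|_{s=0}=\psi_v|_{s=-1},\quad \psi_2|_{s=0}=\psi_v|_{s=1},\quad \partial_s\psi_1|_{s=0}=-\tfrac1\varepsilon\partial_s\psi_v|_{s=-1},\quad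 \partial_s\psi_2|_{s=0}=\tfrac1\varepsilon\partial_s\psi_v|_{s=1},$$ and which acts as $$\tilde H_{\delta,\varepsilon}\Psi=\Big(\big[-\partial_s^2-\tfrac1{\delta^2}\partial_u^2\big]\psi_1,\ \big[-\partial_s^2-\tfrac1{\delta^2}\partial_u^2\big]\psi_2,\ \tfrac1{\varepsilon^2}\tilde L_{\delta/\varepsilon}\psi_v\Big),$$ where, with $\beta=\delta/\varepsilon$ and $g_\beta(s,u)=(1+u\beta\gamma(s))^2$, $$\tilde L_\beta=-\frac1{g_\beta}\partial_s^2-\Big[\partial_s\frac1{g_\beta}\Big]\partial_s+W_\beta-\frac1{\beta^2}\partial_u^2,\qquad W_\beta=-\frac14\frac{\gamma^2}{(1+u\beta\gamma)^2}+\frac12\frac{u\beta\gamma''}{(1+u\beta\gamma)^3}-\frac54\frac{(u\beta\gamma')^2}{(1+u\beta\gamma)^4}.$$ Let $h_v=-\frac{d^2}{ds^2}-\frac{\gamma^2}{4}$ in $L^2((-1,1))$ with domain $\{y\in H^2((-1,1)) : y'(\pm1)=0\}$, and let $r_v(w;s,s')$ be the integral kernel, continuous on $[-1,1]^2$, of $(h_v-w)^{-1}$.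 For $z\in\mathbb C\setminus\mathbb R$ let $\sqrt z$ be the square root with $\operatorname{Im}\sqrt z>0$ and, for $f\in L^2((0,\infty))$, let $$(r_0(z)f)(s)=\int_0^\infty\frac{i}{2\sqrt z}\Big(e^{i\sqrt z|s-s'|}-e^{i\sqrt z s}e^{i\sqrt z s'}\Big)f(s')\,ds'$$ (the resolvent $(-d^2/ds^2-z)^{-1}$ of the Dirichlet Laplacian on $(0,\infty)$). For an integer $n\ge1$ put $\chi_n(u)=\sqrt2\sin(n\pi u)$, and for $f_1,f_2\in L^2((0,\infty))$ put $\tilde\Xi_n=(f_1\chi_n,f_2\chi_n,0)$ and $p_j=(r_0(z)f_j)'(0)$, $j=1,2$. Consider constants $q_1,q_2\in\mathbb C$, $\xi_j=p_j+i\sqrt z\,q_j$, fixed by the relations $$q_1=\varepsilon r_v(\varepsilon^2z;-1,-1)\xi_1+\varepsilon r_v(\varepsilon^2z;-1,1)\xi_2,\qquad q_2=\varepsilon r_v(\varepsilon^2z;1,-1)\xi_1+\varepsilon r_v(\varepsilon^2z;1,1)\xi_2,$$ and the vector $\hat\Psi_\varepsilon=(\hat\psi_1,\hat\psi_2,\hat\psi_v)$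 with $$\hat\psi_j(s,u)=\big[(r_0(z)f_j)(s)+q_je^{i\sqrt z s}\big]\chi_n(u)\ (j=1,2),\qquad \hat\psi_v(s,u)=\varepsilon\big[\xi_1r_v(\varepsilon^2z;s,-1)+\xi_2r_v(\varepsilon^2z;s,1)\big]\chi_n(u).$$ **Theorem.** For all $z\in\mathbb C\setminus\mathbb R$, $0<\delta\le\varepsilon$, $n\ge1$ and $f_1,f_2\in L^2((0,\infty))$ the relations above determine $(q_1,q_2)$ uniquely, and $\hat\Psi_\varepsilon\in D(\tilde H_{\delta,\varepsilon})$. Moreover, for each $z\in\mathbb C\setminus\mathbb R$ there are $\varepsilon_0>0$ and $c>0$, depending only on $\gamma$ and $z$, such that for all $0<\varepsilon<\varepsilon_0$, all $0<\delta\le\varepsilon$, all $n\ge1$ and all $f_1,f_2\in L^2((0,\infty))$: * Case 1: if $0$ is not an eigenvalue of $h_v$, then $$\Big\|\Big[\tilde H_{\delta,\varepsilon}-\frac{n^2\pi^2}{\delta^2}-z\Big]\hat\Psi_\varepsilon-\tilde\Xi_n\Big\|_{\tilde{\mathbb H}_\varepsilon}\le c\,\frac{\delta}{\varepsilon^{3/2}}\,\|\tilde\Xi_n\|_{\tilde{\mathbb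 H}_\varepsilon};$$ * Case 2: if $0$ is an eigenvalue of $h_v$, then $$\Big\|\Big[\tilde H_{\delta,\varepsilon}-\frac{n^2\pi^2}{\delta^2}-z\Big]\hat\Psi_\varepsilon-\tilde\Xi_n\Big\|_{\tilde{\mathbb H}_\varepsilon}\le c\Big(\frac{\delta}{\varepsilon^{3/2}}+\frac{\delta}{\varepsilon^{5/2}}\Big)\|\tilde\Xi_n\|_{\tilde{\mathbb H}_\varepsilon}.$$ -/

import Mathlib

open Set Filter Topology MeasureTheory
open scoped ContDiff ENNReal

noncomputable section

namespace Waveguide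

/-! ### Weak derivatives, square-integrable Sobolev functions and traces on rectangles -/

/-- `p` is the weak derivative, in the constant direction `d`, of `ψ` on the open set `Ω`, and both
functions are square integrable on `Ω`. Points of `ℝ × ℝ` are written `(s, u)`. -/
structure HasWeakDeriv (d : ℝ × ℝ) (Ω : Set (ℝ × ℝ)) (ψ p : ℝ × ℝ → ℂ) : Prop where
  memLp : MemLp ψ 2 (volume.restrict Ω)
  memLp_deriv : MemLp p 2 (volume.restrict Ω)
  integral_eq : ∀ φ : ℝ × ℝ → ℝ, ContDiff ℝ ∞ φ → HasCompactSupport φ → tsupport φ ⊆ Ω →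
    ∫ x in Ω, fderiv ℝ φ x d • ψ x = - ∫ x in Ω, φ x • p x

/-- On an open set the weak derivative is unique almost everywhere. -/
theorem HasWeakDeriv.ae_eq {d : ℝ × ℝ} {Ω : Set (ℝ × ℝ)} (hΩ : IsOpen Ω)
    {ψ p q : ℝ × ℝ → ℂ} (hp : HasWeakDeriv d Ω ψ p) (hq : HasWeakDeriv d Ω ψ q) :
    p =ᵐ[volume.restrict Ω] q := by
  have hpl : LocallyIntegrable p (volume.restrict Ω) :=
    hp.memLp_deriv.locallyIntegrable (by norm_num)
  have hql : LocallyIntegrable q (volume.restrict Ω) :=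
    hq.memLp_deriv.locallyIntegrable (by norm_num)
  have key := hΩ.ae_eq_zero_of_integral_contDiff_smul_eq_zero (μ := volume.restrict Ω)
    ((hpl.sub hql).locallyIntegrableOn Ω) (by
      intro g hg hc hs
      have h1 := hp.integral_eq g hg hc hs
      have h2 := hq.integral_eq g hg hc hs
      have h3 : ∫ x in Ω, g x • p x = ∫ x in Ω, g x • q x := by
        rw [h1] at h2; exact neg_injective h2
      have hip : Integrable (fun x => g x • p x) (volume.restrict Ω) :=
        hpl.integrable_smul_left_of_hasCompactSupport hg.continuous hc
      have hiq : Integrable (fun x => g x • q x) (volume.restrict Ω) :=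
        hql.integrable_smul_left_of_hasCompactSupport hg.continuous hc
      simp only [Pi.sub_apply, smul_sub]
      rw [integral_sub hip hiq, h3, sub_self])
  filter_upwards [key, ae_restrict_mem hΩ.measurableSet] with x hx hxΩ
  exact sub_eq_zero.mp (hx hxΩ)

open Classical in
/-- The weak derivative of `ψ` on `Ω` in direction `d` (a chosen representative; the value `0` is
used only if there is no square-integrable weak derivative). -/
def weakDeriv (d : ℝ × ℝ) (Ω : Set (ℝ × ℝ)) (ψ : ℝ × ℝ → ℂ) : ℝ × ℝ → ℂ :=
  if h : ∃ p, HasWeakDeriv d Ω ψ p then h.choose else 0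

/-- The weak partial derivative `∂ψ/∂s` on `Ω`. -/
def dS (Ω : Set (ℝ × ℝ)) (ψ : ℝ × ℝ → ℂ) : ℝ × ℝ → ℂ := weakDeriv (1, 0) Ω ψ

/-- The weak partial derivative `∂ψ/∂u` on `Ω`. -/
def dU (Ω : Set (ℝ × ℝ)) (ψ : ℝ × ℝ → ℂ) : ℝ × ℝ → ℂ := weakDeriv (0, 1) Ω ψ

/-- `ψ`, `∂ψ/∂s`, `∂ψ/∂u`, `∂²ψ/∂s²` and `∂²ψ/∂u²` exist weakly and belong to `L²(Ω)`. -/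
structure MemH2 (Ω : Set (ℝ × ℝ)) (ψ : ℝ × ℝ → ℂ) : Prop where
  ds : ∃ p, HasWeakDeriv (1, 0) Ω ψ p
  du : ∃ p, HasWeakDeriv (0, 1) Ω ψ p
  dss : ∃ p, HasWeakDeriv (1, 0) Ω (dS Ω ψ) p
  duu : ∃ p, HasWeakDeriv (0, 1) Ω (dU Ω ψ) p

/-- `ψ` has the trace `g ∈ L²((0,1))` on the vertical side `{s = a} × (0,1)`, approached from
`s > a` if `σ = 1` and from `s < a` if `σ = -1`: the mean over `t ∈ (0,h)` of
`‖ψ(a + σ t, ·) - g‖²` in `L²((0,1))` tends to `0` as `h → 0+`. -/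
def HasTraceS (a σ : ℝ) (ψ : ℝ × ℝ → ℂ) (g : ℝ → ℂ) : Prop :=
  MemLp g 2 (volume.restrict (Ioo 0 1)) ∧
  Tendsto (fun h : ℝ => (ENNReal.ofReal h)⁻¹ *
    ∫⁻ t in Ioo 0 h, ∫⁻ u in Ioo (0 : ℝ) 1, ‖ψ (a + σ * t, u) - g u‖ₑ ^ 2) (𝓝[>] 0) (𝓝 0)

/-- `ψ` has the trace `g ∈ L²(I)` on the horizontal side `I × {u = b}`, approached from
`u > b` if `σ = 1` and from `u < b` if `σ = -1`. -/
def HasTraceU (I : Set ℝ) (b σ : ℝ) (ψ : ℝ × ℝ → ℂ) (g : ℝ → ℂ) : Prop :=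
  MemLp g 2 (volume.restrict I) ∧
  Tendsto (fun h : ℝ => (ENNReal.ofReal h)⁻¹ *
    ∫⁻ t in Ioo 0 h, ∫⁻ s in I, ‖ψ (s, b + σ * t) - g s‖ₑ ^ 2) (𝓝[>] 0) (𝓝 0)

/-! ### The Hilbert space and the Hamiltonian -/

/-- The edge `E = (0,∞) × (0,1)`. -/
def E : Set (ℝ × ℝ) := Ioi 0 ×ˢ Ioo 0 1

/-- The vertex region `V = (-1,1) × (0,1)`. -/
def V : Set (ℝ × ℝ) := Ioo (-1) 1 ×ˢ Ioo 0 1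

/-- Vectors `Ψ = (ψ₁, ψ₂, ψ_v)`: two functions on the edges and one on the vertex region (only
their classes up to null sets in `E`, `E` and `V` matter). -/
abbrev Vec : Type := (ℝ × ℝ → ℂ) × (ℝ × ℝ → ℂ) × (ℝ × ℝ → ℂ)

/-- The norm of `L²(E) ⊕ L²(E) ⊕ L²(V, ε ds du)`, with values in `[0, ∞]`. -/
def normH (ε : ℝ) (Ψ : Vec) : ℝ≥0∞ :=
  (eLpNorm Ψ.1 2 (volume.restrict E) ^ 2 + eLpNorm Ψ.2.1 2 (volume.restrict E) ^ 2 +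
    ENNReal.ofReal ε * eLpNorm Ψ.2.2 2 (volume.restrict V) ^ 2) ^ (1 / 2 : ℝ)

/-- The function `g_β(s,u) = (1 + u β γ(s))²`, where `β = δ/ε`. -/
def metricG (γ : ℝ → ℝ) (β : ℝ) (x : ℝ × ℝ) : ℝ := (1 + x.2 * β * γ x.1) ^ 2

/-- The effective potential `W_β`, where `β = δ/ε`. -/
def potW (γ : ℝ → ℝ) (β : ℝ) (x : ℝ × ℝ) : ℝ :=
  -(1 / 4) * (γ x.1 ^ 2 / (1 + x.2 * β * γ x.1) ^ 2)
    + (1 / 2) * (x.2 * β * deriv (deriv γ) x.1 / (1 + x.2 * β * γ x.1) ^ 3)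
    - (5 / 4) * ((x.2 * β * deriv γ x.1) ^ 2 / (1 + x.2 * β * γ x.1) ^ 4)

/-- The differential operator
`L_β ψ = -g⁻¹ ∂²ψ/∂s² - (∂g⁻¹/∂s) ∂ψ/∂s + W ψ - β⁻² ∂²ψ/∂u²` on `V`, where `β = δ/ε`. -/
def opL (γ : ℝ → ℝ) (β : ℝ) (ψ : ℝ × ℝ → ℂ) : ℝ × ℝ → ℂ := fun x =>
  -((1 / metricG γ β x : ℝ) : ℂ) * dS V (dS V ψ) x
    - ((deriv (fun t => 1 / metricG γ β (t, x.2)) x.1 : ℝ) : ℂ) * dS V ψ x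
    + ((potW γ β x : ℝ) : ℂ) * ψ x
    - ((1 / β ^ 2 : ℝ) : ℂ) * dU V (dU V ψ) x

/-- The domain of the Hamiltonian: square-integrable second derivatives, Dirichlet conditions on
the sides `u = 0, 1`, and matching of the traces and of the normal derivatives where the edges meet
the vertex region (`s = 0` on the first edge with `s = -1`, `s = 0` on the second edge with
`s = 1`). -/
structure MemDomain (ε : ℝ) (Ψ : Vec) : Prop where
  memH2_one : MemH2 E Ψ.1
  memH2_two : MemH2 E Ψ.2.1
  memH2_vertex : MemH2 V Ψ.2.2
  dirichlet_one : HasTraceU (Ioi 0) 0 1 Ψ.1 0 ∧ HasTraceU (Ioi 0) 1 (-1) Ψ.1 0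
  dirichlet_two : HasTraceU (Ioi 0) 0 1 Ψ.2.1 0 ∧ HasTraceU (Ioi 0) 1 (-1) Ψ.2.1 0
  dirichlet_vertex : HasTraceU (Ioo (-1) 1) 0 1 Ψ.2.2 0 ∧ HasTraceU (Ioo (-1) 1) 1 (-1) Ψ.2.2 0
  match_one : ∃ g, HasTraceS 0 1 Ψ.1 g ∧ HasTraceS (-1) 1 Ψ.2.2 g
  match_two : ∃ g, HasTraceS 0 1 Ψ.2.1 g ∧ HasTraceS 1 (-1) Ψ.2.2 g
  match_deriv_one : ∃ g, HasTraceS (-1) 1 (dS V Ψ.2.2) g ∧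
    HasTraceS 0 1 (dS E Ψ.1) (fun u => -(1 / (ε : ℂ)) * g u)
  match_deriv_two : ∃ g, HasTraceS 1 (-1) (dS V Ψ.2.2) g ∧
    HasTraceS 0 1 (dS E Ψ.2.1) (fun u => (1 / (ε : ℂ)) * g u)

/-- The action of the Hamiltonian (meaningful on its domain `MemDomain ε`). -/
def hamiltonian (γ : ℝ → ℝ) (δ ε : ℝ) (Ψ : Vec) : Vec :=
  (fun x => -dS E (dS E Ψ.1) x - (1 / (δ : ℂ) ^ 2) * dU E (dU E Ψ.1) x,
   fun x => -dS E (dS E Ψ.2.1) x - (1 / (δ : ℂ) ^ 2) * dU E (dU E Ψ.2.1) x,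
   fun x => (1 / (ε : ℂ) ^ 2) * opL γ (δ / ε) Ψ.2.2 x)

/-! ### The one-dimensional Neumann operator and its resolvent kernel -/

/-- `y` (taken as its continuous representative on `[-1,1]`) belongs to the domain
`{y ∈ H²((-1,1)) | y'(-1) = y'(1) = 0}` of `h_v = -d²/ds² - γ²/4`, and `h_v y = k`. Membership in
`H²` is expressed by `y` being `C¹` with absolutely continuous derivative `y₁` and second
derivative `y₂ ∈ L²`. -/
def NeumannMaps (γ : ℝ → ℝ) (y k : ℝ → ℂ) : Prop :=
  ∃ y₁ y₂ : ℝ → ℂ, ContinuousOn y₁ (Icc (-1) 1) ∧ MemLp y₂ 2 (volume.restrict (Ioo (-1) 1)) ∧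
    (∀ s ∈ Icc (-1 : ℝ) 1, y s = y (-1) + ∫ t in (-1)..s, y₁ t) ∧
    (∀ s ∈ Icc (-1 : ℝ) 1, y₁ s = y₁ (-1) + ∫ t in (-1)..s, y₂ t) ∧
    y₁ (-1) = 0 ∧ y₁ 1 = 0 ∧
    ∀ᵐ s ∂(volume.restrict (Ioo (-1) 1)), k s = -y₂ s - ((γ s ^ 2 / 4 : ℝ) : ℂ) * y s

/-- `μ` is an eigenvalue of `h_v`. -/
def IsNeumannEigenvalue (γ : ℝ → ℝ) (μ : ℂ) : Prop :=
  ∃ y : ℝ → ℂ, (∃ s ∈ Icc (-1 : ℝ) 1, y s ≠ 0) ∧ NeumannMaps γ y (fun s => μ * y s)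

/-- `r` is the (continuous) integral kernel of the resolvent `(h_v - w)⁻¹`: for each `f ∈ L²`, the
function `y(s) = ∫ r(s,s') f(s') ds'` lies in the domain of `h_v` and satisfies
`h_v y = f + w y`. -/
def IsResolventKernel (γ : ℝ → ℝ) (w : ℂ) (r : ℝ → ℝ → ℂ) : Prop :=
  ContinuousOn (fun x : ℝ × ℝ => r x.1 x.2) (Icc (-1) 1 ×ˢ Icc (-1) 1) ∧
  ∀ f : ℝ → ℂ, MemLp f 2 (volume.restrict (Ioo (-1) 1)) →
    NeumannMaps γ (fun s => ∫ s' in Ioo (-1) 1, r s s' * f s')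
      (fun s => f s + w * ∫ s' in Ioo (-1) 1, r s s' * f s')

open Classical in
/-- The integral kernel `r_v(w; s, s')` of `(h_v - w)⁻¹`; it is determined on `[-1,1]²` when `w` is
not an eigenvalue of `h_v`. -/
def rV (γ : ℝ → ℝ) (w : ℂ) : ℝ → ℝ → ℂ :=
  if h : ∃ r, IsResolventKernel γ w r then h.choose else 0

/-! ### The approximate solution -/

/-- The square root with positive imaginary part, for `z ∉ [0, ∞)`. -/
def sqrtUp (z : ℂ) : ℂ := Complex.I * (-z) ^ (1 / 2 : ℂ)

theorem sqrtUp_sq (z : ℂ) : sqrtUp z ^ 2 = z := by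
  have h : ((-z) ^ (1 / 2 : ℂ)) ^ 2 = -z := by
    simp
  rw [sqrtUp, mul_pow, h, Complex.I_sq]; ring

theorem sqrtUp_im_pos {z : ℂ} (hz : z.im ≠ 0) : 0 < (sqrtUp z).im := by
  have hz0 : -z ≠ 0 := by
    intro h; apply hz; have := congrArg Complex.im h; simpa using this
  have harg : |(-z).arg| < Real.pi := by
    rw [abs_lt]
    refine ⟨Complex.neg_pi_lt_arg _, lt_of_le_of_ne (Complex.arg_le_pi _) ?_⟩
    intro h
    rw [Complex.arg_eq_pi_iff] at h
    apply hz; simpa using h.2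
  have : 0 < ((-z) ^ (1 / 2 : ℂ)).re := by
    rw [Complex.cpow_def_of_ne_zero hz0, Complex.exp_re]
    have him : (Complex.log (-z) * (1 / 2)).im = (-z).arg / 2 := by
      simp [Complex.mul_im, Complex.log_im]; ring
    rw [him]
    refine mul_pos (Real.exp_pos _) (Real.cos_pos_of_mem_Ioo ⟨?_, ?_⟩)
    · linarith [(abs_lt.mp harg).1]
    · linarith [(abs_lt.mp harg).2]
  simpa [sqrtUp] using this

/-- The transverse modes `χ_n(u) = √2 sin(nπu)`. -/
def chi (n : ℕ) (u : ℝ) : ℂ := ((Real.sqrt 2 * Real.sin (n * Real.pi * u) : ℝ) : ℂ)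

/-- The resolvent `r₀(z) = (-d²/ds² - z)⁻¹` of the Dirichlet Laplacian on `(0,∞)`, through its
explicit kernel. -/
def r0 (z : ℂ) (f : ℝ → ℂ) (s : ℝ) : ℂ :=
  ∫ s' in Ioi (0 : ℝ), (Complex.I / (2 * sqrtUp z)) *
    (Complex.exp (Complex.I * sqrtUp z * ((|s - s'| : ℝ) : ℂ))
      - Complex.exp (Complex.I * sqrtUp z * (s : ℂ)) * Complex.exp (Complex.I * sqrtUp z * (s' : ℂ)))
    * f s'

/-- The constant `p = (r₀(z) f)'(0)` (derivative from the right). -/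
def pConst (z : ℂ) (f : ℝ → ℂ) : ℂ := derivWithin (r0 z f) (Ici 0) 0

/-- The constant `ξ = p + i √z q`. -/
def xiConst (z : ℂ) (f : ℝ → ℂ) (q : ℂ) : ℂ := pConst z f + Complex.I * sqrtUp z * q

/-- The linear relations that fix the constants `q = (q₁, q₂)`. -/
def IsCoupling (γ : ℝ → ℝ) (ε : ℝ) (z : ℂ) (f₁ f₂ : ℝ → ℂ) (q : ℂ × ℂ) : Prop :=
  q.1 = ε * rV γ (ε ^ 2 * z) (-1) (-1) * xiConst z f₁ q.1
      + ε * rV γ (ε ^ 2 * z) (-1) 1 * xiConst z f₂ q.2 ∧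
  q.2 = ε * rV γ (ε ^ 2 * z) 1 (-1) * xiConst z f₁ q.1
      + ε * rV γ (ε ^ 2 * z) 1 1 * xiConst z f₂ q.2

/-- The approximate solution `(ψ₁, ψ₂, ψ_v)` built with the constants `q = (q₁, q₂)`. -/
def hatPsi (γ : ℝ → ℝ) (ε : ℝ) (z : ℂ) (n : ℕ) (f₁ f₂ : ℝ → ℂ) (q : ℂ × ℂ) : Vec :=
  (fun x => (r0 z f₁ x.1 + q.1 * Complex.exp (Complex.I * sqrtUp z * (x.1 : ℂ))) * chi n x.2,
   fun x => (r0 z f₂ x.1 + q.2 * Complex.exp (Complex.I * sqrtUp z * (x.1 : ℂ))) * chi n x.2,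
   fun x => ε * (xiConst z f₁ q.1 * rV γ (ε ^ 2 * z) x.1 (-1)
      + xiConst z f₂ q.2 * rV γ (ε ^ 2 * z) x.1 1) * chi n x.2)

/-- The data `Ξ_n = (f₁ χ_n, f₂ χ_n, 0)`. -/
def dataXi (n : ℕ) (f₁ f₂ : ℝ → ℂ) : Vec :=
  (fun x => f₁ x.1 * chi n x.2, fun x => f₂ x.1 * chi n x.2, 0)

/-- The error `(H - n²π²/δ² - z) Ψ - Ξ_n` for the approximate solution `Ψ`. -/
def resolventError (γ : ℝ → ℝ) (δ ε : ℝ) (z : ℂ) (n : ℕ) (f₁ f₂ : ℝ → ℂ) (q : ℂ × ℂ) : Vec :=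
  hamiltonian γ δ ε (hatPsi γ ε z n f₁ f₂ q)
    - (((n ^ 2 * Real.pi ^ 2 / δ ^ 2 : ℝ) : ℂ) + z) • hatPsi γ ε z n f₁ f₂ q
    - dataXi n f₁ f₂

end Waveguide

end

open Waveguide

noncomputable section

namespace Waveguide

/-! ### Linear differential equations on the line -/

/-! The data are products with `chi n`, so everything reduces to ordinary differential equations in
s, and the transverse energy n²π²/δ² cancels identically. On an edge, r₀(z)f + q e^{i√z s} solves
the shifted equation exactly (`edge_error_eq_zero`). On the vertex, y = ε(ξ₁ r_v(·,-1) + ξ₂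
r_v(·,1)) solves h_v y = ε²z y with y'(-1) = -εξ₁ and y'(1) = εξ₂. The coupling relations say
precisely that y(-1) = q₁ and y(1) = q₂, which yields all matching conditions (`hatPsi_memDomain`).

The only error is thus ε⁻² times the longitudinal part of L_β minus h_v, applied to y. Its
coefficients are O(β), β = δ/ε (`exists_coefficient_bound`), and the weight of the vertex norm
contributes √ε. The error is therefore at most a constant times δ ε^(-5/2) sup(|y|,|y'|,|y''|)
(`normH_resolventError_le`).

The size of y is found without any spectral expansion of r_v. Since Im(y' ȳ) has derivative -ε² Im z
|y|², and Im z = 2 Re√z Im√z, the quantity Re√z · Im(y' ȳ) decreases. Inserting the boundary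
relations gives |Re√z|(|q₁| + |q₂|) ≤ 2(|p₁| + |p₂|) uniformly in ε (`norm_boundary_le`). With p = 0
this is injectivity of the 2×2 system for q, hence its unique solvability. In general it bounds the
Cauchy data of y at -1, and Gronwall gives sup|y| = O(|p₁| + |p₂|) (`exists_profile_bound`), which
is Case 2.

If 0 is not an eigenvalue, let a solve h_v a = 0 with a(-1) = 1, a'(-1) = 0; then a'(1) ≠ 0. The
difference y - y(-1)a has Cauchy data and source of size O(ε), so y'(1) - y(-1)a'(1) = O(ε). As
y'(1) = O(ε) too, y(-1) and then y are O(ε) (`exists_profile_bound_of_not_eigenvalue`). This gains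
the factor ε of Case 1. Finally p = ∫ e^{i√z t} f(t) dt is controlled by the L² norm of f
(`exists_pConst_bound`). -/

theorem norm_integral_exp_abs_le {lam : ℝ} (hlam : 0 < lam) (t : ℝ) :
    |∫ τ in (0 : ℝ)..t, Real.exp (lam * |τ|)| ≤ Real.exp (lam * |t|) / lam := by
  have pos : ∀ t : ℝ, 0 ≤ t →
      |∫ τ in (0 : ℝ)..t, Real.exp (lam * |τ|)| ≤ Real.exp (lam * |t|) / lam := by
    intro t ht
    have h1 : ∫ τ in (0 : ℝ)..t, Real.exp (lam * |τ|) = ∫ τ in (0 : ℝ)..t, Real.exp (lam * τ) := by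
      refine intervalIntegral.integral_congr fun τ hτ => ?_
      rw [uIcc_of_le ht] at hτ
      simp only [abs_of_nonneg hτ.1]
    rw [h1, intervalIntegral.integral_comp_mul_left (fun x => Real.exp x) hlam.ne', integral_exp,
      abs_of_nonneg ht, mul_zero, Real.exp_zero, smul_eq_mul, abs_of_nonneg, div_eq_inv_mul]
    · have := hlam.le; gcongr; linarith
    · have : 1 ≤ Real.exp (lam * t) := Real.one_le_exp (by positivity)
      have h2 : 0 ≤ Real.exp (lam * t) - 1 := by linarith
      positivity
  rcases le_total 0 t with ht | ht
  · exact pos t ht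
  · have h := pos (-t) (by linarith)
    have h2 : ∫ τ in (0 : ℝ)..(-t), Real.exp (lam * |τ|)
        = -∫ τ in (0 : ℝ)..t, Real.exp (lam * |τ|) := by
      have := intervalIntegral.integral_comp_neg (a := 0) (b := t)
        (fun τ => Real.exp (lam * |τ|))
      simp only [abs_neg, neg_zero] at this
      rw [this, intervalIntegral.integral_symm]
    rwa [h2, abs_neg, abs_neg] at h

/-- Global existence for a linear differential equation with bounded continuous coefficients. -/
theorem exists_hasDerivAt_clm {F : Type*} [NormedAddCommGroup F] [NormedSpace ℝ F]
    [CompleteSpace F] {A : ℝ → F →L[ℝ] F} (hA : Continuous A) {K : ℝ} (hK : ∀ t, ‖A t‖ ≤ K)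
    (x₀ : F) : ∃ x : ℝ → F, x 0 = x₀ ∧ ∀ t, HasDerivAt x (A t (x t)) t := by
  have hK0 : 0 ≤ K := (norm_nonneg _).trans (hK 0)
  -- The exponential weight e^{-λ|t|} makes the Picard map a contraction on the whole line at once,
  -- with constant K/λ ≤ 1/2, so no local solutions have to be glued.
  set lam : ℝ := 2 * (K + 1) with hlam
  have hlam0 : 0 < lam := by positivity
  have hcont : ∀ u : BoundedContinuousFunction ℝ F,
      Continuous fun τ => Real.exp (lam * |τ|) • A τ (u τ) := fun u =>
    (by fun_prop : Continuous fun τ : ℝ => Real.exp (lam * |τ|)).smul (hA.clm_apply u.continuous)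
  have hbound : ∀ (u : BoundedContinuousFunction ℝ F) (t : ℝ),
      ‖Real.exp (-(lam * |t|)) • ∫ τ in (0 : ℝ)..t, Real.exp (lam * |τ|) • A τ (u τ)‖
        ≤ 1 / 2 * ‖u‖ := by
    intro u t
    have h1 : ‖∫ τ in (0 : ℝ)..t, Real.exp (lam * |τ|) • A τ (u τ)‖
        ≤ |∫ τ in (0 : ℝ)..t, Real.exp (lam * |τ|) * (K * ‖u‖)| := by
      refine intervalIntegral.norm_integral_le_abs_of_norm_le ?_ ?_
      · refine Filter.Eventually.of_forall fun τ => ?_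
        rw [norm_smul, Real.norm_of_nonneg (Real.exp_pos _).le]
        gcongr
        exact ((A τ).le_opNorm _).trans (mul_le_mul (hK τ) (u.norm_coe_le_norm τ) (norm_nonneg _) hK0)
      · exact (Continuous.intervalIntegrable (by fun_prop) _ _)
    rw [intervalIntegral.integral_mul_const, abs_mul, abs_of_nonneg (by positivity : 0 ≤ K * ‖u‖)]
      at h1
    have h2 := norm_integral_exp_abs_le hlam0 t
    rw [norm_smul, Real.norm_of_nonneg (Real.exp_pos _).le]
    calc Real.exp (-(lam * |t|)) * ‖∫ τ in (0 : ℝ)..t, Real.exp (lam * |τ|) • A τ (u τ)‖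
        ≤ Real.exp (-(lam * |t|)) * (Real.exp (lam * |t|) / lam * (K * ‖u‖)) := by
          gcongr; exact h1.trans (by gcongr)
      _ = K / lam * ‖u‖ := by
          rw [Real.exp_neg]; field_simp
      _ ≤ 1 / 2 * ‖u‖ := by
          have : K / lam ≤ 1 / 2 := by rw [div_le_iff₀ hlam0, hlam]; linarith
          gcongr
  -- The unknown is u(t) = e^{-λ|t|} x(t), which is bounded; `S` is the Picard map rewritten for u.
  let S : BoundedContinuousFunction ℝ F → BoundedContinuousFunction ℝ F := fun u =>
    BoundedContinuousFunction.ofNormedAddCommGroup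
      (fun t => Real.exp (-(lam * |t|)) • x₀ +
        Real.exp (-(lam * |t|)) • ∫ τ in (0 : ℝ)..t, Real.exp (lam * |τ|) • A τ (u τ))
      (by
        have h1 : Continuous fun t => ∫ τ in (0 : ℝ)..t, Real.exp (lam * |τ|) • A τ (u τ) :=
          intervalIntegral.continuous_primitive (fun a b => (hcont u).intervalIntegrable a b) 0
        fun_prop)
      (‖x₀‖ + 1 / 2 * ‖u‖)
      (by
        intro t
        refine (norm_add_le _ _).trans (add_le_add ?_ (hbound u t))
        rw [norm_smul, Real.norm_of_nonneg (Real.exp_pos _).le]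
        refine mul_le_of_le_one_left (norm_nonneg _) (Real.exp_le_one_iff.2 ?_)
        have := abs_nonneg t
        nlinarith)
  have hS : ContractingWith (1 / 2 : NNReal) S := by
    refine ⟨by norm_num, LipschitzWith.of_dist_le_mul fun u v => ?_⟩
    refine (BoundedContinuousFunction.dist_le (by positivity)).2 fun t => ?_
    have h1 : S u t - S v t =
        Real.exp (-(lam * |t|)) • ∫ τ in (0 : ℝ)..t, Real.exp (lam * |τ|) • A τ ((u - v) τ) := by
      simp only [S, BoundedContinuousFunction.coe_ofNormedAddCommGroup, add_sub_add_left_eq_sub,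
        ← smul_sub]
      rw [← intervalIntegral.integral_sub ((hcont u).intervalIntegrable _ _)
        ((hcont v).intervalIntegrable _ _)]
      simp [smul_sub]
    rw [dist_eq_norm, h1, dist_eq_norm]
    simpa using hbound (u - v) t
  set u := hS.fixedPoint S with hu
  have hfix : ∀ t, u t = Real.exp (-(lam * |t|)) • x₀ +
        Real.exp (-(lam * |t|)) • ∫ τ in (0 : ℝ)..t, Real.exp (lam * |τ|) • A τ (u τ) := by
    intro t
    conv_lhs => rw [hu, ← hS.fixedPoint_isFixedPt.eq]
    rfl
  refine ⟨fun t => Real.exp (lam * |t|) • u t, ?_, ?_⟩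
  · simp [hfix 0]
  · have hx : (fun t => Real.exp (lam * |t|) • u t) =
        fun t => x₀ + ∫ τ in (0 : ℝ)..t, Real.exp (lam * |τ|) • A τ (u τ) := by
      funext t
      rw [hfix t, smul_add, smul_smul, smul_smul, ← Real.exp_add]
      simp
    intro t
    rw [hx]
    have := (intervalIntegral.integral_hasDerivAt_right ((hcont u).intervalIntegrable 0 t)
      ((hcont u).stronglyMeasurableAtFilter _ _) (hcont u).continuousAt).const_add x₀
    rw [← map_smul] at this
    exact this.congr_deriv (congrArg (A t) (congrFun hx t))

/-- `y'' + q y = 0` on the line, with `y₁ = y'`. -/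
structure SolvesODE (q : ℝ → ℂ) (y y₁ : ℝ → ℂ) : Prop where
  deriv_fst : ∀ t, HasDerivAt y (y₁ t) t
  deriv_snd : ∀ t, HasDerivAt y₁ (-(q t * y t)) t

/-- The equation becomes a first-order system in ℂ × ℂ with coefficient `J - N (q t)`, where `J` and
`N` carry y' and q y to their places; a translation moves the initial time to 0. -/
theorem SolvesODE.exists_of_bounded {q : ℝ → ℂ} (hq : Continuous q) {K : ℝ} (hK : ∀ t, ‖q t‖ ≤ K)
    (t₀ : ℝ) (α β : ℂ) : ∃ y y₁ : ℝ → ℂ, SolvesODE q y y₁ ∧ y t₀ = α ∧ y₁ t₀ = β := by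
  let J : (ℂ × ℂ) →L[ℝ] (ℂ × ℂ) :=
    (ContinuousLinearMap.inl ℝ ℂ ℂ).comp (ContinuousLinearMap.snd ℝ ℂ ℂ)
  let N : ℂ →L[ℝ] (ℂ × ℂ) →L[ℝ] (ℂ × ℂ) :=
    ((ContinuousLinearMap.compL ℝ (ℂ × ℂ) ℂ (ℂ × ℂ)) (ContinuousLinearMap.inr ℝ ℂ ℂ)).comp
      (((ContinuousLinearMap.compL ℝ (ℂ × ℂ) ℂ ℂ).flip (ContinuousLinearMap.fst ℝ ℂ ℂ)).comp
        (ContinuousLinearMap.mul ℝ ℂ))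
  have hN : ∀ c x, N c x = (0, c * x.1) := fun c x => by simp [N]
  have hJ : ∀ x, J x = (x.2, 0) := fun x => by simp [J]
  have hA : Continuous fun t => J - N (q (t + t₀)) := by fun_prop
  obtain ⟨x, hx0, hx⟩ := exists_hasDerivAt_clm hA (K := ‖J‖ + ‖N‖ * K) (fun t =>
    (norm_sub_le _ _).trans (by
      gcongr; exact (N.le_opNorm _).trans (by gcongr; exact hK _))) (α, β)
  have hx' : ∀ t, HasDerivAt (fun t => x (t - t₀)) ((x (t - t₀)).2, -(q t * (x (t - t₀)).1)) t := by
    intro t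
    have h := (hx (t - t₀)).comp_sub_const t t₀
    simpa [hN, hJ] using h
  refine ⟨fun t => (x (t - t₀)).1, fun t => (x (t - t₀)).2, ⟨fun t => ?_, fun t => ?_⟩, ?_, ?_⟩
  · exact (ContinuousLinearMap.fst ℝ ℂ ℂ).hasFDerivAt.comp_hasDerivAt t (hx' t)
  · exact (ContinuousLinearMap.snd ℝ ℂ ℂ).hasFDerivAt.comp_hasDerivAt t (hx' t)
  · simp [hx0]
  · simp [hx0]

namespace SolvesODE
variable {q : ℝ → ℂ} {y y₁ : ℝ → ℂ}

theorem continuous_fst (h : SolvesODE q y y₁) : Continuous y :=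
  continuous_iff_continuousAt.2 fun t => (h.deriv_fst t).continuousAt

theorem continuous_snd (h : SolvesODE q y y₁) : Continuous y₁ :=
  continuous_iff_continuousAt.2 fun t => (h.deriv_snd t).continuousAt

theorem const_mul (h : SolvesODE q y y₁) (c : ℂ) :
    SolvesODE q (fun t => c * y t) (fun t => c * y₁ t) :=
  ⟨fun t => (h.deriv_fst t).const_mul c, fun t => by
    exact ((h.deriv_snd t).const_mul c).congr_deriv (by ring)⟩

theorem add {w w₁ : ℝ → ℂ} (h : SolvesODE q y y₁) (h' : SolvesODE q w w₁) :
    SolvesODE q (fun t => y t + w t) (fun t => y₁ t + w₁ t) :=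
  ⟨fun t => (h.deriv_fst t).add (h'.deriv_fst t), fun t => by
    exact ((h.deriv_snd t).add (h'.deriv_snd t)).congr_deriv (by ring)⟩

theorem wronskian_const {w w₁ : ℝ → ℂ} (h : SolvesODE q y y₁) (h' : SolvesODE q w w₁) (s t : ℝ) :
    y s * w₁ s - y₁ s * w s = y t * w₁ t - y₁ t * w t := by
  have hd : ∀ t, HasDerivAt (fun t => y t * w₁ t - y₁ t * w t) 0 t := fun t => by
    exact (((h.deriv_fst t).mul (h'.deriv_snd t)).sub
      ((h.deriv_snd t).mul (h'.deriv_fst t))).congr_deriv (by ring)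
  exact is_const_of_deriv_eq_zero (fun t => (hd t).differentiableAt) (fun t => (hd t).deriv) s t

end SolvesODE

/-- Growth bound for `y'' = -q y + g` in terms of the Cauchy data at `a`. -/
theorem norm_le_of_cauchyData {y y₁ q g : ℝ → ℂ} {a b K M G : ℝ}
    (hy : ∀ t, HasDerivAt y (y₁ t) t) (hy₁ : ∀ t, HasDerivAt y₁ (-(q t * y t) + g t) t)
    (hK : 1 ≤ K) (hq : ∀ t ∈ Icc a b, ‖q t‖ ≤ K) (hg : ∀ t ∈ Icc a b, ‖g t‖ ≤ G)
    (h0 : ‖y a‖ ≤ M) (h1 : ‖y₁ a‖ ≤ M) :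
    ∀ t ∈ Icc a b, ‖y t‖ ≤ (M + G) * Real.exp (K * (b - a)) ∧
      ‖y₁ t‖ ≤ (M + G) * Real.exp (K * (b - a)) := by
  intro t ht
  have hab : a ≤ b := ht.1.trans ht.2
  have hG : 0 ≤ G := (norm_nonneg _).trans (hg a ⟨le_rfl, hab⟩)
  have hM : 0 ≤ M := (norm_nonneg _).trans h0
  have hd : ∀ t, HasDerivAt (fun t => (y t, y₁ t)) (y₁ t, -(q t * y t) + g t) t := fun t =>
    (hy t).prodMk (hy₁ t)
  -- Gronwall for the pair (y, y') in the sup norm; K ≥ 1 absorbs the row y' of the system.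
  have key := norm_le_gronwallBound_of_norm_deriv_right_le (f := fun t => (y t, y₁ t))
    (f' := fun t => (y₁ t, -(q t * y t) + g t)) (δ := M) (K := K) (ε := G) (a := a) (b := b)
    (fun t _ => (hd t).continuousAt.continuousWithinAt) (fun t _ => (hd t).hasDerivWithinAt)
    (by simpa [Prod.norm_def] using ⟨h0, h1⟩) (by
      intro t ht
      have ht' : t ∈ Icc a b := ⟨ht.1, ht.2.le⟩
      have e1 : ‖y t‖ ≤ ‖(y t, y₁ t)‖ := le_max_left _ _
      have e2 : ‖y₁ t‖ ≤ ‖(y t, y₁ t)‖ := le_max_right _ _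
      have e3 := norm_nonneg (y t, y₁ t)
      refine max_le ?_ ?_
      · show ‖y₁ t‖ ≤ _
        nlinarith
      · show ‖-(q t * y t) + g t‖ ≤ _
        refine (norm_add_le _ _).trans (add_le_add ?_ (hg t ht'))
        rw [norm_neg, norm_mul]
        exact mul_le_mul (hq t ht') e1 (norm_nonneg _) (by linarith)) t ht
  have hK0 : K ≠ 0 := by linarith
  have hb : gronwallBound M K G (t - a) ≤ (M + G) * Real.exp (K * (b - a)) := by
    rw [gronwallBound_of_K_ne_0 hK0]
    have e1 : Real.exp (K * (t - a)) ≤ Real.exp (K * (b - a)) := by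
      gcongr; exact ht.2
    have e2 : G / K ≤ G := div_le_self hG hK
    have e3 : 1 ≤ Real.exp (K * (t - a)) := Real.one_le_exp (by nlinarith [ht.1])
    have e4 : G / K * (Real.exp (K * (t - a)) - 1) ≤ G * Real.exp (K * (b - a)) := by
      refine mul_le_mul e2 (by linarith) (by linarith) hG
    nlinarith
  exact ⟨(le_max_left _ _).trans (key.trans hb), (le_max_right _ _).trans (key.trans hb)⟩

/-- The identity `(Im (y' ȳ))' = -Im q |y|²` for `y'' = -q y`. -/
theorem im_deriv_mul_conj {y y₁ q : ℝ → ℂ} {t : ℝ} (hy : HasDerivAt y (y₁ t) t)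
    (hy₁ : HasDerivAt y₁ (-(q t * y t)) t) :
    HasDerivAt (fun s => (y₁ s * (starRingEnd ℂ) (y s)).im) (-(q t).im * Complex.normSq (y t)) t := by
  have h1 : HasDerivAt (fun s => (starRingEnd ℂ) (y s)) ((starRingEnd ℂ) (y₁ t)) t :=
    (Complex.conjCLE.toContinuousLinearMap.hasFDerivAt.comp_hasDerivAt t hy)
  have h2 := hy₁.mul h1
  have h3 := Complex.imCLM.hasFDerivAt.comp_hasDerivAt t h2
  refine h3.congr_deriv ?_
  simp [Complex.mul_im, Complex.normSq_apply]
  ring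

/-- If `Im q` is a nonzero constant and `Im (y' ȳ)` has the same value at both ends of the interval,
then a solution of `y'' = -q y` vanishes there. -/
theorem eqOn_zero_of_im_eq {y y₁ q : ℝ → ℂ} {a b c : ℝ} (hc : c ≠ 0)
    (hyc : ContinuousOn y (Icc a b)) (hy₁c : ContinuousOn y₁ (Icc a b))
    (hy : ∀ t ∈ Ioo a b, HasDerivAt y (y₁ t) t)
    (hy₁ : ∀ t ∈ Ioo a b, HasDerivAt y₁ (-(q t * y t)) t) (hq : ∀ t, (q t).im = c)
    (hab : a < b)
    (hE : (y₁ a * (starRingEnd ℂ) (y a)).im = (y₁ b * (starRingEnd ℂ) (y b)).im) :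
    ∀ t ∈ Icc a b, y t = 0 := by
  have hcont : ContinuousOn (fun s => (y₁ s * (starRingEnd ℂ) (y s)).im) (Icc a b) :=
    Complex.continuous_im.comp_continuousOn
      (hy₁c.mul (Complex.continuous_conj.comp_continuousOn hyc))
  have hNc : ContinuousOn (fun s => Complex.normSq (y s)) (Icc a b) :=
    Complex.continuous_normSq.comp_continuousOn hyc
  have hint : IntervalIntegrable (fun t => -c * Complex.normSq (y t)) volume a b :=
    ContinuousOn.intervalIntegrable (by rw [uIcc_of_le hab.le]; exact continuousOn_const.mul hNc)
  have h := intervalIntegral.integral_eq_sub_of_hasDeriv_right_of_le hab.le hcont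
    (fun t ht => (by simpa [hq] using im_deriv_mul_conj (hy t ht) (hy₁ t ht) :
      HasDerivAt _ (-c * Complex.normSq (y t)) t).hasDerivWithinAt) hint
  rw [← hE, sub_self, intervalIntegral.integral_const_mul] at h
  have h0 : ∫ t in a..b, Complex.normSq (y t) = 0 := by
    rcases mul_eq_zero.1 h with h | h
    · exact absurd (neg_eq_zero.1 h) hc
    · exact h
  by_contra! hcon
  obtain ⟨t, ht, hne⟩ := hcon
  have := intervalIntegral.integral_pos hab hNc (fun x _ => Complex.normSq_nonneg _)
    ⟨t, ht, Complex.normSq_pos.2 hne⟩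
  linarith

/-- The identity for Im(y' ȳ), used through the sign of σ Im q. In the application σ = Re√z, which
has the sign of Im z. -/
theorem im_le_of_sign {y y₁ q : ℝ → ℂ} {a b : ℝ}
    (hy : ∀ t, HasDerivAt y (y₁ t) t) (hy₁ : ∀ t, HasDerivAt y₁ (-(q t * y t)) t) {σ : ℝ}
    (hq : ∀ t, 0 ≤ σ * (q t).im) (hab : a ≤ b) :
    σ * (y₁ b * (starRingEnd ℂ) (y b)).im ≤ σ * (y₁ a * (starRingEnd ℂ) (y a)).im := by
  have hd := fun t => (im_deriv_mul_conj (hy t) (hy₁ t)).const_mul σ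
  refine antitone_of_deriv_nonpos (fun t => (hd t).differentiableAt) (fun t => ?_) hab
  rw [(hd t).deriv]
  nlinarith [hq t, Complex.normSq_nonneg (y t), mul_nonneg (hq t) (Complex.normSq_nonneg (y t))]

/-! ### Primitives of integrable functions and weak derivatives on the line -/

/-- `H` is a primitive of the integrable function `h` on `[a, b]`. -/
structure IsPrim (a b : ℝ) (H h : ℝ → ℂ) : Prop where
  integrable : IntervalIntegrable h volume a b
  eq : ∀ s ∈ Icc a b, H s = H a + ∫ t in a..s, h t

namespace IsPrim
variable {a b : ℝ} {H h G g : ℝ → ℂ}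

theorem mono (hH : IsPrim a b H h) {s : ℝ} (hs : s ∈ Icc a b) : IsPrim a s H h :=
  ⟨hH.integrable.mono_set (by
    rw [uIcc_of_le hs.1, uIcc_of_le (hs.1.trans hs.2)]; exact Icc_subset_Icc_right hs.2),
    fun t ht => hH.eq t ⟨ht.1, ht.2.trans hs.2⟩⟩

theorem continuousOn (hab : a ≤ b) (hH : IsPrim a b H h) : ContinuousOn H (Icc a b) := by
  have h1 : IntegrableOn h (uIcc a b) := by
    rw [uIcc_of_le hab, integrableOn_Icc_iff_integrableOn_Ioc]
    exact (intervalIntegrable_iff_integrableOn_Ioc_of_le hab).1 hH.integrable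
  have h2 := intervalIntegral.continuousOn_primitive_interval h1
  rw [uIcc_of_le hab] at h2
  exact (continuousOn_const.add h2).congr hH.eq

theorem congr (hH : IsPrim a b H h) (hab : a ≤ b) (h1 : ∀ t ∈ Icc a b, G t = H t)
    (h2 : ∀ᵐ t ∂(volume.restrict (Ioo a b)), g t = h t) : IsPrim a b G g := by
  have h3 : ∀ᵐ t ∂(volume.restrict (Ioc a b)), g t = h t := by
    rwa [← Measure.restrict_congr_set Ioo_ae_eq_Ioc]
  refine ⟨hH.integrable.congr_ae ?_, fun s hs => ?_⟩
  · rw [uIoc_of_le hab]; filter_upwards [h3] with t ht using ht.symm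
  · rw [h1 s hs, h1 a ⟨le_rfl, hab⟩, hH.eq s hs]
    congr 1
    refine intervalIntegral.integral_congr_ae_restrict ?_
    rw [uIoc_of_le hs.1]
    filter_upwards [ae_restrict_of_ae_restrict_of_subset (Ioc_subset_Ioc_right hs.2) h3]
      with t ht using ht.symm

theorem const (c : ℂ) : IsPrim a b (fun _ => c) (fun _ => 0) :=
  ⟨intervalIntegrable_const, fun s _ => by simp⟩

theorem add (hH : IsPrim a b H h) (hG : IsPrim a b G g) :
    IsPrim a b (fun t => H t + G t) (fun t => h t + g t) :=
  ⟨hH.integrable.add hG.integrable, fun s hs => by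
    rw [intervalIntegral.integral_add (hH.mono hs).integrable (hG.mono hs).integrable, hH.eq s hs,
      hG.eq s hs]
    ring⟩

theorem const_mul (hH : IsPrim a b H h) (c : ℂ) : IsPrim a b (fun t => c * H t) (fun t => c * h t) :=
  ⟨hH.integrable.const_mul c, fun s hs => by
    rw [intervalIntegral.integral_const_mul, hH.eq s hs]; ring⟩

theorem of_integrable (hg : IntervalIntegrable g volume a b) :
    IsPrim a b (fun s => ∫ t in a..s, g t) g :=
  ⟨hg, fun s _ => by simp⟩

/-- Fubini on the triangle r ≤ t. This replaces integration by parts, since `h` is merely integrable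
and its primitive need not be differentiable everywhere. -/
theorem integral_mul_primitive {e e' : ℝ → ℂ} (he : ∀ t, HasDerivAt e (e' t) t)
    (he' : Continuous e') (hab : a ≤ b) (hh : IntervalIntegrable h volume a b) :
    ∫ t in a..b, e' t * ∫ r in a..t, h r = ∫ r in a..b, (e b - e r) * h r := by
  have hhI : IntegrableOn h (Ioc a b) := (intervalIntegrable_iff_integrableOn_Ioc_of_le hab).1 hh
  have heI : IntegrableOn e' (Ioc a b) := he'.integrableOn_Ioc
  have hprod : Integrable (Function.uncurry fun t r : ℝ =>
      {p : ℝ × ℝ | p.2 ≤ p.1}.indicator (fun p => e' p.1 * h p.2) (t, r))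
      ((volume.restrict (Ioc a b)).prod (volume.restrict (Ioc a b))) :=
    (heI.mul_prod hhI).indicator (measurableSet_le measurable_snd measurable_fst)
  rw [intervalIntegral.integral_of_le hab, intervalIntegral.integral_of_le hab]
  have h1 : ∫ t in Ioc a b, e' t * ∫ r in a..t, h r = ∫ t in Ioc a b, ∫ r in Ioc a b,
      {p : ℝ × ℝ | p.2 ≤ p.1}.indicator (fun p => e' p.1 * h p.2) (t, r) := by
    refine setIntegral_congr_fun measurableSet_Ioc fun t ht => ?_
    have : ∀ r, {p : ℝ × ℝ | p.2 ≤ p.1}.indicator (fun p => e' p.1 * h p.2) (t, r)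
        = (Iic t).indicator (fun r => e' t * h r) r := fun r => by
      simp only [indicator_apply, mem_ofPred_eq, mem_Iic]
    simp only [this]
    rw [setIntegral_indicator measurableSet_Iic, integral_const_mul,
      intervalIntegral.integral_of_le ht.1.le]
    congr 3
    ext r; simp only [mem_inter_iff, mem_Ioc, mem_Iic]
    exact ⟨fun h => ⟨⟨h.1, h.2.trans ht.2⟩, h.2⟩, fun h => ⟨h.1.1, h.2⟩⟩
  rw [h1, integral_integral_swap hprod]
  refine setIntegral_congr_fun measurableSet_Ioc fun r hr => ?_
  have : ∀ t, {p : ℝ × ℝ | p.2 ≤ p.1}.indicator (fun p => e' p.1 * h p.2) (t, r)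
      = (Ici r).indicator (fun t => e' t * h r) t := fun t => by
    simp only [indicator_apply, mem_ofPred_eq, mem_Ici]
  simp only [this]
  rw [setIntegral_indicator measurableSet_Ici, integral_mul_const]
  have h2 : Ioc a b ∩ Ici r = Icc r b := by
    ext t; simp only [mem_inter_iff, mem_Ioc, mem_Ici, mem_Icc]
    exact ⟨fun h => ⟨h.2, h.1.2⟩, fun h => ⟨⟨hr.1.trans_le h.1, h.2⟩, h.1⟩⟩
  rw [h2, integral_Icc_eq_integral_Ioc, ← intervalIntegral.integral_of_le hr.2,
    intervalIntegral.integral_eq_sub_of_hasDerivAt (fun t _ => he t)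
      (he'.intervalIntegrable _ _)]

/-- Product rule for a continuously differentiable function times a primitive. -/
theorem mul {e e' : ℝ → ℂ} (hab : a ≤ b) (he : ∀ t, HasDerivAt e (e' t) t) (he' : Continuous e')
    (hH : IsPrim a b H h) :
    IsPrim a b (fun t => e t * H t) (fun t => e' t * H t + e t * h t) := by
  have hec : Continuous e := continuous_iff_continuousAt.2 fun t => (he t).continuousAt
  refine ⟨?_, fun s hs => ?_⟩
  · refine IntervalIntegrable.add (ContinuousOn.intervalIntegrable ?_)
      (hH.integrable.continuousOn_mul hec.continuousOn)
    rw [uIcc_of_le hab]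
    exact he'.continuousOn.mul (hH.continuousOn hab)
  · have hHs := hH.mono hs
    have i1 : IntervalIntegrable (fun t => e' t * H t) volume a s := by
      refine ContinuousOn.intervalIntegrable ?_
      rw [uIcc_of_le hs.1]
      exact he'.continuousOn.mul (hHs.continuousOn hs.1)
    have i2 := hHs.integrable.continuousOn_mul hec.continuousOn
    have i3 : IntervalIntegrable (fun t => e' t * ∫ r in a..t, h r) volume a s := by
      refine ContinuousOn.intervalIntegrable ?_
      rw [uIcc_of_le hs.1]
      exact he'.continuousOn.mul ((of_integrable hHs.integrable).continuousOn hs.1)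
    have e1 : ∫ t in a..s, e' t * H t =
        (e s - e a) * H a + ∫ r in a..s, (e s - e r) * h r := by
      rw [← integral_mul_primitive he he' hs.1 hHs.integrable,
        ← intervalIntegral.integral_eq_sub_of_hasDerivAt (fun t _ => he t)
          (he'.intervalIntegrable a s), ← intervalIntegral.integral_mul_const,
        ← intervalIntegral.integral_add ((he'.intervalIntegrable _ _).mul_const _) i3]
      refine intervalIntegral.integral_congr fun t ht => ?_
      rw [uIcc_of_le hs.1] at ht
      rw [hHs.eq t ht]; ring
    have e2 : ∫ r in a..s, (e s - e r) * h r
        = e s * (∫ r in a..s, h r) - ∫ r in a..s, e r * h r := by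
      rw [← intervalIntegral.integral_const_mul,
        ← intervalIntegral.integral_sub (hHs.integrable.const_mul _) i2]
      congr 1; ext r; ring
    rw [intervalIntegral.integral_add i1 i2, e1, e2, hHs.eq s ⟨hs.1, le_rfl⟩]
    ring

theorem of_hasDerivAt {e e' : ℝ → ℂ} (he : ∀ t, HasDerivAt e (e' t) t) (he' : Continuous e') :
    IsPrim a b e e' :=
  ⟨he'.intervalIntegrable _ _, fun s _ => by
    rw [intervalIntegral.integral_eq_sub_of_hasDerivAt (fun t _ => he t)
      (he'.intervalIntegrable a s)]; ring⟩

end IsPrim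

/-- `F'` is the weak derivative of `F` on the set `I ⊆ ℝ`. -/
def HasWeakDerivLine (I : Set ℝ) (F F' : ℝ → ℂ) : Prop :=
  ∀ φ : ℝ → ℝ, ContDiff ℝ ∞ φ → HasCompactSupport φ → tsupport φ ⊆ I →
    ∫ t in I, deriv φ t • F t = - ∫ t in I, φ t • F' t

/-- The product rule integrated over the interval. Only the vanishing of φ at the two endpoints
matters, so the same identity serves the half-line after truncation. -/
theorem IsPrim.integral_deriv_smul {a b : ℝ} (hab : a ≤ b) {H h : ℝ → ℂ} (hH : IsPrim a b H h)
    {φ : ℝ → ℝ} (hφ : ContDiff ℝ ∞ φ) (ha : φ a = 0) (hb : φ b = 0) :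
    ∫ t in Ioo a b, deriv φ t • H t = - ∫ t in Ioo a b, φ t • h t := by
  have hφ' : Continuous (deriv φ) := hφ.continuous_deriv (by norm_num)
  have hd : ∀ t, HasDerivAt (fun t => (φ t : ℂ)) ((deriv φ t : ℝ) : ℂ) t := fun t =>
    ((hφ.differentiable (by norm_num)) t).hasDerivAt.ofReal_comp
  have key := (IsPrim.mul hab hd (by fun_prop) hH).eq b ⟨hab, le_rfl⟩
  have i1 : IntervalIntegrable (fun t => ((deriv φ t : ℝ) : ℂ) * H t) volume a b := by
    refine ContinuousOn.intervalIntegrable ?_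
    rw [uIcc_of_le hab]
    exact (Continuous.continuousOn (by fun_prop)).mul (hH.continuousOn hab)
  have i2 : IntervalIntegrable (fun t => ((φ t : ℝ) : ℂ) * h t) volume a b :=
    hH.integrable.continuousOn_mul
      (continuous_iff_continuousAt.2 fun t => (hd t).continuousAt).continuousOn
  rw [ha, hb, intervalIntegral.integral_add i1 i2] at key
  simp only [Complex.ofReal_zero, zero_mul, zero_add] at key
  simp only [Complex.real_smul]
  rw [← integral_Ioc_eq_integral_Ioo, ← integral_Ioc_eq_integral_Ioo,
    ← intervalIntegral.integral_of_le hab, ← intervalIntegral.integral_of_le hab]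
  linear_combination -key

theorem IsPrim.hasWeakDerivLine {a b : ℝ} (hab : a ≤ b) {H h : ℝ → ℂ} (hH : IsPrim a b H h) :
    HasWeakDerivLine (Ioo a b) H h := fun φ hφ _ hs =>
  hH.integral_deriv_smul hab hφ (image_eq_zero_of_notMem_tsupport fun h => by simpa using hs h)
    (image_eq_zero_of_notMem_tsupport fun h => by simpa using hs h)

theorem hasWeakDerivLine_Ioi {a : ℝ} {H h : ℝ → ℂ} (hH : ∀ b, a ≤ b → IsPrim a b H h) :
    HasWeakDerivLine (Ioi a) H h := by
  intro φ hφ hc hs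
  obtain ⟨R, hR⟩ := hc.isCompact.isBounded.subset_ball a
  -- Beyond b the test function vanishes, so the integrals over the half-line are integrals over (a,
  -- b).
  set b := max a (a + R) with hb
  have hab : a ≤ b := le_max_left _ _
  have hout : ∀ t, b ≤ t → t ∉ tsupport φ := by
    intro t ht hmem
    have := hR hmem
    rw [Metric.mem_ball, Real.dist_eq] at this
    have h2 := le_abs_self (t - a)
    have h3 := le_max_right a (a + R)
    linarith
  have hz : ∀ t, b ≤ t → φ t = 0 := fun t ht => image_eq_zero_of_notMem_tsupport (hout t ht)
  have hz' : ∀ t, b ≤ t → deriv φ t = 0 := fun t ht =>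
    image_eq_zero_of_notMem_tsupport fun h => hout t ht (tsupport_deriv_subset h)
  have key := (hH b hab).integral_deriv_smul hab hφ
    (image_eq_zero_of_notMem_tsupport fun h => by simpa using hs h) (hz b le_rfl)
  have red : ∀ g : ℝ → ℂ, (∀ t, b ≤ t → g t = 0) → ∫ t in Ioi a, g t = ∫ t in Ioo a b, g t := by
    intro g hg
    refine setIntegral_eq_of_subset_of_forall_sdiff_eq_zero measurableSet_Ioi
      (fun t ht => ht.1) fun t ht => hg t ?_
    by_contra hlt
    exact ht.2 ⟨ht.1, not_le.1 hlt⟩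
  rw [red _ fun t ht => by rw [hz' t ht, zero_smul], red _ fun t ht => by rw [hz t ht, zero_smul]]
  exact key

/-! ### The resolvent kernel of the Neumann operator -/

theorem memLp_Ioo_of_continuousOn {a b : ℝ} {h : ℝ → ℂ} (hh : ContinuousOn h (Icc a b))
    (p : ℝ≥0∞) : MemLp h p (volume.restrict (Ioo a b)) := by
  obtain ⟨C, hC⟩ := isCompact_Icc.exists_bound_of_continuousOn hh
  refine MemLp.of_bound ((hh.mono Ioo_subset_Icc_self).aestronglyMeasurable measurableSet_Ioo) C ?_
  filter_upwards [ae_restrict_mem measurableSet_Ioo] with t ht using hC t (Ioo_subset_Icc_self ht)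

theorem intervalIntegrable_of_memLp {a b : ℝ} (hab : a ≤ b) {h : ℝ → ℂ}
    (hh : MemLp h 2 (volume.restrict (Ioo a b))) : IntervalIntegrable h volume a b := by
  rw [intervalIntegrable_iff_integrableOn_Ioo_of_le hab]
  exact hh.integrable (by norm_num)

theorem IsPrim.hasDerivAt {a b : ℝ} {H h : ℝ → ℂ} (hH : IsPrim a b H h)
    (hh : ContinuousOn h (Icc a b)) {t : ℝ} (ht : t ∈ Ioo a b) : HasDerivAt H (h t) t := by
  have hI : Icc a b ∈ 𝓝 t := Icc_mem_nhds ht.1 ht.2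
  have h1 : HasDerivAt (fun s => H a + ∫ r in a..s, h r) (h t) t :=
    (intervalIntegral.integral_hasDerivAt_right
      (hH.mono (Ioo_subset_Icc_self ht)).integrable
      (hh.stronglyMeasurableAtFilter_nhdsWithin measurableSet_Icc t |>.filter_mono
        (by rw [nhdsWithin_eq_nhds.2 hI]))
      (hh.continuousAt hI)).const_add _
  refine h1.congr_of_eventuallyEq ?_
  filter_upwards [hI] with s hs using hH.eq s hs

theorem neumannMaps_iff {γ : ℝ → ℝ} {y k : ℝ → ℂ} :
    NeumannMaps γ y k ↔ ∃ y₁ y₂ : ℝ → ℂ, IsPrim (-1) 1 y y₁ ∧ IsPrim (-1) 1 y₁ y₂ ∧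
      MemLp y₂ 2 (volume.restrict (Ioo (-1) 1)) ∧ y₁ (-1) = 0 ∧ y₁ 1 = 0 ∧
      ∀ᵐ s ∂(volume.restrict (Ioo (-1) 1)), k s = -y₂ s - ((γ s ^ 2 / 4 : ℝ) : ℂ) * y s := by
  constructor
  · rintro ⟨y₁, y₂, hc, hm, h1, h2, hl, hr, hk⟩
    refine ⟨y₁, y₂, ⟨?_, h1⟩, ⟨intervalIntegrable_of_memLp (by norm_num) hm, h2⟩, hm, hl, hr, hk⟩
    exact ContinuousOn.intervalIntegrable (by rwa [uIcc_of_le (by norm_num)])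
  · rintro ⟨y₁, y₂, h1, h2, hm, hl, hr, hk⟩
    exact ⟨y₁, y₂, h2.continuousOn (by norm_num), hm, h1.eq, h2.eq, hl, hr, hk⟩

theorem NeumannMaps.sub {γ : ℝ → ℝ} {y k w l : ℝ → ℂ} (h : NeumannMaps γ y k)
    (h' : NeumannMaps γ w l) : NeumannMaps γ (fun s => y s - w s) (fun s => k s - l s) := by
  obtain ⟨y₁, y₂, h1, h2, h3, h4, h5, h6⟩ := neumannMaps_iff.1 h
  obtain ⟨w₁, w₂, g1, g2, g3, g4, g5, g6⟩ := neumannMaps_iff.1 h'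
  have i1 := h1.add (g1.const_mul (-1))
  have i2 := h2.add (g2.const_mul (-1))
  refine neumannMaps_iff.2 ⟨fun s => y₁ s - w₁ s, fun s => y₂ s - w₂ s, ?_, ?_, h3.sub g3, ?_, ?_, ?_⟩
  · convert i1 using 2 <;> ring
  · convert i2 using 2 <;> ring
  · simp [h4, g4]
  · simp [h5, g5]
  · filter_upwards [h6, g6] with s e1 e2
    rw [e1, e2]; ring

/-- The potential of the equation `h_v y = w y`, written as `y'' = -(γ²/4 + w) y`. -/
def shiftedPot (γ : ℝ → ℝ) (w : ℂ) (t : ℝ) : ℂ := ((γ t ^ 2 / 4 : ℝ) : ℂ) + w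

/-! ### Green function of the Neumann operator and uniqueness of its kernel. -/

section
variable {γ : ℝ → ℝ}

theorem continuous_shiftedPot (hγ : Continuous γ) (w : ℂ) : Continuous (shiftedPot γ w) := by
  unfold shiftedPot; fun_prop

theorem norm_shiftedPot_le (hγ1 : ∀ s, |γ s| < 1) (w : ℂ) (t : ℝ) :
    ‖shiftedPot γ w t‖ ≤ 1 / 4 + ‖w‖ := by
  refine (norm_add_le _ _).trans (add_le_add ?_ le_rfl)
  rw [Complex.norm_real, Real.norm_of_nonneg (by positivity)]
  have := (sq_lt_one_iff_abs_lt_one (γ t)).2 (hγ1 t)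
  linarith

theorem shiftedPot_im (w : ℂ) (t : ℝ) : (shiftedPot γ w t).im = w.im := by
  simp [shiftedPot, -Complex.ofReal_div, -Complex.ofReal_pow]

/-- A nonreal number is not an eigenvalue: the Neumann conditions make Im(y' ȳ) vanish at both ends.
The equation holds only almost everywhere at first; it provides a continuous second derivative, so
the pointwise identity applies. -/
theorem NeumannMaps.eq_zero {w : ℂ} (hγ : Continuous γ) (hw : w.im ≠ 0) {y : ℝ → ℂ}
    (h : NeumannMaps γ y (fun s => w * y s)) : ∀ s ∈ Icc (-1 : ℝ) 1, y s = 0 := by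
  obtain ⟨y₁, y₂, h1, h2, h3, h4, h5, h6⟩ := neumannMaps_iff.1 h
  have hy := h1.continuousOn (by norm_num)
  have hy₁ := h2.continuousOn (by norm_num)
  have hq : ContinuousOn (fun t => -(shiftedPot γ w t * y t)) (Icc (-1) 1) :=
    ((continuous_shiftedPot hγ w).continuousOn.mul hy).neg
  have h2' : IsPrim (-1) 1 y₁ (fun t => -(shiftedPot γ w t * y t)) := by
    refine h2.congr (by norm_num) (fun _ _ => rfl) ?_
    filter_upwards [h6] with t ht
    rw [shiftedPot, add_mul, ht]; ring
  exact eqOn_zero_of_im_eq hw hy hy₁ (fun t ht => h1.hasDerivAt hy₁ ht)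
    (fun t ht => h2'.hasDerivAt hq ht) (shiftedPot_im w) (by norm_num) (by simp [h4, h5])

/-- Solutions `a`, `b` of `h_v y = w y` with Neumann condition at `-1` and at `1`, respectively. -/
structure NeumannPair (γ : ℝ → ℝ) (w : ℂ) (a a₁ b b₁ : ℝ → ℂ) : Prop where
  left : SolvesODE (shiftedPot γ w) a a₁
  right : SolvesODE (shiftedPot γ w) b b₁
  left_val : a (-1) = 1
  left_deriv : a₁ (-1) = 0
  right_val : b 1 = 1
  right_deriv : b₁ 1 = 0

theorem exists_neumannPair (hγ : Continuous γ) (hγ1 : ∀ s, |γ s| < 1) (w : ℂ) :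
    ∃ a a₁ b b₁ : ℝ → ℂ, NeumannPair γ w a a₁ b b₁ := by
  obtain ⟨a, a₁, ha, h1, h2⟩ := SolvesODE.exists_of_bounded (continuous_shiftedPot hγ w)
    (norm_shiftedPot_le hγ1 w) (-1) 1 0
  obtain ⟨b, b₁, hb, h3, h4⟩ := SolvesODE.exists_of_bounded (continuous_shiftedPot hγ w)
    (norm_shiftedPot_le hγ1 w) 1 1 0
  exact ⟨a, a₁, b, b₁, ha, hb, h1, h2, h3, h4⟩

/-- The Green function of `h_v - w`. -/
def green (a b : ℝ → ℂ) (D : ℂ) (s s' : ℝ) : ℂ := D⁻¹ * (a (min s s') * b (max s s'))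

variable {w : ℂ} {a a₁ b b₁ : ℝ → ℂ}

theorem SolvesODE.isNeumannEigenvalue {y y₁ : ℝ → ℂ} (hγ : Continuous γ)
    (hy : SolvesODE (shiftedPot γ w) y y₁) (hl : y₁ (-1) = 0) (hr : y₁ 1 = 0)
    (hne : y (-1) ≠ 0) : IsNeumannEigenvalue γ w := by
  have hc : Continuous fun t => -(shiftedPot γ w t * y t) :=
    ((continuous_shiftedPot hγ w).mul hy.continuous_fst).neg
  refine ⟨y, ⟨-1, by norm_num, hne⟩, neumannMaps_iff.2 ⟨y₁, fun t => -(shiftedPot γ w t * y t),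
    .of_hasDerivAt hy.deriv_fst hy.continuous_snd, .of_hasDerivAt hy.deriv_snd hc,
    memLp_Ioo_of_continuousOn hc.continuousOn 2, hl, hr, Eventually.of_forall fun s => ?_⟩⟩
  simp only [shiftedPot]; ring

theorem NeumannPair.deriv_ne_zero (h : NeumannPair γ w a a₁ b b₁) (hγ : Continuous γ)
    (hw : w.im ≠ 0) : a₁ 1 ≠ 0 := by
  intro h0
  obtain ⟨y, ⟨s, hs, hne⟩, hy⟩ := h.left.isNeumannEigenvalue hγ h.left_deriv h0 (by simp [h.left_val])
  exact hne (hy.eq_zero hγ hw s hs)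

/-- The Wronskian is evaluated at the right end, where `b` is normalised. Thus `a₁ 1` is the
denominator of the Green function, and it vanishes exactly when `a` also satisfies the right Neumann
condition. -/
theorem NeumannPair.wronskian (h : NeumannPair γ w a a₁ b b₁) (t : ℝ) :
    a t * b₁ t - a₁ t * b t = -a₁ 1 := by
  rw [h.left.wronskian_const h.right t 1, h.right_val, h.right_deriv]; ring

theorem green_integral_eq (ha : Continuous a) (hb : Continuous b) (D : ℂ) {f : ℝ → ℂ}
    (hf : IntervalIntegrable f volume (-1) 1) {s : ℝ} (hs : s ∈ Icc (-1 : ℝ) 1) :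
    ∫ s' in Ioo (-1) 1, green a b D s s' * f s' =
      D⁻¹ * (b s * (∫ t in (-1)..s, a t * f t) +
        a s * ((∫ t in (-1)..1, b t * f t) - ∫ t in (-1)..s, b t * f t)) := by
  have hf1 : IntervalIntegrable f volume (-1) s := hf.mono_set (by
    rw [uIcc_of_le hs.1, uIcc_of_le (by norm_num)]; exact Icc_subset_Icc_right hs.2)
  have hf2 : IntervalIntegrable f volume s 1 := hf.mono_set (by
    rw [uIcc_of_le hs.2, uIcc_of_le (by norm_num)]; exact Icc_subset_Icc_left hs.1)
  have hg : Continuous fun s' => green a b D s s' := by unfold green; fun_prop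
  rw [← integral_Ioc_eq_integral_Ioo, ← intervalIntegral.integral_of_le (by norm_num),
    ← intervalIntegral.integral_add_adjacent_intervals (b := s)
      (hf1.continuousOn_mul hg.continuousOn) (hf2.continuousOn_mul hg.continuousOn),
    ← intervalIntegral.integral_add_adjacent_intervals (a := -1) (b := s) (c := 1)
      (hf1.continuousOn_mul hb.continuousOn) (hf2.continuousOn_mul hb.continuousOn), mul_add]
  congr 1
  · rw [← intervalIntegral.integral_const_mul, ← intervalIntegral.integral_const_mul]
    refine intervalIntegral.integral_congr fun t ht => ?_
    rw [uIcc_of_le hs.1] at ht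
    simp only [green, min_eq_right ht.2, max_eq_left ht.2]; ring
  · rw [add_sub_cancel_left, ← intervalIntegral.integral_const_mul,
      ← intervalIntegral.integral_const_mul]
    refine intervalIntegral.integral_congr fun t ht => ?_
    rw [uIcc_of_le hs.2] at ht
    simp only [green, min_eq_left ht.1, max_eq_right ht.1]; ring

/-- Variation of parameters: y = D⁻¹(bP + aQ) with P' = af and Q' = -bf. The terms in f cancel in
y', and in y'' they combine to -f by the Wronskian identity. -/
theorem NeumannPair.isResolventKernel (h : NeumannPair γ w a a₁ b b₁) (hγ : Continuous γ)
    (hw : w.im ≠ 0) : IsResolventKernel γ w (green a b (a₁ 1)) := by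
  have hac := h.left.continuous_fst
  have hbc := h.right.continuous_fst
  refine ⟨?_, fun f hf => ?_⟩
  · unfold green; exact Continuous.continuousOn (by fun_prop)
  have hD := h.deriv_ne_zero hγ hw
  set D := a₁ 1 with hDdef
  have hfi := intervalIntegrable_of_memLp (by norm_num) hf
  have hle : (-1 : ℝ) ≤ 1 := by norm_num
  set P : ℝ → ℂ := fun s => ∫ t in (-1)..s, a t * f t with hP
  set B : ℂ := ∫ t in (-1)..1, b t * f t with hB
  set Q : ℝ → ℂ := fun s => B + -1 * ∫ t in (-1)..s, b t * f t with hQ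
  have hPp : IsPrim (-1) 1 P (fun t => a t * f t) :=
    .of_integrable (hfi.continuousOn_mul hac.continuousOn)
  have hQp : IsPrim (-1) 1 Q (fun t => 0 + -1 * (b t * f t)) :=
    (IsPrim.const B).add
      ((IsPrim.of_integrable (hfi.continuousOn_mul hbc.continuousOn)).const_mul (-1))
  have hqc : Continuous (shiftedPot γ w) := continuous_shiftedPot hγ w
  set Y : ℝ → ℂ := fun s => D⁻¹ * (b s * P s + a s * Q s) with hY
  set Y₁ : ℝ → ℂ := fun s => D⁻¹ * (b₁ s * P s + a₁ s * Q s) with hY₁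
  have hYY : IsPrim (-1) 1 Y Y₁ := by
    refine (((IsPrim.mul hle h.right.deriv_fst h.right.continuous_snd hPp).add
      (IsPrim.mul hle h.left.deriv_fst h.left.continuous_snd hQp)).const_mul D⁻¹).congr hle
      (fun _ _ => rfl) (Eventually.of_forall fun t => ?_)
    simp only [hY₁]; ring
  have hYc : ContinuousOn Y (Icc (-1) 1) := hYY.continuousOn hle
  have hY₁Y : IsPrim (-1) 1 Y₁ (fun t => -(shiftedPot γ w t * Y t) - f t) := by
    refine (((IsPrim.mul hle h.right.deriv_snd (hqc.mul hbc).neg hPp).add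
      (IsPrim.mul hle h.left.deriv_snd (hqc.mul hac).neg hQp)).const_mul D⁻¹).congr hle
      (fun _ _ => rfl) (Eventually.of_forall fun t => ?_)
    have hW := h.wronskian t
    simp only [hY]
    have : f t = -(D⁻¹ * (a t * b₁ t - a₁ t * b t)) * f t := by
      rw [hW, ← hDdef]; field_simp
    linear_combination -this
  have hyY : ∀ s ∈ Icc (-1 : ℝ) 1, ∫ s' in Ioo (-1) 1, green a b D s s' * f s' = Y s := by
    intro s hs
    rw [green_integral_eq hac hbc D hfi hs]
    simp only [hY, hP, hQ]; ring
  refine neumannMaps_iff.2 ⟨Y₁, _, hYY.congr hle hyY (Eventually.of_forall fun _ => rfl), hY₁Y,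
    ((memLp_Ioo_of_continuousOn (hqc.continuousOn.mul hYc) 2).neg).sub hf, ?_, ?_, ?_⟩
  · simp [hY₁, hP, h.left_deriv]
  · simp [hY₁, hQ, hB, h.right_deriv]
  · filter_upwards [ae_restrict_mem measurableSet_Ioo] with s hs
    simp only [hyY s (Ioo_subset_Icc_self hs), shiftedPot]; ring

/-- For fixed s, both kernels are applied to the complex conjugate of their difference in s'.
Uniqueness for the boundary problem makes the integral of the squared modulus zero, and continuity
upgrades this to every s', endpoints included. Hence the arbitrary choice in `rV` is harmless there.
-/
theorem IsResolventKernel.eqOn {r r' : ℝ → ℝ → ℂ} (hγ : Continuous γ) (hw : w.im ≠ 0)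
    (hr : IsResolventKernel γ w r) (hr' : IsResolventKernel γ w r') {s s' : ℝ}
    (hs : s ∈ Icc (-1 : ℝ) 1) (hs' : s' ∈ Icc (-1 : ℝ) 1) : r s s' = r' s s' := by
  have hslice : ∀ {r : ℝ → ℝ → ℂ}, IsResolventKernel γ w r → ContinuousOn (r s) (Icc (-1) 1) :=
    fun h => h.1.comp (f := fun t => (s, t)) (by fun_prop) fun t ht => ⟨hs, ht⟩
  set d : ℝ → ℂ := fun t => r s t - r' s t with hd
  have hdc : ContinuousOn d (Icc (-1) 1) := (hslice hr).sub (hslice hr')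
  have hcc : ContinuousOn (fun t => (starRingEnd ℂ) (d t)) (Icc (-1) 1) :=
    Complex.continuous_conj.comp_continuousOn hdc
  set f : ℝ → ℂ := fun t => (starRingEnd ℂ) (d t) with hf
  have hfm := memLp_Ioo_of_continuousOn hcc 2
  have hy := (hr.2 f hfm).sub (hr'.2 f hfm)
  have hint : ∀ {r : ℝ → ℝ → ℂ}, IsResolventKernel γ w r →
      Integrable (fun t => r s t * f t) (volume.restrict (Ioo (-1) 1)) := fun h =>
    memLp_one_iff_integrable.1 (memLp_Ioo_of_continuousOn ((hslice h).mul hcc) 1)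
  have h0 := NeumannMaps.eq_zero hγ hw (y := fun s => (∫ t in Ioo (-1) 1, r s t * f t) -
    ∫ t in Ioo (-1) 1, r' s t * f t) (by convert hy using 2; ring) s hs
  rw [← integral_sub (hint hr) (hint hr')] at h0
  have h1 : ∫ t in (-1 : ℝ)..1, Complex.normSq (d t) = 0 := by
    rw [intervalIntegral.integral_of_le (by norm_num), integral_Ioc_eq_integral_Ioo]
    have h2 : ∫ t in Ioo (-1 : ℝ) 1, ((Complex.normSq (d t) : ℝ) : ℂ) = 0 := by
      rw [← h0]
      refine integral_congr_ae (Eventually.of_forall fun t => ?_)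
      simp only [← Complex.mul_conj, hf, hd]; ring
    rw [integral_complex_ofReal] at h2
    exact_mod_cast h2
  by_contra hne
  have := intervalIntegral.integral_pos (by norm_num : (-1 : ℝ) < 1)
    (Complex.continuous_normSq.comp_continuousOn hdc) (fun x _ => Complex.normSq_nonneg _)
    ⟨s', hs', Complex.normSq_pos.2 (sub_ne_zero.2 hne)⟩
  exact this.ne' h1

theorem NeumannPair.rV_eq (h : NeumannPair γ w a a₁ b b₁) (hγ : Continuous γ)
    (hw : w.im ≠ 0) {s s' : ℝ} (hs : s ∈ Icc (-1 : ℝ) 1) (hs' : s' ∈ Icc (-1 : ℝ) 1) :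
    rV γ w s s' = green a b (a₁ 1) s s' := by
  have hex : ∃ r, IsResolventKernel γ w r := ⟨_, h.isResolventKernel hγ hw⟩
  rw [rV, dif_pos hex]
  exact hex.choose_spec.eqOn hγ hw (h.isResolventKernel hγ hw) hs hs'

theorem NeumannPair.rV_neg_one (h : NeumannPair γ w a a₁ b b₁) (hγ : Continuous γ)
    (hw : w.im ≠ 0) {s : ℝ} (hs : s ∈ Icc (-1 : ℝ) 1) : rV γ w s (-1) = (a₁ 1)⁻¹ * b s := by
  rw [h.rV_eq hγ hw hs (by norm_num), green, min_eq_right hs.1, max_eq_left hs.1, h.left_val, one_mul]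

theorem NeumannPair.rV_one (h : NeumannPair γ w a a₁ b b₁) (hγ : Continuous γ)
    (hw : w.im ≠ 0) {s : ℝ} (hs : s ∈ Icc (-1 : ℝ) 1) : rV γ w s 1 = (a₁ 1)⁻¹ * a s := by
  rw [h.rV_eq hγ hw hs (by norm_num), green, min_eq_left hs.2, max_eq_right hs.2, h.right_val, mul_one]

/-- The combination `ξ₁ r_v(w; ·, -1) + ξ₂ r_v(w; ·, 1)` solves `h_v y = w y` with
`y'(-1) = -ξ₁` and `y'(1) = ξ₂`. -/
theorem exists_solvesODE_rV (hγ : Continuous γ) (hγ1 : ∀ s, |γ s| < 1) (hw : w.im ≠ 0)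
    (ξ₁ ξ₂ : ℂ) : ∃ y y₁ : ℝ → ℂ, SolvesODE (shiftedPot γ w) y y₁ ∧
      (∀ s ∈ Icc (-1 : ℝ) 1, y s = ξ₁ * rV γ w s (-1) + ξ₂ * rV γ w s 1) ∧
      y₁ (-1) = -ξ₁ ∧ y₁ 1 = ξ₂ := by
  obtain ⟨a, a₁, b, b₁, h⟩ := exists_neumannPair hγ hγ1 w
  have hD := h.deriv_ne_zero hγ hw
  refine ⟨_, _, (h.right.const_mul (ξ₁ * (a₁ 1)⁻¹)).add (h.left.const_mul (ξ₂ * (a₁ 1)⁻¹)),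
    fun s hs => ?_, ?_, ?_⟩
  · rw [h.rV_neg_one hγ hw hs, h.rV_one hγ hw hs]; ring
  · have := h.wronskian (-1)
    rw [h.left_val, h.left_deriv, zero_mul, one_mul, sub_zero] at this
    rw [this, h.left_deriv]; field_simp; ring
  · rw [h.right_deriv]; field_simp; ring

end

/-! ### The resolvent of the Dirichlet Laplacian on the half-line -/

theorem lintegral_exp_neg_abs_ne_top {μ : ℝ} (hμ : 0 < μ) :
    ∫⁻ x : ℝ, ENNReal.ofReal (Real.exp (-(μ * |x|))) ≠ ⊤ := by
  have h1 : IntegrableOn (fun x : ℝ => Real.exp (-(μ * |x|))) (Ioi 0) := by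
    refine (integrableOn_exp_mul_Ioi (a := -μ) (by linarith) 0).congr_fun (fun x hx => ?_)
      measurableSet_Ioi
    simp only [abs_of_pos (mem_Ioi.1 hx)]; ring_nf
  have h2 : IntegrableOn (fun x : ℝ => Real.exp (-(μ * |x|))) (Iic 0) := by
    refine (integrableOn_exp_mul_Iic hμ 0).congr_fun (fun x hx => ?_) measurableSet_Iic
    simp only [abs_of_nonpos (mem_Iic.1 hx)]; ring_nf
  have h3 := h2.union h1
  rw [Iic_union_Ioi, integrableOn_univ] at h3
  exact h3.lintegral_lt_top.ne

/-- Cauchy–Schwarz inequality for a weighted integral. -/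
theorem sq_lintegral_mul_le {α : Type*} [MeasurableSpace α] {ν : Measure α} {k g : α → ℝ≥0∞}
    (hk : AEMeasurable k ν) (hg : AEMeasurable g ν) :
    (∫⁻ x, k x * g x ∂ν) ^ 2 ≤ (∫⁻ x, k x ∂ν) * ∫⁻ x, k x * g x ^ 2 ∂ν := by
  have h := ENNReal.lintegral_mul_le_Lp_mul_Lq ν (p := 2) (q := 2) Real.HolderConjugate.two_two
    (f := fun x => k x ^ (1 / 2 : ℝ)) (g := fun x => k x ^ (1 / 2 : ℝ) * g x)
    (hk.pow_const _) ((hk.pow_const _).mul hg)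
  have e1 : ∀ x, ((fun x => k x ^ (1 / 2 : ℝ)) * fun x => k x ^ (1 / 2 : ℝ) * g x) x
      = k x * g x := fun x => by
    simp only [Pi.mul_apply]
    rw [← mul_assoc, ← ENNReal.rpow_add_of_nonneg _ _ (by norm_num) (by norm_num)]
    norm_num
  have e2 : ∀ x, (k x ^ (1 / 2 : ℝ)) ^ (2 : ℝ) = k x := fun x => by
    rw [← ENNReal.rpow_mul]; norm_num
  have e3 : ∀ x, (k x ^ (1 / 2 : ℝ) * g x) ^ (2 : ℝ) = k x * g x ^ 2 := fun x => by
    rw [ENNReal.mul_rpow_of_nonneg _ _ (by norm_num), e2]; norm_num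
  simp only [e1, e2, e3] at h
  calc (∫⁻ x, k x * g x ∂ν) ^ 2 ≤ _ := pow_le_pow_left' h 2
    _ = _ := by
      rw [mul_pow, ← ENNReal.rpow_natCast, ← ENNReal.rpow_natCast, ← ENNReal.rpow_mul,
        ← ENNReal.rpow_mul]
      norm_num

/-- A function bounded by the convolution of an `L²` function with `exp (-μ |·|)` is in `L²`. -/
theorem memLp_of_enorm_le_convolution {μ : ℝ} (hμ : 0 < μ) {I : Set ℝ} {f h : ℝ → ℂ}
    (hf : MemLp f 2 (volume.restrict I)) (hI : MeasurableSet I)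
    (hh : AEStronglyMeasurable h (volume.restrict I))
    (hb : ∀ s ∈ I, ‖h s‖ₑ ≤ ∫⁻ t in I, ENNReal.ofReal (Real.exp (-(μ * |s - t|))) * ‖f t‖ₑ) :
    MemLp h 2 (volume.restrict I) := by
  refine ⟨hh, (eLpNorm_lt_top_iff_lintegral_rpow_enorm_lt_top (by norm_num) (by norm_num)).2 ?_⟩
  have hf2 := (eLpNorm_lt_top_iff_lintegral_rpow_enorm_lt_top (by norm_num) (by norm_num)).1 hf.2
  simp only [ENNReal.toReal_ofNat, ENNReal.rpow_ofNat] at hf2 ⊢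
  set C := ∫⁻ x : ℝ, ENNReal.ofReal (Real.exp (-(μ * |x|))) with hC
  set k : ℝ → ℝ → ℝ≥0∞ := fun s t => ENNReal.ofReal (Real.exp (-(μ * |s - t|))) with hk
  have hkm : Measurable fun p : ℝ × ℝ => k p.1 p.2 := by
    simp only [hk]; fun_prop
  have hkm1 : ∀ s, Measurable (k s) := fun s => by simp only [hk]; fun_prop
  have hkm2 : ∀ t, Measurable fun s => k s t := fun t => by simp only [hk]; fun_prop
  have hfm : AEMeasurable (fun t => ‖f t‖ₑ) (volume.restrict I) := hf.1.enorm
  have hk1 : ∀ s, ∫⁻ t in I, k s t ≤ C := fun s => by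
    refine (setLIntegral_le_lintegral I _).trans (le_of_eq ?_)
    exact lintegral_sub_left_eq_self (fun x => ENNReal.ofReal (Real.exp (-(μ * |x|)))) s
  have hk2 : ∀ t, ∫⁻ s in I, k s t ≤ C := fun t => by
    refine (setLIntegral_le_lintegral I _).trans (le_of_eq ?_)
    exact lintegral_sub_right_eq_self (fun x => ENNReal.ofReal (Real.exp (-(μ * |x|)))) t
  -- Schur test: Cauchy–Schwarz with the kernel as weight, then Tonelli; each integral of the kernel
  -- in one variable is at most C.
  calc ∫⁻ s in I, ‖h s‖ₑ ^ 2
      ≤ ∫⁻ s in I, C * ∫⁻ t in I, k s t * ‖f t‖ₑ ^ 2 := by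
        refine setLIntegral_mono' hI fun s hs => ?_
        refine (pow_le_pow_left' (hb s hs) 2).trans ((sq_lintegral_mul_le
          (hkm1 s).aemeasurable hfm).trans ?_)
        gcongr
        exact hk1 s
    _ = C * ∫⁻ t in I, ∫⁻ s in I, k s t * ‖f t‖ₑ ^ 2 := by
        rw [lintegral_const_mul' _ _ (lintegral_exp_neg_abs_ne_top hμ), lintegral_lintegral_swap]
        exact hkm.aemeasurable.mul ((hfm.comp_snd).pow_const 2)
    _ ≤ C * ∫⁻ t in I, C * ‖f t‖ₑ ^ 2 := by
        gcongr with t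
        rw [lintegral_mul_const _ (hkm2 t)]
        gcongr
        exact hk2 t
    _ = C * (C * ∫⁻ t in I, ‖f t‖ₑ ^ 2) := by
        rw [lintegral_const_mul' _ _ (lintegral_exp_neg_abs_ne_top hμ)]
    _ < ⊤ := by
        have := (lintegral_exp_neg_abs_ne_top hμ).lt_top
        exact ENNReal.mul_lt_top this (ENNReal.mul_lt_top this hf2)

/-- The exponential `exp (i κ s)`. -/
def expI (κ : ℂ) (s : ℝ) : ℂ := Complex.exp (Complex.I * κ * (s : ℂ))

theorem hasDerivAt_expI (κ : ℂ) (s : ℝ) :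
    HasDerivAt (expI κ) (Complex.I * κ * expI κ s) s := by
  have h : HasDerivAt (fun t : ℝ => Complex.I * κ * (t : ℂ)) (Complex.I * κ * 1) s :=
    (Complex.ofRealCLM.hasDerivAt (x := s)).const_mul (Complex.I * κ)
  exact h.cexp.congr_deriv (by rw [expI]; ring)

theorem continuous_expI (κ : ℂ) : Continuous (expI κ) := by
  unfold expI; fun_prop

theorem norm_expI (κ : ℂ) (s : ℝ) : ‖expI κ s‖ = Real.exp (-(κ.im * s)) := by
  rw [expI, Complex.norm_exp]
  congr 1
  simp [Complex.mul_re, Complex.mul_im]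

theorem expI_neg_mul (κ : ℂ) (s : ℝ) : expI (-κ) s * expI κ s = 1 := by
  rw [expI, expI, ← Complex.exp_add]
  simp

theorem memLp_expI {κ : ℂ} (hκ : 0 < κ.im) : MemLp (expI κ) 2 (volume.restrict (Ioi 0)) := by
  refine (memLp_two_iff_integrable_sq_norm (continuous_expI κ).aestronglyMeasurable).2 ?_
  refine (integrableOn_exp_mul_Ioi (a := -(2 * κ.im)) (by linarith) 0).congr_fun (fun s _ => ?_)
    measurableSet_Ioi
  simp only [norm_expI]
  rw [← Real.exp_nat_mul]; congr 1; push_cast; ring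

/-! ### One-sided exponential integrals on the half-line. -/

section
variable {κ : ℂ} {f : ℝ → ℂ}

theorem integrable_expI_mul (hκ : 0 < κ.im) (hf : MemLp f 2 (volume.restrict (Ioi 0))) :
    IntegrableOn (fun t => expI κ t * f t) (Ioi 0) :=
  (memLp_expI hκ).integrable_mul hf

theorem enorm_integral_expI_mul_le (hκ : 0 < κ.im) (hf : MemLp f 2 (volume.restrict (Ioi 0))) :
    ‖∫ t in Ioi (0 : ℝ), expI κ t * f t‖ₑ ≤
      eLpNorm (expI κ) 2 (volume.restrict (Ioi 0)) * eLpNorm f 2 (volume.restrict (Ioi 0)) := by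
  refine (enorm_integral_le_lintegral_enorm _).trans ?_
  rw [← eLpNorm_one_eq_lintegral_enorm]
  have h := eLpNorm_smul_le_mul_eLpNorm (p := 2) (q := 2) (r := 1) hf.1 (memLp_expI hκ).1
  exact h

theorem intervalIntegrable_of_memLp_Ioi (hf : MemLp f 2 (volume.restrict (Ioi 0))) {b : ℝ}
    (hb : 0 ≤ b) : IntervalIntegrable f volume 0 b :=
  intervalIntegrable_of_memLp hb (hf.mono_measure (Measure.restrict_mono_set _ Ioo_subset_Ioi_self))

/-- The left half of the integral operator with kernel `exp (iκ|s - t|)`. -/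
def expLeft (κ : ℂ) (f : ℝ → ℂ) (s : ℝ) : ℂ := expI κ s * ∫ t in (0 : ℝ)..s, expI (-κ) t * f t

/-- The right half of the integral operator with kernel `exp (iκ|s - t|)`. -/
def expRight (κ : ℂ) (f : ℝ → ℂ) (s : ℝ) : ℂ :=
  expI (-κ) s * ((∫ t in Ioi (0 : ℝ), expI κ t * f t) + -1 * ∫ t in (0 : ℝ)..s, expI κ t * f t)

theorem isPrim_expLeft (hf : MemLp f 2 (volume.restrict (Ioi 0))) {b : ℝ} (hb : 0 ≤ b) :
    IsPrim 0 b (expLeft κ f) (fun s => Complex.I * κ * expLeft κ f s + f s) := by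
  have h := IsPrim.mul hb (hasDerivAt_expI κ)
    (continuous_const.mul (continuous_expI κ)) (IsPrim.of_integrable
      ((intervalIntegrable_of_memLp_Ioi hf hb).continuousOn_mul (continuous_expI (-κ)).continuousOn))
  refine h.congr hb (fun _ _ => rfl) (Eventually.of_forall fun t => ?_)
  simp only [expLeft]
  linear_combination (-f t) * expI_neg_mul κ t

theorem isPrim_expRight (hf : MemLp f 2 (volume.restrict (Ioi 0))) {b : ℝ} (hb : 0 ≤ b) :
    IsPrim 0 b (expRight κ f) (fun s => -(Complex.I * κ) * expRight κ f s - f s) := by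
  have h := IsPrim.mul hb (hasDerivAt_expI (-κ))
    (continuous_const.mul (continuous_expI (-κ)))
    ((IsPrim.const (∫ t in Ioi (0 : ℝ), expI κ t * f t)).add ((IsPrim.of_integrable
      ((intervalIntegrable_of_memLp_Ioi hf hb).continuousOn_mul
        (continuous_expI κ).continuousOn)).const_mul (-1)))
  refine h.congr hb (fun _ _ => rfl) (Eventually.of_forall fun t => ?_)
  simp only [expRight]
  linear_combination (f t) * expI_neg_mul κ t

/-- The definition subtracts the integral over (0, s) from a constant, which is convenient for
differentiation; this tail form is the one that gives decay. -/
theorem expRight_eq (hκ : 0 < κ.im) (hf : MemLp f 2 (volume.restrict (Ioi 0))) {s : ℝ}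
    (hs : 0 ≤ s) : expRight κ f s = expI (-κ) s * ∫ t in Ioi s, expI κ t * f t := by
  have hi := integrable_expI_mul hκ hf
  rw [expRight, intervalIntegral.integral_of_le hs, ← Ioc_union_Ioi_eq_Ioi hs,
    setIntegral_union (Ioc_disjoint_Ioi le_rfl) measurableSet_Ioi
      (hi.mono_set Ioc_subset_Ioi_self) (hi.mono_set (Ioi_subset_Ioi hs))]
  ring

theorem expI_abs_eq_left {s t : ℝ} (h : t ≤ s) : expI κ |s - t| = expI κ s * expI (-κ) t := by
  rw [abs_of_nonneg (by linarith), expI, expI, expI, ← Complex.exp_add]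
  congr 1; push_cast; ring

theorem expI_abs_eq_right {s t : ℝ} (h : s ≤ t) : expI κ |s - t| = expI (-κ) s * expI κ t := by
  rw [abs_of_nonpos (by linarith), expI, expI, expI, ← Complex.exp_add]
  congr 1; push_cast; ring

theorem enorm_expI (κ : ℂ) (s : ℝ) : ‖expI κ s‖ₑ = ENNReal.ofReal (Real.exp (-(κ.im * s))) := by
  rw [← ofReal_norm, norm_expI]

theorem integrable_expI_abs_mul (hκ : 0 < κ.im) (hf : MemLp f 2 (volume.restrict (Ioi 0))) {s : ℝ}
    (hs : 0 ≤ s) : IntegrableOn (fun t => expI κ |s - t| * f t) (Ioi 0) := by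
  rw [← Ioc_union_Ioi_eq_Ioi hs]
  refine IntegrableOn.union ?_ ?_
  · have h1 := ((intervalIntegrable_of_memLp_Ioi hf hs).continuousOn_mul
      (continuous_expI (-κ)).continuousOn).const_mul (expI κ s)
    refine ((intervalIntegrable_iff_integrableOn_Ioc_of_le hs).1 h1).congr_fun (fun t ht => ?_)
      measurableSet_Ioc
    simp only [expI_abs_eq_left ht.2]; ring
  · have h1 : IntegrableOn (fun t => expI (-κ) s * (expI κ t * f t)) (Ioi s) :=
      ((integrable_expI_mul hκ hf).mono_set (Ioi_subset_Ioi hs)).const_mul _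
    refine h1.congr_fun (fun t ht => ?_) measurableSet_Ioi
    simp only [expI_abs_eq_right (mem_Ioi.1 ht).le]; ring

theorem expLeft_add_expRight (hκ : 0 < κ.im) (hf : MemLp f 2 (volume.restrict (Ioi 0))) {s : ℝ}
    (hs : 0 ≤ s) : ∫ t in Ioi (0 : ℝ), expI κ |s - t| * f t = expLeft κ f s + expRight κ f s := by
  have hi := integrable_expI_abs_mul hκ hf hs
  rw [expRight_eq hκ hf hs, expLeft, intervalIntegral.integral_of_le hs, ← integral_const_mul,
    ← integral_const_mul, ← Ioc_union_Ioi_eq_Ioi hs,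
    setIntegral_union (Ioc_disjoint_Ioi le_rfl) measurableSet_Ioi
      (hi.mono_set Ioc_subset_Ioi_self) (hi.mono_set (Ioi_subset_Ioi hs))]
  congr 1
  · refine setIntegral_congr_fun measurableSet_Ioc fun t ht => ?_
    simp only [expI_abs_eq_left ht.2]; ring
  · refine setIntegral_congr_fun measurableSet_Ioi fun t ht => ?_
    simp only [expI_abs_eq_right (mem_Ioi.1 ht).le]; ring

theorem aestronglyMeasurable_of_isPrim {H : ℝ → ℂ} {h : ℝ → ℂ} (hH : ∀ b, 0 ≤ b → IsPrim 0 b H h) :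
    AEStronglyMeasurable H (volume.restrict (Ioi 0)) := by
  refine ContinuousOn.aestronglyMeasurable (fun t ht => ?_) measurableSet_Ioi
  have h1 := (hH (t + 1) (by linarith [mem_Ioi.1 ht])).continuousOn (by linarith [mem_Ioi.1 ht])
  exact (h1.continuousAt (Icc_mem_nhds ht (by linarith))).continuousWithinAt

theorem memLp_expLeft (hκ : 0 < κ.im) (hf : MemLp f 2 (volume.restrict (Ioi 0))) :
    MemLp (expLeft κ f) 2 (volume.restrict (Ioi 0)) := by
  refine memLp_of_enorm_le_convolution hκ hf measurableSet_Ioi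
    (aestronglyMeasurable_of_isPrim fun b hb => isPrim_expLeft hf hb) fun s hs => ?_
  rw [expLeft, intervalIntegral.integral_of_le (mem_Ioi.1 hs).le, ← integral_const_mul]
  refine (enorm_integral_le_lintegral_enorm _).trans ((setLIntegral_mono' measurableSet_Ioc
    fun t ht => ?_).trans (lintegral_mono_set Ioc_subset_Ioi_self))
  rw [← mul_assoc, ← expI_abs_eq_left ht.2, enorm_mul, enorm_expI]

theorem memLp_expRight (hκ : 0 < κ.im) (hf : MemLp f 2 (volume.restrict (Ioi 0))) :
    MemLp (expRight κ f) 2 (volume.restrict (Ioi 0)) := by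
  refine memLp_of_enorm_le_convolution hκ hf measurableSet_Ioi
    (aestronglyMeasurable_of_isPrim fun b hb => isPrim_expRight hf hb) fun s hs => ?_
  rw [expRight_eq hκ hf (mem_Ioi.1 hs).le, ← integral_const_mul]
  refine (enorm_integral_le_lintegral_enorm _).trans ((setLIntegral_mono' measurableSet_Ioi
    fun t ht => ?_).trans (lintegral_mono_set (Ioi_subset_Ioi (mem_Ioi.1 hs).le)))
  rw [← mul_assoc, ← expI_abs_eq_right (mem_Ioi.1 ht).le, enorm_mul, enorm_expI]

end

/-- `F` and `F₁ = F'` are square integrable on the half-line, with `F'' = G`. -/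
structure HalfLineH2 (F F₁ G : ℝ → ℂ) : Prop where
  memLp : MemLp F 2 (volume.restrict (Ioi 0))
  memLp_deriv : MemLp F₁ 2 (volume.restrict (Ioi 0))
  memLp_deriv2 : MemLp G 2 (volume.restrict (Ioi 0))
  isPrim : ∀ b, 0 ≤ b → IsPrim 0 b F F₁
  isPrim_deriv : ∀ b, 0 ≤ b → IsPrim 0 b F₁ G

/-! ### The edge profile and the constant p. -/

section
variable {z : ℂ} {f : ℝ → ℂ}

theorem r0_eq (hz : z.im ≠ 0) (hf : MemLp f 2 (volume.restrict (Ioi 0))) {s : ℝ} (hs : 0 ≤ s) :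
    r0 z f s = Complex.I / (2 * sqrtUp z) * (expLeft (sqrtUp z) f s + expRight (sqrtUp z) f s
      - (∫ t in Ioi (0 : ℝ), expI (sqrtUp z) t * f t) * expI (sqrtUp z) s) := by
  have hκ := sqrtUp_im_pos hz
  rw [← expLeft_add_expRight hκ hf hs, ← integral_mul_const,
    ← integral_sub (integrable_expI_abs_mul hκ hf hs) ((integrable_expI_mul hκ hf).mul_const _),
    ← integral_const_mul, r0]
  refine integral_congr_ae (Eventually.of_forall fun t => ?_)
  simp only [expI]; ring

theorem sqrtUp_ne_zero (hz : z.im ≠ 0) : sqrtUp z ≠ 0 := by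
  intro h; have := sqrtUp_im_pos hz; simp [h] at this

/-- `r₀(z) f + q exp(i√z s)` belongs to `H²` of the half-line and solves `-F'' = z F + f`. -/
theorem exists_halfLineH2 (hz : z.im ≠ 0) (hf : MemLp f 2 (volume.restrict (Ioi 0))) (q : ℂ) :
    ∃ F₁ : ℝ → ℂ, HalfLineH2 (fun s => r0 z f s + q * expI (sqrtUp z) s) F₁
        (fun s => -(z * (r0 z f s + q * expI (sqrtUp z) s)) - f s) ∧
      r0 z f 0 = 0 ∧
      F₁ 0 = (∫ t in Ioi (0 : ℝ), expI (sqrtUp z) t * f t) + Complex.I * sqrtUp z * q := by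
  have hκ := sqrtUp_im_pos hz
  have hκ0 := sqrtUp_ne_zero hz
  have hsq := sqrtUp_sq z
  set κ := sqrtUp z with hκdef
  set p := ∫ t in Ioi (0 : ℝ), expI κ t * f t with hp
  have hp0 : (∫ t in Ioi (0 : ℝ), Complex.exp (Complex.I * κ * (t : ℂ)) * f t) = p := rfl
  have hI2 := Complex.I_sq
  set m : ℂ := Complex.I / (2 * κ) with hm
  have hmκ : m * (Complex.I * κ) = -1 / 2 := by
    rw [hm]; field_simp; rw [hI2]
  have hmz : m * (Complex.I * κ) * (Complex.I * κ) = - z * m := by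
    rw [← hsq]; linear_combination m * κ ^ 2 * hI2
  -- With L' = iκL + f and R' = -iκR - f, the sum L + R loses f upon differentiation, while L - R
  -- gains 2f. Since m·iκ = -1/2, the second derivative produces exactly -f.
  set F : ℝ → ℂ := fun s => m * (expLeft κ f s + expRight κ f s) + (q - m * p) * expI κ s with hF
  set F₁ : ℝ → ℂ := fun s => m * (Complex.I * κ) * (expLeft κ f s + -1 * expRight κ f s)
    + (q - m * p) * (Complex.I * κ) * expI κ s with hF₁
  have hFeq : ∀ s, 0 ≤ s → r0 z f s + q * expI κ s = F s := fun s hs => by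
    rw [r0_eq hz hf hs]; simp only [hF]; ring
  have hL := memLp_expLeft hκ hf
  have hR := memLp_expRight hκ hf
  have hE := memLp_expI hκ
  have hFm : MemLp F 2 (volume.restrict (Ioi 0)) :=
    ((hL.add hR).const_mul m).add (hE.const_mul (q - m * p))
  have hae : (fun s => r0 z f s + q * expI κ s) =ᵐ[volume.restrict (Ioi 0)] F := by
    filter_upwards [ae_restrict_mem measurableSet_Ioi] with s hs using hFeq s (mem_Ioi.1 hs).le
  have hEp : ∀ b, IsPrim 0 b (expI κ) (fun s => Complex.I * κ * expI κ s) := fun b =>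
    .of_hasDerivAt (hasDerivAt_expI κ) (continuous_const.mul (continuous_expI κ))
  have hm' : MemLp (fun s => r0 z f s + q * expI κ s) 2 (volume.restrict (Ioi 0)) :=
    (memLp_congr_ae hae).2 hFm
  refine ⟨F₁, ⟨hm', ?_, ((hm'.const_mul z).neg).sub hf, fun b hb => ?_, fun b hb => ?_⟩, ?_, ?_⟩
  · exact ((hL.add (hR.const_mul (-1))).const_mul _).add (hE.const_mul _)
  · refine ((((isPrim_expLeft hf hb).add (isPrim_expRight hf hb)).const_mul m).add
      ((hEp b).const_mul (q - m * p))).congr hb (fun s hs => hFeq s hs.1)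
      (Eventually.of_forall fun s => ?_)
    simp only [hF₁]; ring
  · refine ((((isPrim_expLeft hf hb).add
      ((isPrim_expRight hf hb).const_mul (-1))).const_mul (m * (Complex.I * κ))).add
      ((hEp b).const_mul ((q - m * p) * (Complex.I * κ)))).congr hb (fun _ _ => rfl) ?_
    filter_upwards [ae_restrict_mem measurableSet_Ioo] with s hs
    rw [hFeq s hs.1.le]
    simp only [hF]
    have e : Complex.I * κ * (Complex.I * κ) = -z := by rw [← hsq]; linear_combination κ ^ 2 * hI2
    linear_combination (-(expLeft κ f s + expRight κ f s)) * hmz - 2 * f s * hmκ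
      - (q - m * p) * expI κ s * e
  · have := hFeq 0 le_rfl
    simp only [hF, expLeft, expRight, intervalIntegral.integral_same, expI, Complex.ofReal_zero,
      mul_zero, Complex.exp_zero] at this
    rw [hp0] at this
    linear_combination this
  · simp only [hF₁, expLeft, expRight, intervalIntegral.integral_same, expI, Complex.ofReal_zero,
      mul_zero, Complex.exp_zero]
    rw [hp0]
    linear_combination (-2 * p) * hmκ

/-- The derivative of r₀(z)f is continuous up to 0, so its value there is the one-sided derivative.
This writes p as the pairing of f with an L² exponential. -/
theorem pConst_eq (hz : z.im ≠ 0) (hf : MemLp f 2 (volume.restrict (Ioi 0))) :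
    pConst z f = ∫ t in Ioi (0 : ℝ), expI (sqrtUp z) t * f t := by
  obtain ⟨F₁, hF, h0, h1⟩ := exists_halfLineH2 hz hf 0
  simp only [zero_mul, add_zero, mul_zero] at hF h1
  have hp := hF.isPrim 1 (by norm_num)
  have hc : ContinuousWithinAt F₁ (Ioi 0) 0 := by
    have := (hF.isPrim_deriv 1 (by norm_num)).continuousOn (by norm_num) 0 (by norm_num)
    exact this.mono_of_mem_nhdsWithin (mem_of_superset (Ioo_mem_nhdsGT one_pos) Ioo_subset_Icc_self)
  have hd := intervalIntegral.integral_hasDerivWithinAt_right (a := 0) (b := 0) (f := F₁)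
    (s := Ici 0) (t := Ioi 0) IntervalIntegrable.refl
    ⟨Ioi 0, self_mem_nhdsWithin, hF.memLp_deriv.1⟩ hc
  rw [pConst, ← h1]
  refine HasDerivWithinAt.derivWithin ?_ (uniqueDiffWithinAt_Ici 0)
  refine hd.congr_of_eventuallyEq ?_ (by simp [h0])
  filter_upwards [Icc_mem_nhdsGE (one_pos : (0 : ℝ) < 1)] with s hs
  rw [hp.eq s hs, h0, zero_add]

end

/-! ### Functions `F(s) χ(u)` on rectangles -/

/-- The function `F(s) χ(u)`. -/
def tensor (F χ : ℝ → ℂ) (x : ℝ × ℝ) : ℂ := F x.1 * χ x.2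

theorem volume_restrict_prod (I J : Set ℝ) : (volume : Measure (ℝ × ℝ)).restrict (I ×ˢ J) =
    (volume.restrict I).prod (volume.restrict J) := by
  rw [Measure.prod_restrict, Measure.volume_eq_prod]

theorem lintegral_enorm_sq_ne_top {α : Type*} [MeasurableSpace α] {ν : Measure α} {f : α → ℂ}
    (hf : MemLp f 2 ν) : ∫⁻ x, ‖f x‖ₑ ^ 2 ∂ν ≠ ⊤ := by
  have h := (eLpNorm_lt_top_iff_lintegral_rpow_enorm_lt_top (by norm_num) (by norm_num)).1 hf.2
  simp only [ENNReal.toReal_ofNat, ENNReal.rpow_ofNat] at h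
  exact h.ne

theorem eLpNorm_two_eq {α : Type*} [MeasurableSpace α] (ν : Measure α) (f : α → ℂ) :
    eLpNorm f 2 ν = (∫⁻ x, ‖f x‖ₑ ^ 2 ∂ν) ^ (1 / 2 : ℝ) := by
  rw [eLpNorm_eq_lintegral_rpow_enorm_toReal (by norm_num) (by norm_num)]
  simp only [ENNReal.toReal_ofNat, ENNReal.rpow_ofNat]

theorem lintegral_tensor {I J : Set ℝ} {F χ : ℝ → ℂ}
    (hF : AEStronglyMeasurable F (volume.restrict I))
    (hχ : AEStronglyMeasurable χ (volume.restrict J)) :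
    ∫⁻ x in I ×ˢ J, ‖tensor F χ x‖ₑ ^ 2 = (∫⁻ s in I, ‖F s‖ₑ ^ 2) * ∫⁻ u in J, ‖χ u‖ₑ ^ 2 := by
  rw [volume_restrict_prod, ← lintegral_prod_mul (hF.enorm.pow_const 2) (hχ.enorm.pow_const 2)]
  simp only [tensor, enorm_mul, mul_pow]

theorem eLpNorm_tensor {I J : Set ℝ} {F χ : ℝ → ℂ}
    (hF : AEStronglyMeasurable F (volume.restrict I))
    (hχ : AEStronglyMeasurable χ (volume.restrict J)) :
    eLpNorm (tensor F χ) 2 (volume.restrict (I ×ˢ J)) =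
      eLpNorm F 2 (volume.restrict I) * eLpNorm χ 2 (volume.restrict J) := by
  rw [eLpNorm_two_eq, eLpNorm_two_eq, eLpNorm_two_eq, lintegral_tensor hF hχ,
    ENNReal.mul_rpow_of_nonneg _ _ (by norm_num)]

theorem memLp_tensor {I J : Set ℝ} {F χ : ℝ → ℂ} (hF : MemLp F 2 (volume.restrict I))
    (hχ : MemLp χ 2 (volume.restrict J)) : MemLp (tensor F χ) 2 (volume.restrict (I ×ˢ J)) := by
  refine ⟨?_, ?_⟩
  · rw [volume_restrict_prod]
    exact (hF.1.comp_fst).mul (hχ.1.comp_snd)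
  · rw [eLpNorm_tensor hF.1 hχ.1]
    exact ENNReal.mul_lt_top hF.2 hχ.2

theorem HasWeakDeriv.congr {d : ℝ × ℝ} {Ω : Set (ℝ × ℝ)} {ψ p ψ' p' : ℝ × ℝ → ℂ}
    (h : HasWeakDeriv d Ω ψ p) (h1 : ψ' =ᵐ[volume.restrict Ω] ψ) (h2 : p' =ᵐ[volume.restrict Ω] p) :
    HasWeakDeriv d Ω ψ' p' where
  memLp := (memLp_congr_ae h1).2 h.memLp
  memLp_deriv := (memLp_congr_ae h2).2 h.memLp_deriv
  integral_eq := fun φ hφ hc hs => by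
    rw [integral_congr_ae (g := fun x => fderiv ℝ φ x d • ψ x)
        (by filter_upwards [h1] with x hx; rw [hx]),
      integral_congr_ae (f := fun x => φ x • p' x) (g := fun x => φ x • p x)
        (by filter_upwards [h2] with x hx; rw [hx])]
    exact h.integral_eq φ hφ hc hs

theorem HasWeakDeriv.weakDeriv_ae_eq {d : ℝ × ℝ} {Ω : Set (ℝ × ℝ)} (hΩ : IsOpen Ω)
    {ψ p : ℝ × ℝ → ℂ} (h : HasWeakDeriv d Ω ψ p) : weakDeriv d Ω ψ =ᵐ[volume.restrict Ω] p := by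
  have hex : ∃ p, HasWeakDeriv d Ω ψ p := ⟨p, h⟩
  rw [weakDeriv, dif_pos hex]
  exact hex.choose_spec.ae_eq hΩ h

theorem integrable_smul_of_compactSupport {Ω : Set (ℝ × ℝ)} {ψ : ℝ × ℝ → ℂ}
    (hψ : MemLp ψ 2 (volume.restrict Ω)) {g : ℝ × ℝ → ℝ} (hg : Continuous g)
    (hc : HasCompactSupport g) : Integrable (fun x => g x • ψ x) (volume.restrict Ω) :=
  (hψ.locallyIntegrable (by norm_num)).integrable_smul_left_of_hasCompactSupport hg hc

/-! ### Restriction of test functions to coordinate lines. -/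

section slices
variable {φ : ℝ × ℝ → ℝ} {I J : Set ℝ}

theorem hasCompactSupport_fderiv_apply (hc : HasCompactSupport φ) (d : ℝ × ℝ) :
    HasCompactSupport fun x => fderiv ℝ φ x d :=
  (hc.fderiv ℝ).comp_left (g := fun L : ℝ × ℝ →L[ℝ] ℝ => L d) (by simp)

theorem continuous_fderiv_apply (hφ : ContDiff ℝ ∞ φ) (d : ℝ × ℝ) :
    Continuous fun x => fderiv ℝ φ x d :=
  (hφ.continuous_fderiv (by norm_num)).clm_apply continuous_const

theorem slice_fst (hφ : ContDiff ℝ ∞ φ) (hc : HasCompactSupport φ) (hs : tsupport φ ⊆ I ×ˢ J)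
    (u : ℝ) : ContDiff ℝ ∞ (fun s => φ (s, u)) ∧ HasCompactSupport (fun s => φ (s, u)) ∧
      tsupport (fun s => φ (s, u)) ⊆ I ∧
      ∀ s, deriv (fun s => φ (s, u)) s = fderiv ℝ φ (s, u) (1, 0) := by
  refine ⟨hφ.comp (by fun_prop), ?_, fun s h => ?_, fun s => ?_⟩
  · refine HasCompactSupport.intro (hc.isCompact.image continuous_fst) fun s h => ?_
    by_contra hne
    exact h ⟨(s, u), subset_tsupport _ hne, rfl⟩
  · have := tsupport_comp_subset_preimage φ (f := fun s : ℝ => (s, u)) (by fun_prop) h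
    exact (hs this).1
  · have h1 : HasDerivAt (fun s : ℝ => (s, u)) ((1 : ℝ), (0 : ℝ)) s :=
      (hasDerivAt_id s).prodMk (hasDerivAt_const s u)
    exact (((hφ.differentiable (by norm_num)) (s, u)).hasFDerivAt.comp_hasDerivAt s h1).deriv

theorem slice_snd (hφ : ContDiff ℝ ∞ φ) (hc : HasCompactSupport φ) (hs : tsupport φ ⊆ I ×ˢ J)
    (s : ℝ) : ContDiff ℝ ∞ (fun u => φ (s, u)) ∧ HasCompactSupport (fun u => φ (s, u)) ∧
      tsupport (fun u => φ (s, u)) ⊆ J ∧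
      ∀ u, deriv (fun u => φ (s, u)) u = fderiv ℝ φ (s, u) (0, 1) := by
  refine ⟨hφ.comp (by fun_prop), ?_, fun u h => ?_, fun u => ?_⟩
  · refine HasCompactSupport.intro (hc.isCompact.image continuous_snd) fun u h => ?_
    by_contra hne
    exact h ⟨(s, u), subset_tsupport _ hne, rfl⟩
  · have := tsupport_comp_subset_preimage φ (f := fun u : ℝ => (s, u)) (by fun_prop) h
    exact (hs this).2
  · have h1 : HasDerivAt (fun u : ℝ => (s, u)) ((0 : ℝ), (1 : ℝ)) u :=
      (hasDerivAt_const u s).prodMk (hasDerivAt_id u)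
    exact (((hφ.differentiable (by norm_num)) (s, u)).hasFDerivAt.comp_hasDerivAt u h1).deriv

end slices

/-- By Fubini the two-dimensional test identity is tested line by line: for fixed u the slice of φ
is a test function on I, and χ(u) factors out. -/
theorem hasWeakDeriv_tensor_fst {I J : Set ℝ} {F F' χ : ℝ → ℂ} (hF : MemLp F 2 (volume.restrict I))
    (hF' : MemLp F' 2 (volume.restrict I)) (h : HasWeakDerivLine I F F')
    (hχ : MemLp χ 2 (volume.restrict J)) :
    HasWeakDeriv (1, 0) (I ×ˢ J) (tensor F χ) (tensor F' χ) where
  memLp := memLp_tensor hF hχ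
  memLp_deriv := memLp_tensor hF' hχ
  integral_eq := fun φ hφ hc hs => by
    have i1 := integrable_smul_of_compactSupport (memLp_tensor hF hχ)
      (continuous_fderiv_apply hφ (1, 0)) (hasCompactSupport_fderiv_apply hc (1, 0))
    have i2 := integrable_smul_of_compactSupport (memLp_tensor hF' hχ) hφ.continuous hc
    rw [volume_restrict_prod] at i1 i2 ⊢
    rw [integral_prod_symm _ i1, integral_prod_symm _ i2, ← integral_neg]
    refine integral_congr_ae (Eventually.of_forall fun u => ?_)
    obtain ⟨h1, h2, h3, h4⟩ := slice_fst hφ hc hs u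
    have key := h _ h1 h2 h3
    simp only [h4] at key
    simp only [tensor, ← smul_mul_assoc]
    rw [integral_mul_const, integral_mul_const, key, neg_mul]

theorem hasWeakDeriv_tensor_snd {I J : Set ℝ} {F χ χ' : ℝ → ℂ} (hF : MemLp F 2 (volume.restrict I))
    (hχ : MemLp χ 2 (volume.restrict J)) (hχ' : MemLp χ' 2 (volume.restrict J))
    (h : HasWeakDerivLine J χ χ') :
    HasWeakDeriv (0, 1) (I ×ˢ J) (tensor F χ) (tensor F χ') where
  memLp := memLp_tensor hF hχ
  memLp_deriv := memLp_tensor hF hχ'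
  integral_eq := fun φ hφ hc hs => by
    have i1 := integrable_smul_of_compactSupport (memLp_tensor hF hχ)
      (continuous_fderiv_apply hφ (0, 1)) (hasCompactSupport_fderiv_apply hc (0, 1))
    have i2 := integrable_smul_of_compactSupport (memLp_tensor hF hχ') hφ.continuous hc
    rw [volume_restrict_prod] at i1 i2 ⊢
    rw [integral_prod _ i1, integral_prod _ i2, ← integral_neg]
    refine integral_congr_ae (Eventually.of_forall fun s => ?_)
    obtain ⟨h1, h2, h3, h4⟩ := slice_snd hφ hc hs s
    have key := h _ h1 h2 h3
    simp only [h4] at key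
    simp only [tensor, ← mul_smul_comm]
    rw [integral_const_mul, integral_const_mul, key, mul_neg]

/-- `F` has square integrable weak derivatives `F' = F₁` and `F'' = F₂` on `I`. -/
structure LineH2 (I : Set ℝ) (F F₁ F₂ : ℝ → ℂ) : Prop where
  memLp : MemLp F 2 (volume.restrict I)
  memLp_deriv : MemLp F₁ 2 (volume.restrict I)
  memLp_deriv2 : MemLp F₂ 2 (volume.restrict I)
  weak : HasWeakDerivLine I F F₁
  weak_deriv : HasWeakDerivLine I F₁ F₂

theorem HalfLineH2.lineH2 {F F₁ F₂ : ℝ → ℂ} (h : HalfLineH2 F F₁ F₂) : LineH2 (Ioi 0) F F₁ F₂ :=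
  ⟨h.memLp, h.memLp_deriv, h.memLp_deriv2, hasWeakDerivLine_Ioi h.isPrim,
    hasWeakDerivLine_Ioi h.isPrim_deriv⟩

theorem lineH2_of_hasDerivAt {a b : ℝ} (hab : a ≤ b) {F F₁ F₂ : ℝ → ℂ}
    (h1 : ∀ t, HasDerivAt F (F₁ t) t) (h2 : ∀ t, HasDerivAt F₁ (F₂ t) t) (hc : Continuous F₂) :
    LineH2 (Ioo a b) F F₁ F₂ := by
  have c0 : Continuous F := continuous_iff_continuousAt.2 fun t => (h1 t).continuousAt
  have c1 : Continuous F₁ := continuous_iff_continuousAt.2 fun t => (h2 t).continuousAt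
  exact ⟨memLp_Ioo_of_continuousOn c0.continuousOn 2, memLp_Ioo_of_continuousOn c1.continuousOn 2,
    memLp_Ioo_of_continuousOn hc.continuousOn 2,
    (IsPrim.of_hasDerivAt h1 c1).hasWeakDerivLine hab,
    (IsPrim.of_hasDerivAt h2 hc).hasWeakDerivLine hab⟩

/-! ### Weak derivatives of functions that are almost everywhere products. -/

section
variable {I J : Set ℝ} {F F₁ F₂ χ χ₁ χ₂ : ℝ → ℂ} {ψ : ℝ × ℝ → ℂ}

/-- Weak derivatives are unique only up to null sets, so the chosen `dS` is known only almost
everywhere. Assuming ψ is a product merely almost everywhere lets the argument be iterated for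
second derivatives. -/
theorem LineH2.dS_ae_eq (hF : LineH2 I F F₁ F₂) (hχ : LineH2 J χ χ₁ χ₂) (hI : IsOpen I)
    (hJ : IsOpen J) (hψ : ψ =ᵐ[volume.restrict (I ×ˢ J)] tensor F χ) :
    dS (I ×ˢ J) ψ =ᵐ[volume.restrict (I ×ˢ J)] tensor F₁ χ :=
  ((hasWeakDeriv_tensor_fst hF.memLp hF.memLp_deriv hF.weak hχ.memLp).congr hψ
    (EventuallyEq.refl _ _)).weakDeriv_ae_eq (hI.prod hJ)

theorem LineH2.dS_dS_ae_eq (hF : LineH2 I F F₁ F₂) (hχ : LineH2 J χ χ₁ χ₂) (hI : IsOpen I)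
    (hJ : IsOpen J) (hψ : ψ =ᵐ[volume.restrict (I ×ˢ J)] tensor F χ) :
    dS (I ×ˢ J) (dS (I ×ˢ J) ψ) =ᵐ[volume.restrict (I ×ˢ J)] tensor F₂ χ :=
  ((hasWeakDeriv_tensor_fst hF.memLp_deriv hF.memLp_deriv2 hF.weak_deriv hχ.memLp).congr
    (hF.dS_ae_eq hχ hI hJ hψ) (EventuallyEq.refl _ _)).weakDeriv_ae_eq (hI.prod hJ)

theorem LineH2.dU_ae_eq (hF : LineH2 I F F₁ F₂) (hχ : LineH2 J χ χ₁ χ₂) (hI : IsOpen I)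
    (hJ : IsOpen J) (hψ : ψ =ᵐ[volume.restrict (I ×ˢ J)] tensor F χ) :
    dU (I ×ˢ J) ψ =ᵐ[volume.restrict (I ×ˢ J)] tensor F χ₁ :=
  ((hasWeakDeriv_tensor_snd hF.memLp hχ.memLp hχ.memLp_deriv hχ.weak).congr hψ
    (EventuallyEq.refl _ _)).weakDeriv_ae_eq (hI.prod hJ)

theorem LineH2.dU_dU_ae_eq (hF : LineH2 I F F₁ F₂) (hχ : LineH2 J χ χ₁ χ₂) (hI : IsOpen I)
    (hJ : IsOpen J) (hψ : ψ =ᵐ[volume.restrict (I ×ˢ J)] tensor F χ) :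
    dU (I ×ˢ J) (dU (I ×ˢ J) ψ) =ᵐ[volume.restrict (I ×ˢ J)] tensor F χ₂ :=
  ((hasWeakDeriv_tensor_snd hF.memLp hχ.memLp_deriv hχ.memLp_deriv2 hχ.weak_deriv).congr
    (hF.dU_ae_eq hχ hI hJ hψ) (EventuallyEq.refl _ _)).weakDeriv_ae_eq (hI.prod hJ)

theorem LineH2.memH2 (hF : LineH2 I F F₁ F₂) (hχ : LineH2 J χ χ₁ χ₂) (hI : IsOpen I)
    (hJ : IsOpen J) (hψ : ψ =ᵐ[volume.restrict (I ×ˢ J)] tensor F χ) : MemH2 (I ×ˢ J) ψ where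
  ds := ⟨_, (hasWeakDeriv_tensor_fst hF.memLp hF.memLp_deriv hF.weak hχ.memLp).congr hψ
    (EventuallyEq.refl _ _)⟩
  du := ⟨_, (hasWeakDeriv_tensor_snd hF.memLp hχ.memLp hχ.memLp_deriv hχ.weak).congr hψ
    (EventuallyEq.refl _ _)⟩
  dss := ⟨_, (hasWeakDeriv_tensor_fst hF.memLp_deriv hF.memLp_deriv2 hF.weak_deriv hχ.memLp).congr
    (hF.dS_ae_eq hχ hI hJ hψ) (EventuallyEq.refl _ _)⟩
  duu := ⟨_, (hasWeakDeriv_tensor_snd hF.memLp hχ.memLp_deriv hχ.memLp_deriv2 hχ.weak_deriv).congr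
    (hF.dU_ae_eq hχ hI hJ hψ) (EventuallyEq.refl _ _)⟩

end

/-! ### Traces -/

/-- Averages over (0, h) are bounded by the supremum of g there. An almost-everywhere bound on G
suffices, which is what traces of equivalence classes require. -/
theorem tendsto_average_zero {G g : ℝ → ℝ≥0∞} {h₀ : ℝ} (h₀pos : 0 < h₀)
    (hG : ∀ᵐ t ∂(volume.restrict (Ioo 0 h₀)), G t ≤ g t) (hg : Tendsto g (𝓝[>] 0) (𝓝 0)) :
    Tendsto (fun h : ℝ => (ENNReal.ofReal h)⁻¹ * ∫⁻ t in Ioo 0 h, G t) (𝓝[>] 0) (𝓝 0) := by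
  rw [ENNReal.tendsto_nhds_zero] at hg ⊢
  intro ε hε
  obtain ⟨h₁, h₁pos, h₁sub⟩ := mem_nhdsGT_iff_exists_Ioo_subset.1 (hg ε hε)
  filter_upwards [Ioo_mem_nhdsGT (lt_min h₀pos h₁pos)] with h hh
  have hh0 : 0 < ENNReal.ofReal h := ENNReal.ofReal_pos.2 hh.1
  have hb : ∫⁻ t in Ioo 0 h, G t ≤ ENNReal.ofReal h * ε := by
    calc ∫⁻ t in Ioo 0 h, G t ≤ ∫⁻ t in Ioo 0 h, ε := by
          refine lintegral_mono_ae ?_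
          filter_upwards [ae_restrict_of_ae_restrict_of_subset
            (Ioo_subset_Ioo_right (hh.2.le.trans (min_le_left _ _))) hG,
            ae_restrict_mem measurableSet_Ioo] with t ht htm
          exact ht.trans (h₁sub ⟨htm.1, htm.2.trans (hh.2.trans_le (min_le_right _ _))⟩)
      _ = ENNReal.ofReal h * ε := by
          rw [setLIntegral_const, Real.volume_Ioo, sub_zero, mul_comm]
  calc (ENNReal.ofReal h)⁻¹ * ∫⁻ t in Ioo 0 h, G t ≤ (ENNReal.ofReal h)⁻¹ * (ENNReal.ofReal h * ε) := by
        gcongr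
    _ = ε := by
        rw [← mul_assoc, ENNReal.inv_mul_cancel hh0.ne' ENNReal.ofReal_ne_top, one_mul]

theorem hasTraceS_of_ae_eq_tensor {I : Set ℝ} {F χ : ℝ → ℂ} {ψ : ℝ × ℝ → ℂ} {a σ h₀ : ℝ} {c : ℂ}
    {g : ℝ → ℂ} (hσ : σ ≠ 0) (hχ : MemLp χ 2 (volume.restrict (Ioo 0 1))) (hI : MeasurableSet I)
    (hψ : ψ =ᵐ[volume.restrict (I ×ˢ Ioo 0 1)] tensor F χ) (h₀pos : 0 < h₀)
    (hsub : ∀ t ∈ Ioo 0 h₀, a + σ * t ∈ I)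
    (hF : Tendsto (fun t => F (a + σ * t)) (𝓝[>] 0) (𝓝 c)) (hg : ∀ u, g u = c * χ u) :
    HasTraceS a σ ψ g := by
  obtain rfl : g = fun u => c * χ u := funext hg
  refine ⟨hχ.const_mul c, ?_⟩
  set C := ∫⁻ u in Ioo (0 : ℝ) 1, ‖χ u‖ₑ ^ 2 with hC
  have hCt : C ≠ ⊤ := lintegral_enorm_sq_ne_top hχ
  refine tendsto_average_zero (g := fun t => ‖F (a + σ * t) - c‖ₑ ^ 2 * C) h₀pos ?_ ?_
  · have h1 : ∀ᵐ s ∂(volume.restrict I), ∀ᵐ u ∂(volume.restrict (Ioo (0 : ℝ) 1)),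
        ψ (s, u) = tensor F χ (s, u) := by
      rw [Filter.EventuallyEq, volume_restrict_prod] at hψ
      exact Measure.ae_ae_of_ae_prod hψ
    rw [ae_restrict_iff' hI] at h1
    -- An exceptional null set of abscissas s must pull back to a null set of t under t ↦ a + σt;
    -- this is where σ ≠ 0 enters.
    have hq : Measure.QuasiMeasurePreserving (fun t : ℝ => a + σ * t) volume volume :=
      (measurePreserving_add_left volume a).quasiMeasurePreserving.comp
        (by
          refine ⟨by fun_prop, ?_⟩
          rw [Real.map_volume_mul_left hσ]
          exact Measure.smul_absolutelyContinuous)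
    rw [ae_restrict_iff' measurableSet_Ioo]
    filter_upwards [hq.ae h1] with t ht htm
    refine le_of_eq ?_
    rw [hC, ← lintegral_const_mul' _ _ (by finiteness)]
    refine lintegral_congr_ae ?_
    filter_upwards [ht (hsub t htm)] with u hu
    rw [hu, tensor, ← mul_pow, ← enorm_mul, sub_mul]
  · have h2 : Tendsto (fun t => ‖F (a + σ * t) - c‖ₑ ^ 2 * C) (𝓝[>] 0) (𝓝 (‖c - c‖ₑ ^ 2 * C)) :=
      ENNReal.Tendsto.mul_const (ENNReal.Tendsto.pow ((hF.sub_const c).enorm)) (Or.inr hCt)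
    simpa using h2

theorem hasTraceU_zero_of_eq_tensor {I : Set ℝ} {F χ : ℝ → ℂ} {ψ : ℝ × ℝ → ℂ} {b σ : ℝ}
    (hF : MemLp F 2 (volume.restrict I)) (hI : MeasurableSet I) (hχ : Continuous χ) (hb : χ b = 0)
    (hψ : ∀ s ∈ I, ∀ u, ψ (s, u) = F s * χ u) : HasTraceU I b σ ψ 0 := by
  refine ⟨MemLp.zero, ?_⟩
  set C := ∫⁻ s in I, ‖F s‖ₑ ^ 2 with hC
  have hCt : C ≠ ⊤ := lintegral_enorm_sq_ne_top hF
  refine tendsto_average_zero (g := fun t => C * ‖χ (b + σ * t)‖ₑ ^ 2) one_pos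
    (Eventually.of_forall fun t => le_of_eq ?_) ?_
  · rw [hC, ← lintegral_mul_const' _ _ (by finiteness)]
    refine setLIntegral_congr_fun hI fun s hs => ?_
    simp only [hψ s hs, Pi.zero_apply, sub_zero, enorm_mul, mul_pow]
  · have h1 : Tendsto (fun t : ℝ => χ (b + σ * t)) (𝓝[>] 0) (𝓝 (χ (b + σ * 0))) :=
      (Continuous.tendsto (by fun_prop) 0).mono_left nhdsWithin_le_nhds
    rw [mul_zero, add_zero, hb] at h1
    have h2 : Tendsto (fun t => C * ‖χ (b + σ * t)‖ₑ ^ 2) (𝓝[>] 0) (𝓝 (C * ‖(0 : ℂ)‖ₑ ^ 2)) :=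
      ENNReal.Tendsto.const_mul (ENNReal.Tendsto.pow h1.enorm) (Or.inr hCt)
    simpa using h2

/-! ### Transverse modes -/

theorem continuous_chi (n : ℕ) : Continuous (chi n) := by unfold chi; fun_prop

theorem chi_zero (n : ℕ) : chi n 0 = 0 := by simp [chi]

theorem chi_one (n : ℕ) : chi n 1 = 0 := by simp [chi, Real.sin_nat_mul_pi]

theorem norm_chi_le (n : ℕ) (u : ℝ) : ‖chi n u‖ ≤ 2 := by
  rw [chi, Complex.norm_real, norm_mul, Real.norm_of_nonneg (Real.sqrt_nonneg 2)]
  have h1 : √2 ≤ 2 := (Real.sqrt_le_left (by norm_num)).2 (by norm_num)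
  have h2 : ‖Real.sin (n * Real.pi * u)‖ ≤ 1 := Real.abs_sin_le_one _
  calc √2 * ‖Real.sin (n * Real.pi * u)‖ ≤ 2 * 1 := by gcongr
    _ = 2 := by norm_num

theorem lineH2_chi (n : ℕ) : LineH2 (Ioo 0 1) (chi n)
    (fun u => ((√2 * (Real.cos (n * Real.pi * u) * (n * Real.pi)) : ℝ) : ℂ))
    (fun u => -((n ^ 2 * Real.pi ^ 2 : ℝ) : ℂ) * chi n u) := by
  have hl : ∀ t : ℝ, HasDerivAt (fun u : ℝ => n * Real.pi * u) (n * Real.pi) t := fun t => by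
    simpa using (hasDerivAt_id t).const_mul (n * Real.pi)
  refine lineH2_of_hasDerivAt zero_le_one (fun t => ?_) (fun t => ?_)
    (continuous_const.mul (continuous_chi n))
  · exact ((hl t).sin.const_mul √2).ofReal_comp
  · refine ((((hl t).cos.mul_const (n * Real.pi)).const_mul √2).ofReal_comp).congr_deriv ?_
    rw [chi]; push_cast; ring

theorem eLpNorm_chi {n : ℕ} (hn : 1 ≤ n) : eLpNorm (chi n) 2 (volume.restrict (Ioo 0 1)) = 1 := by
  have hn0 : (n : ℝ) * Real.pi ≠ 0 := by positivity
  have h1 : ∫ u in Ioo (0 : ℝ) 1, ‖chi n u‖ ^ 2 = 1 := by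
    have : ∀ u, ‖chi n u‖ ^ 2 = 2 * Real.sin (n * Real.pi * u) ^ 2 := fun u => by
      rw [chi, Complex.norm_real, Real.norm_eq_abs, sq_abs, mul_pow, Real.sq_sqrt (by norm_num)]
    simp only [this]
    rw [← integral_Ioc_eq_integral_Ioo, ← intervalIntegral.integral_of_le zero_le_one,
      intervalIntegral.integral_const_mul,
      intervalIntegral.integral_comp_mul_left (fun x => Real.sin x ^ 2) hn0, integral_sin_sq]
    simp [Real.sin_nat_mul_pi]
    field_simp
  have h2 : MemLp (chi n) 2 (volume.restrict (Ioo 0 1)) :=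
    memLp_Ioo_of_continuousOn (continuous_chi n).continuousOn 2
  have h3 : ∫⁻ u in Ioo (0 : ℝ) 1, ‖chi n u‖ₑ ^ 2
      = ENNReal.ofReal (∫ u in Ioo (0 : ℝ) 1, ‖chi n u‖ ^ 2) := by
    rw [ofReal_integral_eq_lintegral_ofReal h2.integrable_norm_pow'
      (Eventually.of_forall fun u => by positivity)]
    refine lintegral_congr fun u => ?_
    rw [← ofReal_norm, ENNReal.ofReal_pow (norm_nonneg _)]
  rw [eLpNorm_two_eq, h3, h1]; simp

/-! ### The coupling constants and the domain -/

section
variable {γ : ℝ → ℝ} {z : ℂ} {ε : ℝ}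

theorem im_sq_mul (z : ℂ) (ε : ℝ) : ((ε : ℂ) ^ 2 * z).im = ε ^ 2 * z.im := by
  rw [← Complex.ofReal_pow, Complex.im_ofReal_mul]

theorem im_sq_mul_ne_zero (hz : z.im ≠ 0) (hε : 0 < ε) : ((ε : ℂ) ^ 2 * z).im ≠ 0 := by
  rw [im_sq_mul]; exact mul_ne_zero (by positivity) hz

/-- Im z = 2 Re√z Im√z. The nonzero real part is the outgoing flux that drives the a priori bound.
-/
theorem sqrtUp_re_ne_zero (hz : z.im ≠ 0) : (sqrtUp z).re ≠ 0 := by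
  intro h
  have := congrArg Complex.im (sqrtUp_sq z)
  rw [sq, Complex.mul_im, h] at this
  apply hz; rw [← this]; ring

/-- A priori bound for the boundary values of a solution of `h_v y = ε² z y` that is coupled to the
half-lines through its normal derivatives. -/
theorem norm_boundary_le (hz : z.im ≠ 0) (hε : 0 < ε) {y y₁ : ℝ → ℂ} {p₁ p₂ : ℂ}
    (hy : SolvesODE (shiftedPot γ ((ε : ℂ) ^ 2 * z)) y y₁)
    (hl : y₁ (-1) = -(ε * (p₁ + Complex.I * sqrtUp z * y (-1))))
    (hr : y₁ 1 = ε * (p₂ + Complex.I * sqrtUp z * y 1)) :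
    |(sqrtUp z).re| * (‖y (-1)‖ + ‖y 1‖) ≤ 2 * (‖p₁‖ + ‖p₂‖) := by
  have hκ := sqrtUp_im_pos hz
  have hre := sqrtUp_re_ne_zero hz
  have hzim : z.im = 2 * (sqrtUp z).re * (sqrtUp z).im := by
    conv_lhs => rw [← sqrtUp_sq z, sq, Complex.mul_im]
    ring
  set κ := sqrtUp z
  set q₁ := y (-1)
  set q₂ := y 1
  -- The factor Re√z turns ε² Im z into 2(ε Re√z)² Im√z ≥ 0, whichever half-plane contains z.
  have key := im_le_of_sign hy.deriv_fst hy.deriv_snd (σ := κ.re) (a := -1) (b := 1)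
    (fun t => by
      rw [shiftedPot_im, im_sq_mul, hzim]
      have : κ.re * (ε ^ 2 * (2 * κ.re * κ.im)) = 2 * (ε * κ.re) ^ 2 * κ.im := by ring
      rw [this]; positivity) (by norm_num)
  rw [hl, hr] at key
  have e : ∀ p q : ℂ, (ε * (p + Complex.I * κ * q) * (starRingEnd ℂ) q).im =
      ε * ((p * (starRingEnd ℂ) q).im + κ.re * ‖q‖ ^ 2) := fun p q => by
    rw [← Complex.normSq_eq_norm_sq, Complex.normSq_apply]
    simp [Complex.mul_im, Complex.mul_re]
    ring
  rw [neg_mul, Complex.neg_im, e, e] at key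
  have key2 : κ.re ^ 2 * (‖q₁‖ ^ 2 + ‖q₂‖ ^ 2) ≤
      -(κ.re * (p₁ * (starRingEnd ℂ) q₁).im) - κ.re * (p₂ * (starRingEnd ℂ) q₂).im := by
    refine le_of_mul_le_mul_left ?_ hε
    linarith
  have hb : ∀ p q : ℂ, -(κ.re * (p * (starRingEnd ℂ) q).im) ≤ |κ.re| * (‖p‖ * ‖q‖) := fun p q => by
    refine (neg_le_abs _).trans ?_
    rw [abs_mul]
    gcongr
    refine (Complex.abs_im_le_norm _).trans ?_
    rw [norm_mul, RCLike.norm_conj]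
  have h1 := hb p₁ q₁
  have h2 := hb p₂ q₂
  rw [← sq_abs] at key2
  have hpos : 0 < |κ.re| := abs_pos.2 hre
  have key3 : |κ.re| * (‖q₁‖ ^ 2 + ‖q₂‖ ^ 2) ≤ ‖p₁‖ * ‖q₁‖ + ‖p₂‖ * ‖q₂‖ := by
    refine le_of_mul_le_mul_left ?_ hpos
    linarith
  have n1 := norm_nonneg q₁
  have n2 := norm_nonneg q₂
  have n3 := norm_nonneg p₁
  have n4 := norm_nonneg p₂
  -- Divide by |q₁| + |q₂| after (|q₁| + |q₂|)² ≤ 2(|q₁|² + |q₂|²); the case of sum zero is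
  -- separate.
  rcases (add_nonneg n1 n2).eq_or_lt with h0 | h0
  · rw [← h0]; nlinarith
  · refine le_of_mul_le_mul_right ?_ h0
    nlinarith [mul_nonneg hpos.le (sq_nonneg (‖q₁‖ - ‖q₂‖)), mul_nonneg n3 n2, mul_nonneg n4 n1]

/-- The vertex profile `ε (ξ₁ r_v(ε²z; ·, -1) + ξ₂ r_v(ε²z; ·, 1))` solves `h_v y = ε² z y` with
`y'(-1) = -ε ξ₁` and `y'(1) = ε ξ₂`. -/
theorem exists_vertexProfile (hγ : Continuous γ) (hγ1 : ∀ s, |γ s| < 1) (hz : z.im ≠ 0)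
    (hε : 0 < ε) (ξ₁ ξ₂ : ℂ) : ∃ y y₁ : ℝ → ℂ, SolvesODE (shiftedPot γ ((ε : ℂ) ^ 2 * z)) y y₁ ∧
      (∀ s ∈ Icc (-1 : ℝ) 1, y s = ε * (ξ₁ * rV γ ((ε : ℂ) ^ 2 * z) s (-1)
        + ξ₂ * rV γ ((ε : ℂ) ^ 2 * z) s 1)) ∧
      y₁ (-1) = -(ε * ξ₁) ∧ y₁ 1 = ε * ξ₂ := by
  obtain ⟨y, y₁, h1, h2, h3, h4⟩ :=
    exists_solvesODE_rV hγ hγ1 (im_sq_mul_ne_zero hz hε) (ε * ξ₁) (ε * ξ₂)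
  exact ⟨y, y₁, h1, fun s hs => by rw [h2 s hs]; ring, h3, h4⟩

/-- The relations identify q₁, q₂ with the boundary values of the vertex profile, to which the flux
bound applies. The p's are free here so that p = 0 can be used for injectivity. -/
theorem norm_coupling_le (hγ : Continuous γ) (hγ1 : ∀ s, |γ s| < 1) (hz : z.im ≠ 0)
    (hε : 0 < ε) {p₁ p₂ q₁ q₂ : ℂ}
    (h1 : q₁ = ε * rV γ (ε ^ 2 * z) (-1) (-1) * (p₁ + Complex.I * sqrtUp z * q₁)
      + ε * rV γ (ε ^ 2 * z) (-1) 1 * (p₂ + Complex.I * sqrtUp z * q₂))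
    (h2 : q₂ = ε * rV γ (ε ^ 2 * z) 1 (-1) * (p₁ + Complex.I * sqrtUp z * q₁)
      + ε * rV γ (ε ^ 2 * z) 1 1 * (p₂ + Complex.I * sqrtUp z * q₂)) :
    |(sqrtUp z).re| * (‖q₁‖ + ‖q₂‖) ≤ 2 * (‖p₁‖ + ‖p₂‖) := by
  obtain ⟨y, y₁, hy, hyv, hl, hr⟩ := exists_vertexProfile hγ hγ1 hz hε
    (p₁ + Complex.I * sqrtUp z * q₁) (p₂ + Complex.I * sqrtUp z * q₂)
  have e1 : y (-1) = q₁ := by rw [hyv (-1) (by norm_num)]; linear_combination -h1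
  have e2 : y 1 = q₂ := by rw [hyv 1 (by norm_num)]; linear_combination -h2
  have := norm_boundary_le hz hε hy (by rw [e1]; exact hl) (by rw [e2]; exact hr)
  rwa [e1, e2] at this

/-- The homogeneous system has only the zero solution by the a priori bound with p = 0; in finite
dimension injectivity is bijectivity. -/
theorem existsUnique_coupling (hγ : Continuous γ) (hγ1 : ∀ s, |γ s| < 1) (hz : z.im ≠ 0)
    (hε : 0 < ε) (f₁ f₂ : ℝ → ℂ) : ∃! q : ℂ × ℂ, IsCoupling γ ε z f₁ f₂ q := by
  set m := Complex.I * sqrtUp z with hm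
  let r : ℝ → ℝ → ℂ := rV γ (ε ^ 2 * z)
  let T : (ℂ × ℂ) →ₗ[ℂ] (ℂ × ℂ) :=
    { toFun := fun q => (q.1 - (ε * r (-1) (-1) * (m * q.1) + ε * r (-1) 1 * (m * q.2)),
        q.2 - (ε * r 1 (-1) * (m * q.1) + ε * r 1 1 * (m * q.2)))
      map_add' := fun x y => by ext <;> simp <;> ring
      map_smul' := fun c x => by ext <;> simp <;> ring }
  have hT : ∀ q, T q = (q.1 - (ε * r (-1) (-1) * (m * q.1) + ε * r (-1) 1 * (m * q.2)),
        q.2 - (ε * r 1 (-1) * (m * q.1) + ε * r 1 1 * (m * q.2))) := fun _ => rfl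
  have hinj : Function.Injective T := by
    rw [injective_iff_map_eq_zero]
    intro q hq
    rw [hT, Prod.mk_eq_zero] at hq
    have := norm_coupling_le hγ hγ1 hz hε (p₁ := 0) (p₂ := 0) (q₁ := q.1) (q₂ := q.2)
      (by linear_combination hq.1) (by linear_combination hq.2)
    simp only [norm_zero, add_zero, mul_zero] at this
    have hpos : 0 < |(sqrtUp z).re| := abs_pos.2 (sqrtUp_re_ne_zero hz)
    have n1 := norm_nonneg q.1
    have n2 := norm_nonneg q.2
    have h0 : ‖q.1‖ + ‖q.2‖ ≤ 0 := le_of_mul_le_mul_left (by simpa using this) hpos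
    exact Prod.ext (norm_le_zero_iff.1 (by linarith)) (norm_le_zero_iff.1 (by linarith))
  have hbij : Function.Bijective T := ⟨hinj, LinearMap.injective_iff_surjective.1 hinj⟩
  obtain ⟨q, hq, huniq⟩ := hbij.existsUnique
    (ε * r (-1) (-1) * pConst z f₁ + ε * r (-1) 1 * pConst z f₂,
      ε * r 1 (-1) * pConst z f₁ + ε * r 1 1 * pConst z f₂)
  have hiff : ∀ q : ℂ × ℂ, T q = (ε * r (-1) (-1) * pConst z f₁ + ε * r (-1) 1 * pConst z f₂,
      ε * r 1 (-1) * pConst z f₁ + ε * r 1 1 * pConst z f₂) ↔ IsCoupling γ ε z f₁ f₂ q := by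
    intro q
    rw [hT, Prod.mk_inj, IsCoupling, xiConst, xiConst]
    constructor
    · rintro ⟨h1, h2⟩
      exact ⟨by linear_combination h1, by linear_combination h2⟩
    · rintro ⟨h1, h2⟩
      exact ⟨by linear_combination h1, by linear_combination h2⟩
  exact ⟨q, (hiff q).1 hq, fun q' hq' => huniq q' ((hiff q').2 hq')⟩

theorem SolvesODE.lineH2 {q y y₁ : ℝ → ℂ} (hq : Continuous q) (hy : SolvesODE q y y₁) :
    LineH2 (Ioo (-1) 1) y y₁ (fun t => -(q t * y t)) :=
  lineH2_of_hasDerivAt (by norm_num) hy.deriv_fst hy.deriv_snd (hq.mul hy.continuous_fst).neg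

theorem ae_eq_tensor_of_forall {I J : Set ℝ} (hI : MeasurableSet I) (hJ : MeasurableSet J)
    {F χ : ℝ → ℂ} {ψ : ℝ × ℝ → ℂ} (h : ∀ s ∈ I, ∀ u, ψ (s, u) = F s * χ u) :
    ψ =ᵐ[volume.restrict (I ×ˢ J)] tensor F χ := by
  filter_upwards [ae_restrict_mem (hI.prod hJ)] with x hx using h x.1 hx.1 x.2

theorem tendsto_right_of_isPrim {a b : ℝ} (hab : a < b) {F F₁ : ℝ → ℂ} (h : IsPrim a b F F₁) :
    Tendsto (fun t => F (a + 1 * t)) (𝓝[>] 0) (𝓝 (F a)) := by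
  have hc : Tendsto F (𝓝[Icc a b] a) (𝓝 (F a)) := h.continuousOn hab.le a ⟨le_rfl, hab.le⟩
  refine hc.comp (tendsto_nhdsWithin_iff.2 ⟨?_, ?_⟩)
  · have : Tendsto (fun t : ℝ => a + 1 * t) (𝓝 0) (𝓝 (a + 1 * 0)) :=
      Continuous.tendsto (by fun_prop) 0
    simpa using this.mono_left nhdsWithin_le_nhds
  · filter_upwards [Ioo_mem_nhdsGT (sub_pos.2 hab)] with t ht
    exact ⟨by linarith [ht.1], by linarith [ht.2]⟩

theorem tendsto_side_of_continuous {F : ℝ → ℂ} (h : Continuous F) (a σ : ℝ) :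
    Tendsto (fun t => F (a + σ * t)) (𝓝[>] 0) (𝓝 (F a)) := by
  have : Tendsto (fun t => F (a + σ * t)) (𝓝 0) (𝓝 (F (a + σ * 0))) :=
    Continuous.tendsto (by fun_prop) 0
  simpa using this.mono_left nhdsWithin_le_nhds

/-- On the edges the profile has boundary value q and derivative ξ; on the vertex the boundary
values are q₁, q₂ by the coupling, and the derivatives are -εξ₁, εξ₂. The factors ∓1/ε of the
matching conditions convert one into the other. -/
theorem hatPsi_memDomain (hγ : Continuous γ) (hγ1 : ∀ s, |γ s| < 1) (hz : z.im ≠ 0)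
    (hε : 0 < ε) (n : ℕ) {f₁ f₂ : ℝ → ℂ} (hf₁ : MemLp f₁ 2 (volume.restrict (Ioi 0)))
    (hf₂ : MemLp f₂ 2 (volume.restrict (Ioi 0))) {q : ℂ × ℂ} (hq : IsCoupling γ ε z f₁ f₂ q) :
    MemDomain ε (hatPsi γ ε z n f₁ f₂ q) := by
  obtain ⟨y, y₁, hy, hyv, hl, hr⟩ := exists_vertexProfile hγ hγ1 hz hε
    (xiConst z f₁ q.1) (xiConst z f₂ q.2)
  have e1 : y (-1) = q.1 := by rw [hyv (-1) (by norm_num)]; linear_combination -hq.1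
  have e2 : y 1 = q.2 := by rw [hyv 1 (by norm_num)]; linear_combination -hq.2
  obtain ⟨F, hF, hF0, hFd⟩ := exists_halfLineH2 hz hf₁ q.1
  obtain ⟨G, hG, hG0, hGd⟩ := exists_halfLineH2 hz hf₂ q.2
  rw [← pConst_eq hz hf₁] at hFd
  rw [← pConst_eq hz hf₂] at hGd
  have hχ := lineH2_chi n
  have hχc := continuous_chi n
  have hE0 : expI (sqrtUp z) 0 = 1 := by simp [expI]
  have hYL := hy.lineH2 (continuous_shiftedPot hγ _)
  have p1 : ∀ s ∈ Ioi (0 : ℝ), ∀ u, (hatPsi γ ε z n f₁ f₂ q).1 (s, u) =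
      (r0 z f₁ s + q.1 * expI (sqrtUp z) s) * chi n u := fun s _ u => rfl
  have p2 : ∀ s ∈ Ioi (0 : ℝ), ∀ u, (hatPsi γ ε z n f₁ f₂ q).2.1 (s, u) =
      (r0 z f₂ s + q.2 * expI (sqrtUp z) s) * chi n u := fun s _ u => rfl
  have p3 : ∀ s ∈ Ioo (-1 : ℝ) 1, ∀ u, (hatPsi γ ε z n f₁ f₂ q).2.2 (s, u) = y s * chi n u :=
    fun s hs u => by
      rw [hyv s (Ioo_subset_Icc_self hs)]; rfl
  have a1 := ae_eq_tensor_of_forall measurableSet_Ioi (measurableSet_Ioo (a := (0 : ℝ)) (b := 1)) p1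
  have a2 := ae_eq_tensor_of_forall measurableSet_Ioi (measurableSet_Ioo (a := (0 : ℝ)) (b := 1)) p2
  have a3 := ae_eq_tensor_of_forall measurableSet_Ioo (measurableSet_Ioo (a := (0 : ℝ)) (b := 1)) p3
  have d1 := hF.lineH2.dS_ae_eq hχ isOpen_Ioi isOpen_Ioo a1
  have d2 := hG.lineH2.dS_ae_eq hχ isOpen_Ioi isOpen_Ioo a2
  have d3 := hYL.dS_ae_eq hχ isOpen_Ioo isOpen_Ioo a3
  have sub1 : ∀ t ∈ Ioo (0 : ℝ) 1, 0 + 1 * t ∈ Ioi (0 : ℝ) := fun t ht => by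
    simpa using ht.1
  have sub2 : ∀ t ∈ Ioo (0 : ℝ) 1, -1 + 1 * t ∈ Ioo (-1 : ℝ) 1 := fun t ht =>
    ⟨by linarith [ht.1], by linarith [ht.2]⟩
  have sub3 : ∀ t ∈ Ioo (0 : ℝ) 1, 1 + -1 * t ∈ Ioo (-1 : ℝ) 1 := fun t ht =>
    ⟨by linarith [ht.2], by linarith [ht.1]⟩
  have hε0 : (ε : ℂ) ≠ 0 := by exact_mod_cast hε.ne'
  have hyc := hy.continuous_fst
  have hy₁c := hy.continuous_snd
  refine
    { memH2_one := hF.lineH2.memH2 hχ isOpen_Ioi isOpen_Ioo a1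
      memH2_two := hG.lineH2.memH2 hχ isOpen_Ioi isOpen_Ioo a2
      memH2_vertex := hYL.memH2 hχ isOpen_Ioo isOpen_Ioo a3
      dirichlet_one := ⟨hasTraceU_zero_of_eq_tensor hF.memLp measurableSet_Ioi hχc (chi_zero n) p1,
        hasTraceU_zero_of_eq_tensor hF.memLp measurableSet_Ioi hχc (chi_one n) p1⟩
      dirichlet_two := ⟨hasTraceU_zero_of_eq_tensor hG.memLp measurableSet_Ioi hχc (chi_zero n) p2,
        hasTraceU_zero_of_eq_tensor hG.memLp measurableSet_Ioi hχc (chi_one n) p2⟩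
      dirichlet_vertex := ⟨hasTraceU_zero_of_eq_tensor hYL.memLp measurableSet_Ioo hχc
          (chi_zero n) p3,
        hasTraceU_zero_of_eq_tensor hYL.memLp measurableSet_Ioo hχc (chi_one n) p3⟩
      match_one := ⟨fun u => q.1 * chi n u, ?_, ?_⟩
      match_two := ⟨fun u => q.2 * chi n u, ?_, ?_⟩
      match_deriv_one := ⟨fun u => -(ε * xiConst z f₁ q.1) * chi n u, ?_, ?_⟩
      match_deriv_two := ⟨fun u => ε * xiConst z f₂ q.2 * chi n u, ?_, ?_⟩ }
  · refine hasTraceS_of_ae_eq_tensor one_ne_zero hχ.memLp measurableSet_Ioi a1 one_pos sub1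
      (tendsto_right_of_isPrim one_pos (hF.isPrim 1 zero_le_one)) fun u => ?_
    simp only [hF0, hE0]; ring
  · exact hasTraceS_of_ae_eq_tensor one_ne_zero hχ.memLp measurableSet_Ioo a3 one_pos sub2
      (tendsto_side_of_continuous hyc _ _) fun u => by rw [e1]
  · refine hasTraceS_of_ae_eq_tensor one_ne_zero hχ.memLp measurableSet_Ioi a2 one_pos sub1
      (tendsto_right_of_isPrim one_pos (hG.isPrim 1 zero_le_one)) fun u => ?_
    simp only [hG0, hE0]; ring
  · exact hasTraceS_of_ae_eq_tensor (by norm_num) hχ.memLp measurableSet_Ioo a3 one_pos sub3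
      (tendsto_side_of_continuous hyc _ _) fun u => by rw [e2]
  · exact hasTraceS_of_ae_eq_tensor one_ne_zero hχ.memLp measurableSet_Ioo d3 one_pos sub2
      (tendsto_side_of_continuous hy₁c _ _) fun u => by rw [hl]
  · refine hasTraceS_of_ae_eq_tensor one_ne_zero hχ.memLp measurableSet_Ioi d1 one_pos sub1
      (tendsto_right_of_isPrim one_pos (hF.isPrim_deriv 1 zero_le_one)) fun u => ?_
    rw [hFd, xiConst]; field_simp
  · exact hasTraceS_of_ae_eq_tensor (by norm_num) hχ.memLp measurableSet_Ioo d3 one_pos sub3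
      (tendsto_side_of_continuous hy₁c _ _) fun u => by rw [hr]
  · refine hasTraceS_of_ae_eq_tensor one_ne_zero hχ.memLp measurableSet_Ioi d2 one_pos sub1
      (tendsto_right_of_isPrim one_pos (hG.isPrim_deriv 1 zero_le_one)) fun u => ?_
    rw [hGd, xiConst]; field_simp

end

/-! ### Bounds for the vertex profile -/

section
variable {γ : ℝ → ℝ} {z : ℂ}

/-- `y` is the vertex profile of the approximate solution with data `p₁`, `p₂`. -/
structure IsProfile (γ : ℝ → ℝ) (z : ℂ) (ε : ℝ) (p₁ p₂ : ℂ) (y y₁ : ℝ → ℂ) : Prop where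
  solves : SolvesODE (shiftedPot γ ((ε : ℂ) ^ 2 * z)) y y₁
  left : y₁ (-1) = -(ε * (p₁ + Complex.I * sqrtUp z * y (-1)))
  right : y₁ 1 = ε * (p₂ + Complex.I * sqrtUp z * y 1)

theorem norm_shiftedPot_le_of_le_one (hγ1 : ∀ s, |γ s| < 1) {ε : ℝ} (hε : 0 < ε) (hε1 : ε ≤ 1)
    (t : ℝ) : ‖shiftedPot γ ((ε : ℂ) ^ 2 * z) t‖ ≤ 1 + ‖z‖ := by
  refine (norm_shiftedPot_le hγ1 _ t).trans ?_
  have h1 : ‖(ε : ℂ) ^ 2 * z‖ ≤ ‖z‖ := by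
    rw [norm_mul, norm_pow, Complex.norm_real, Real.norm_of_nonneg hε.le]
    exact mul_le_of_le_one_left (norm_nonneg z) (pow_le_one₀ hε.le hε1)
  linarith

/-- The boundary values are O(|p₁| + |p₂|) by the flux bound, and the boundary derivatives carry an
explicit extra ε. That extra ε is what the case without zero eigenvalue exploits. -/
theorem IsProfile.norm_flux_le (hz : z.im ≠ 0) {ε : ℝ} (hε : 0 < ε) {p₁ p₂ : ℂ} {y y₁ : ℝ → ℂ}
    (h : IsProfile γ z ε p₁ p₂ y y₁) :
    ‖y (-1)‖ ≤ 2 / |(sqrtUp z).re| * (‖p₁‖ + ‖p₂‖) ∧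
    ‖y₁ (-1)‖ ≤ ε * ((1 + ‖sqrtUp z‖ * (2 / |(sqrtUp z).re|)) * (‖p₁‖ + ‖p₂‖)) ∧
    ‖y₁ 1‖ ≤ ε * ((1 + ‖sqrtUp z‖ * (2 / |(sqrtUp z).re|)) * (‖p₁‖ + ‖p₂‖)) := by
  have hre : 0 < |(sqrtUp z).re| := abs_pos.2 (sqrtUp_re_ne_zero hz)
  have hb := norm_boundary_le hz hε h.solves h.left h.right
  have hq : ‖y (-1)‖ + ‖y 1‖ ≤ 2 / |(sqrtUp z).re| * (‖p₁‖ + ‖p₂‖) := by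
    rw [div_mul_eq_mul_div, le_div_iff₀ hre]; linarith
  have n1 := norm_nonneg (y (-1))
  have n2 := norm_nonneg (y 1)
  have n3 := norm_nonneg p₁
  have n4 := norm_nonneg p₂
  have flux : ∀ p q : ℂ, ‖p‖ ≤ ‖p₁‖ + ‖p₂‖ → ‖q‖ ≤ 2 / |(sqrtUp z).re| * (‖p₁‖ + ‖p₂‖) →
      ‖(ε : ℂ) * (p + Complex.I * sqrtUp z * q)‖ ≤
        ε * ((1 + ‖sqrtUp z‖ * (2 / |(sqrtUp z).re|)) * (‖p₁‖ + ‖p₂‖)) := by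
    intro p q hp hq
    rw [norm_mul, Complex.norm_real, Real.norm_of_nonneg hε.le]
    gcongr
    refine (norm_add_le _ _).trans ?_
    rw [norm_mul, norm_mul, Complex.norm_I, one_mul, add_mul, one_mul, mul_assoc]
    gcongr
  refine ⟨by linarith, ?_, ?_⟩
  · rw [h.left, norm_neg]; exact flux _ _ (by linarith) (by linarith)
  · rw [h.right]; exact flux _ _ (by linarith) (by linarith)

/-- Gronwall from the data at -1. The factor 1 + |z| in front of the exponential is there so that
one constant also covers y'' = -q y. -/
theorem SolvesODE.norm_le (hγ1 : ∀ s, |γ s| < 1) {ε : ℝ} (hε : 0 < ε) (hε1 : ε ≤ 1)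
    {y y₁ : ℝ → ℂ} (h : SolvesODE (shiftedPot γ ((ε : ℂ) ^ 2 * z)) y y₁) {M : ℝ}
    (h0 : ‖y (-1)‖ ≤ M) (h1 : ‖y₁ (-1)‖ ≤ M) {s : ℝ} (hs : s ∈ Icc (-1 : ℝ) 1) :
    ‖y s‖ ≤ M * ((1 + ‖z‖) * Real.exp ((1 + ‖z‖) * 2)) ∧
    ‖y₁ s‖ ≤ M * ((1 + ‖z‖) * Real.exp ((1 + ‖z‖) * 2)) ∧
    ‖shiftedPot γ ((ε : ℂ) ^ 2 * z) s * y s‖ ≤ M * ((1 + ‖z‖) * Real.exp ((1 + ‖z‖) * 2)) := by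
  have hz0 := norm_nonneg z
  have hM : 0 ≤ M := (norm_nonneg _).trans h0
  have hq := norm_shiftedPot_le_of_le_one (γ := γ) (z := z) hγ1 hε hε1
  obtain ⟨g0, g1⟩ := norm_le_of_cauchyData (a := -1) (b := 1) (g := fun _ => 0) (G := 0)
    (K := 1 + ‖z‖) h.deriv_fst (fun t => by simpa using h.deriv_snd t) (by linarith)
    (fun t _ => hq t) (fun t _ => by simp) h0 h1 s hs
  rw [show (1 : ℝ) - -1 = 2 by norm_num, add_zero] at g0 g1
  have hle : M * Real.exp ((1 + ‖z‖) * 2) ≤ M * ((1 + ‖z‖) * Real.exp ((1 + ‖z‖) * 2)) := by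
    gcongr
    exact le_mul_of_one_le_left (Real.exp_pos _).le (by linarith)
  refine ⟨g0.trans hle, g1.trans hle, ?_⟩
  rw [norm_mul, mul_left_comm]
  exact mul_le_mul (hq s) g0 (norm_nonneg _) (by linarith)

theorem exists_profile_bound (hγ1 : ∀ s, |γ s| < 1) (hz : z.im ≠ 0) :
    ∃ C : ℝ, 0 < C ∧ ∀ (ε : ℝ) (p₁ p₂ : ℂ) (y y₁ : ℝ → ℂ), 0 < ε → ε ≤ 1 →
      IsProfile γ z ε p₁ p₂ y y₁ → ∀ s ∈ Icc (-1 : ℝ) 1,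
        ‖y s‖ ≤ C * (‖p₁‖ + ‖p₂‖) ∧ ‖y₁ s‖ ≤ C * (‖p₁‖ + ‖p₂‖) ∧
        ‖shiftedPot γ ((ε : ℂ) ^ 2 * z) s * y s‖ ≤ C * (‖p₁‖ + ‖p₂‖) := by
  have hre : 0 < |(sqrtUp z).re| := abs_pos.2 (sqrtUp_re_ne_zero hz)
  have hz0 := norm_nonneg z
  set A := 2 / |(sqrtUp z).re| with hA
  set B := 1 + ‖sqrtUp z‖ * A with hB
  have hA0 : 0 < A := by positivity
  have hB0 : 0 < B := by positivity
  set X := (1 + ‖z‖) * Real.exp ((1 + ‖z‖) * 2) with hX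
  have hX0 : 0 < X := by positivity
  refine ⟨(A + B) * X, by positivity, fun ε p₁ p₂ y y₁ hε hε1 h s hs => ?_⟩
  obtain ⟨h1, h2, -⟩ := h.norm_flux_le hz hε
  set P := ‖p₁‖ + ‖p₂‖ with hP
  have hP0 : 0 ≤ P := by positivity
  have hAP : 0 ≤ A * P := by positivity
  have hBP : 0 ≤ B * P := by positivity
  have := h.solves.norm_le hγ1 hε hε1 (M := (A + B) * P) (by linarith)
    (h2.trans (by nlinarith)) hs
  rwa [mul_right_comm] at this

theorem exists_profile_bound_of_not_eigenvalue (hγ : Continuous γ) (hγ1 : ∀ s, |γ s| < 1)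
    (hz : z.im ≠ 0) (hne : ¬ IsNeumannEigenvalue γ 0) :
    ∃ C : ℝ, 0 < C ∧ ∀ (ε : ℝ) (p₁ p₂ : ℂ) (y y₁ : ℝ → ℂ), 0 < ε → ε ≤ 1 →
      IsProfile γ z ε p₁ p₂ y y₁ → ∀ s ∈ Icc (-1 : ℝ) 1,
        ‖y s‖ ≤ C * (ε * (‖p₁‖ + ‖p₂‖)) ∧ ‖y₁ s‖ ≤ C * (ε * (‖p₁‖ + ‖p₂‖)) ∧
        ‖shiftedPot γ ((ε : ℂ) ^ 2 * z) s * y s‖ ≤ C * (ε * (‖p₁‖ + ‖p₂‖)) := by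
  obtain ⟨C₂, hC₂, hbound⟩ := exists_profile_bound hγ1 hz
  obtain ⟨a, a₁, b, b₁, ha⟩ := exists_neumannPair hγ hγ1 0
  have hD : a₁ 1 ≠ 0 := fun h0 =>
    hne (ha.left.isNeumannEigenvalue hγ ha.left_deriv h0 (by simp [ha.left_val]))
  have hD0 : 0 < ‖a₁ 1‖ := norm_pos_iff.2 hD
  have hre : 0 < |(sqrtUp z).re| := abs_pos.2 (sqrtUp_re_ne_zero hz)
  have hz0 := norm_nonneg z
  set A := 2 / |(sqrtUp z).re| with hA
  set B := 1 + ‖sqrtUp z‖ * A with hB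
  have hA0 : 0 < A := by positivity
  have hB0 : 0 < B := by positivity
  set X := (1 + ‖z‖) * Real.exp ((1 + ‖z‖) * 2) with hX
  have hX0 : 0 < X := by positivity
  set C₃ := (B + ‖z‖ * C₂) * Real.exp (1 * 2) with hC₃
  have hC₃0 : 0 < C₃ := by positivity
  refine ⟨((B + C₃) / ‖a₁ 1‖ + B) * X, by positivity, fun ε p₁ p₂ y y₁ hε hε1 h s hs => ?_⟩
  obtain ⟨-, h2, h3⟩ := h.norm_flux_le hz hε
  have hb := hbound ε p₁ p₂ y y₁ hε hε1 h
  set P := ‖p₁‖ + ‖p₂‖ with hP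
  have hP0 : 0 ≤ P := by positivity
  -- Compare y with y(-1)a, where h_v a = 0. The difference vanishes at -1, has slope O(ε) there,
  -- and its source -ε²z y is O(ε) by the bound already known.
  have hd := norm_le_of_cauchyData (y := fun t => y t - y (-1) * a t)
    (y₁ := fun t => y₁ t - y (-1) * a₁ t) (q := shiftedPot γ 0)
    (g := fun t => -((ε : ℂ) ^ 2 * z * y t)) (a := -1) (b := 1) (K := 1) (M := ε * (B * P))
    (G := ε * (‖z‖ * C₂ * P))
    (fun t => (h.solves.deriv_fst t).sub ((ha.left.deriv_fst t).const_mul _))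
    (fun t => ((h.solves.deriv_snd t).sub ((ha.left.deriv_snd t).const_mul _)).congr_deriv (by
      simp only [shiftedPot]; ring)) le_rfl
    (fun t _ => (norm_shiftedPot_le hγ1 0 t).trans (by norm_num))
    (fun t ht => by
      rw [norm_neg, norm_mul, norm_mul, norm_pow, Complex.norm_real, Real.norm_of_nonneg hε.le,
        mul_assoc, mul_assoc]
      have : ε ^ 2 ≤ ε := by nlinarith
      gcongr
      exact (hb t ht).1)
    (by simp only [ha.left_val, mul_one, sub_self, norm_zero]; positivity)
    (by simpa only [ha.left_deriv, mul_zero, sub_zero] using h2) 1 (by norm_num)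
  have hd1 := hd.2
  have hC3e : (ε * (B * P) + ε * (‖z‖ * C₂ * P)) * Real.exp (1 * (1 - -1)) = ε * (C₃ * P) := by
    rw [hC₃, show (1 : ℝ) - -1 = 2 by norm_num]; ring
  rw [hC3e] at hd1
  -- At s = 1 both y' and the derivative of the difference are O(ε), hence so is y(-1)a'(1); divide
  -- by a'(1) ≠ 0.
  have hq : ‖y (-1)‖ ≤ (B + C₃) / ‖a₁ 1‖ * (ε * P) := by
    rw [div_mul_eq_mul_div, le_div_iff₀ hD0, ← norm_mul]
    have : y (-1) * a₁ 1 = y₁ 1 - (y₁ 1 - y (-1) * a₁ 1) := by ring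
    rw [this]
    refine (norm_sub_le _ _).trans ?_
    linarith
  have hεP : 0 ≤ ε * P := by positivity
  have t1 : 0 ≤ (B + C₃) / ‖a₁ 1‖ * (ε * P) := by positivity
  have t2 : 0 ≤ B * (ε * P) := by positivity
  have := h.solves.norm_le hγ1 hε hε1 (M := ((B + C₃) / ‖a₁ 1‖ + B) * (ε * P)) (by linarith)
    (by linarith) hs
  rwa [mul_right_comm] at this

end

/-! ### The coefficients on the vertex region -/

theorem hasDerivAt_inv_metricG {γ : ℝ → ℝ} (hγ : ContDiff ℝ ∞ γ) {β s u : ℝ}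
    (h : 1 + u * β * γ s ≠ 0) :
    HasDerivAt (fun t => 1 / metricG γ β (t, u)) (-2 * (u * β * deriv γ s) / (1 + u * β * γ s) ^ 3)
      s := by
  have h1 : HasDerivAt γ (deriv γ s) s := (hγ.differentiable (by norm_num) s).hasDerivAt
  have h2 := (((h1.const_mul (u * β)).const_add 1).pow 2).inv (pow_ne_zero 2 h)
  simp only [metricG, one_div]
  refine h2.congr_deriv ?_
  field_simp
  norm_num
  ring

/-- On the compact interval |γ| attains a maximum below 1, so 1 + uβγ ≥ k > 0 uniformly for uβ ≤ 1.
At β = 0 the coefficients are those of h_v, and each deviation carries an explicit factor uβ over a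
power of 1 + uβγ. -/
theorem exists_coefficient_bound {γ : ℝ → ℝ} (hγ : ContDiff ℝ ∞ γ) (hγ1 : ∀ s, |γ s| < 1) :
    ∃ C : ℝ, 0 < C ∧ ∀ β s u : ℝ, 0 < β → β ≤ 1 → s ∈ Icc (-1 : ℝ) 1 → u ∈ Icc (0 : ℝ) 1 →
      |1 - 1 / metricG γ β (s, u)| ≤ C * β ∧
      |deriv (fun t => 1 / metricG γ β (t, u)) s| ≤ C * β ∧
      |potW γ β (s, u) + γ s ^ 2 / 4| ≤ C * β := by
  obtain ⟨s₀, -, hmax⟩ := isCompact_Icc.exists_isMaxOn (nonempty_Icc.2 (by norm_num : (-1 : ℝ) ≤ 1))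
    (hγ.continuous.abs.continuousOn)
  have hd1 : ContDiff ℝ ∞ (deriv γ) := hγ.iterate_deriv 1
  have hd2 : ContDiff ℝ ∞ (deriv (deriv γ)) := hγ.iterate_deriv 2
  obtain ⟨A₁, hA₁⟩ := isCompact_Icc.exists_bound_of_continuousOn (s := Icc (-1 : ℝ) 1)
    hd1.continuous.continuousOn
  obtain ⟨A₂, hA₂⟩ := isCompact_Icc.exists_bound_of_continuousOn (s := Icc (-1 : ℝ) 1)
    hd2.continuous.continuousOn
  set k := 1 - |γ s₀| with hk
  have hk0 : 0 < k := sub_pos.2 (hγ1 s₀)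
  have hA₁0 : 0 ≤ A₁ := (norm_nonneg _).trans (hA₁ 0 (by norm_num))
  have hA₂0 : 0 ≤ A₂ := (norm_nonneg _).trans (hA₂ 0 (by norm_num))
  set c₁ := 3 / k ^ 2 with hc₁
  set c₂ := 2 * A₁ / k ^ 3 with hc₂
  set c₃ := A₂ / k ^ 3 with hc₃
  set c₄ := 5 / 4 * (A₁ ^ 2 / k ^ 4) with hc₄
  have p1 : 0 < c₁ := by positivity
  have p2 : 0 ≤ c₂ := by positivity
  have p3 : 0 ≤ c₃ := by positivity
  have p4 : 0 ≤ c₄ := by positivity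
  refine ⟨c₁ + c₂ + c₃ + c₄, by positivity, fun β s u hβ hβ1 hs hu => ?_⟩
  have hγs : |γ s| ≤ |γ s₀| := hmax hs
  have hub0 : 0 ≤ u * β := mul_nonneg hu.1 hβ.le
  have hubβ : u * β ≤ β := mul_le_of_le_one_left hβ.le hu.2
  set v := 1 + u * β * γ s with hv
  have ht : |u * β * γ s| ≤ |γ s₀| := by
    rw [abs_mul, abs_of_nonneg hub0]
    calc u * β * |γ s| ≤ 1 * |γ s₀| := by gcongr; linarith
      _ = _ := one_mul _
  have hkv : k ≤ v := by have := neg_abs_le (u * β * γ s); linarith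
  have hv0 : 0 < v := hk0.trans_le hkv
  have hv2 : v ≤ 2 := by have := le_abs_self (u * β * γ s); have := hγ1 s₀; linarith
  have e1 : |1 - 1 / v ^ 2| ≤ c₁ * β := by
    have h1 : 1 - 1 / v ^ 2 = (u * β * γ s) * (v + 1) / v ^ 2 := by
      rw [hv] at hv0 ⊢; field_simp; ring
    rw [h1, abs_div, abs_mul, abs_of_pos (by positivity : 0 < v ^ 2),
      abs_of_pos (by linarith : 0 < v + 1), abs_mul, abs_of_nonneg hub0]
    calc u * β * |γ s| * (v + 1) / v ^ 2 ≤ β * 1 * (2 + 1) / k ^ 2 := by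
          gcongr
          exact (hγ1 s).le
      _ = c₁ * β := by rw [hc₁]; ring
  have d1 : |deriv γ s| ≤ A₁ := hA₁ s hs
  have d2 : |deriv (deriv γ) s| ≤ A₂ := hA₂ s hs
  have e2 : |deriv (fun t => 1 / metricG γ β (t, u)) s| ≤ c₂ * β := by
    rw [(hasDerivAt_inv_metricG hγ hv0.ne').deriv, ← hv, abs_div, abs_mul, abs_mul,
      abs_of_nonneg hub0, abs_of_pos (by positivity : 0 < v ^ 3)]
    calc |(-2 : ℝ)| * (u * β * |deriv γ s|) / v ^ 3 ≤ 2 * (β * A₁) / k ^ 3 := by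
          rw [abs_neg, abs_two]
          gcongr
      _ = c₂ * β := by rw [hc₂]; ring
  have e3 : |u * β * deriv (deriv γ) s / v ^ 3| ≤ c₃ * β := by
    rw [abs_div, abs_mul, abs_of_nonneg hub0, abs_of_pos (by positivity : 0 < v ^ 3)]
    calc u * β * |deriv (deriv γ) s| / v ^ 3 ≤ β * A₂ / k ^ 3 := by gcongr
      _ = c₃ * β := by rw [hc₃]; ring
  have e4 : |5 / 4 * ((u * β * deriv γ s) ^ 2 / v ^ 4)| ≤ c₄ * β := by
    rw [abs_of_nonneg (by positivity), ← sq_abs, abs_mul, abs_of_nonneg hub0]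
    calc 5 / 4 * ((u * β * |deriv γ s|) ^ 2 / v ^ 4) ≤ 5 / 4 * ((β * A₁) ^ 2 / k ^ 4) := by gcongr
      _ = c₄ * β ^ 2 := by rw [hc₄]; ring
      _ ≤ c₄ * β := by gcongr; nlinarith
  have q1 : 0 ≤ c₁ * β := by positivity
  have q2 : 0 ≤ c₂ * β := by positivity
  have q3 : 0 ≤ c₃ * β := by positivity
  have q4 : 0 ≤ c₄ * β := by positivity
  refine ⟨?_, ?_, ?_⟩
  · simp only [metricG, ← hv]; linarith
  · linarith
  · have hW : potW γ β (s, u) + γ s ^ 2 / 4 = γ s ^ 2 / 4 * (1 - 1 / v ^ 2)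
        + 1 / 2 * (u * β * deriv (deriv γ) s / v ^ 3)
        - 5 / 4 * ((u * β * deriv γ s) ^ 2 / v ^ 4) := by
      simp only [potW, ← hv]; ring
    rw [hW]
    refine (abs_sub _ _).trans ?_
    refine (add_le_add_left (abs_add_le _ _) _).trans ?_
    have hγ2 : γ s ^ 2 ≤ 1 := ((sq_lt_one_iff_abs_lt_one (γ s)).2 (hγ1 s)).le
    have f1 : |γ s ^ 2 / 4 * (1 - 1 / v ^ 2)| ≤ c₁ * β := by
      rw [abs_mul, abs_of_nonneg (by positivity)]
      refine (mul_le_of_le_one_left (abs_nonneg _) (by linarith)).trans e1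
    have f2 : |1 / 2 * (u * β * deriv (deriv γ) s / v ^ 3)| ≤ c₃ * β := by
      rw [abs_mul, abs_of_nonneg (by norm_num)]
      exact (mul_le_of_le_one_left (abs_nonneg _) (by norm_num)).trans e3
    linarith

/-! ### The error of the approximate solution -/

section
variable {γ : ℝ → ℝ} {z : ℂ} {ε δ : ℝ} {n : ℕ} {f₁ f₂ : ℝ → ℂ} {q : ℂ × ℂ}

theorem exists_isProfile (hγ : Continuous γ) (hγ1 : ∀ s, |γ s| < 1) (hz : z.im ≠ 0)
    (hε : 0 < ε) (hq : IsCoupling γ ε z f₁ f₂ q) :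
    ∃ y y₁ : ℝ → ℂ, IsProfile γ z ε (pConst z f₁) (pConst z f₂) y y₁ ∧
      ∀ s ∈ Ioo (-1 : ℝ) 1, ∀ u, (hatPsi γ ε z n f₁ f₂ q).2.2 (s, u) = y s * chi n u := by
  obtain ⟨y, y₁, hy, hyv, hl, hr⟩ := exists_vertexProfile hγ hγ1 hz hε
    (xiConst z f₁ q.1) (xiConst z f₂ q.2)
  have e1 : y (-1) = q.1 := by rw [hyv (-1) (by norm_num)]; linear_combination -hq.1
  have e2 : y 1 = q.2 := by rw [hyv 1 (by norm_num)]; linear_combination -hq.2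
  exact ⟨y, y₁, ⟨hy, by rw [e1]; exact hl, by rw [e2]; exact hr⟩,
    fun s hs u => by rw [hyv s (Ioo_subset_Icc_self hs)]; rfl⟩

theorem edge_error_eq_zero (hz : z.im ≠ 0) (n : ℕ) {f : ℝ → ℂ}
    (hf : MemLp f 2 (volume.restrict (Ioi 0))) (q : ℂ) {ψ : ℝ × ℝ → ℂ}
    (hψ : ∀ x, ψ x = (r0 z f x.1 + q * expI (sqrtUp z) x.1) * chi n x.2) :
    (fun x => -dS E (dS E ψ) x - (1 / (δ : ℂ) ^ 2) * dU E (dU E ψ) x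
      - (((n ^ 2 * Real.pi ^ 2 / δ ^ 2 : ℝ) : ℂ) + z) * ψ x - f x.1 * chi n x.2)
      =ᵐ[volume.restrict E] 0 := by
  obtain ⟨F, hF, -, -⟩ := exists_halfLineH2 hz hf q
  have a1 := ae_eq_tensor_of_forall (I := Ioi (0 : ℝ)) (J := Ioo (0 : ℝ) 1) (χ := chi n)
    (F := fun s => r0 z f s + q * expI (sqrtUp z) s) (ψ := ψ) measurableSet_Ioi measurableSet_Ioo (fun s _ u => hψ (s, u))
  have h1 := hF.lineH2.dS_dS_ae_eq (lineH2_chi n) isOpen_Ioi isOpen_Ioo a1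
  have h2 := hF.lineH2.dU_dU_ae_eq (lineH2_chi n) isOpen_Ioi isOpen_Ioo a1
  rw [← E] at h1 h2
  filter_upwards [h1, h2] with x e1 e2
  simp only [e1, e2, hψ x, tensor, Pi.zero_apply]
  push_cast; ring

/-- Subtracting the equation of y leaves coefficient differences times y'', y' and y. The transverse
terms cancel because (εβ)⁻² = δ⁻². -/
theorem vertex_error_ae_eq (hγ : Continuous γ) (hδ : 0 < δ) (hε : 0 < ε) (n : ℕ)
    {y y₁ : ℝ → ℂ} (hy : SolvesODE (shiftedPot γ ((ε : ℂ) ^ 2 * z)) y y₁) {ψ : ℝ × ℝ → ℂ}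
    (hψ : ∀ s ∈ Ioo (-1 : ℝ) 1, ∀ u, ψ (s, u) = y s * chi n u) :
    (fun x => (1 / (ε : ℂ) ^ 2) * opL γ (δ / ε) ψ x
      - (((n ^ 2 * Real.pi ^ 2 / δ ^ 2 : ℝ) : ℂ) + z) * ψ x)
      =ᵐ[volume.restrict V] fun x => 1 / (ε : ℂ) ^ 2 *
        (((1 - 1 / metricG γ (δ / ε) x : ℝ) : ℂ) * -(shiftedPot γ ((ε : ℂ) ^ 2 * z) x.1 * y x.1)
        - ((deriv (fun t => 1 / metricG γ (δ / ε) (t, x.2)) x.1 : ℝ) : ℂ) * y₁ x.1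
        + ((potW γ (δ / ε) x + γ x.1 ^ 2 / 4 : ℝ) : ℂ) * y x.1) * chi n x.2 := by
  have hYL := hy.lineH2 (continuous_shiftedPot hγ _)
  have a1 := ae_eq_tensor_of_forall (J := Ioo (0 : ℝ) 1) measurableSet_Ioo measurableSet_Ioo hψ
  have h1 := hYL.dS_ae_eq (lineH2_chi n) isOpen_Ioo isOpen_Ioo a1
  have h2 := hYL.dS_dS_ae_eq (lineH2_chi n) isOpen_Ioo isOpen_Ioo a1
  have h3 := hYL.dU_dU_ae_eq (lineH2_chi n) isOpen_Ioo isOpen_Ioo a1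
  rw [← V] at a1 h1 h2 h3
  have hε0 : (ε : ℂ) ≠ 0 := by exact_mod_cast hε.ne'
  have hδ0 : (δ : ℂ) ≠ 0 := by exact_mod_cast hδ.ne'
  filter_upwards [a1, h1, h2, h3] with x e0 e1 e2 e3
  simp only [opL, e0, e1, e2, e3, tensor]
  have hβ : ((1 / (δ / ε) ^ 2 : ℝ) : ℂ) = (ε : ℂ) ^ 2 / (δ : ℂ) ^ 2 := by
    push_cast; field_simp
  rw [hβ]
  generalize metricG γ (δ / ε) x = g
  generalize potW γ (δ / ε) x = W
  generalize deriv (fun t => 1 / metricG γ (δ / ε) (t, x.2)) x.1 = D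
  simp only [shiftedPot]
  push_cast
  field_simp
  ring

theorem volume_V : volume V = 2 := by
  rw [V, Measure.volume_eq_prod, Measure.prod_prod, Real.volume_Ioo, Real.volume_Ioo]
  norm_num

/-- A sup bound on V costs the square root of its area, rounded up from √2 to 2, and the weight ε
becomes √ε. -/
theorem normH_vertex_le (hε : 0 < ε) {Φ : Vec} {B : ℝ} (h1 : Φ.1 =ᵐ[volume.restrict E] 0)
    (h2 : Φ.2.1 =ᵐ[volume.restrict E] 0) (h3 : ∀ᵐ x ∂(volume.restrict V), ‖Φ.2.2 x‖ ≤ B) :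
    normH ε Φ ≤ ENNReal.ofReal (2 * √ε * B) := by
  have hb := eLpNorm_le_of_ae_bound (p := 2) h3
  rw [Measure.restrict_apply_univ, volume_V, ENNReal.toReal_ofNat] at hb
  have hb2 : eLpNorm Φ.2.2 2 (volume.restrict V) ≤ 2 * ENNReal.ofReal B := by
    refine hb.trans ?_
    gcongr
    calc (2 : ℝ≥0∞) ^ (2⁻¹ : ℝ) ≤ 2 ^ (1 : ℝ) :=
          ENNReal.rpow_le_rpow_of_exponent_le (by norm_num) (by norm_num)
      _ = 2 := ENNReal.rpow_one 2
  rw [normH, eLpNorm_congr_ae h1, eLpNorm_congr_ae h2, eLpNorm_zero]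
  have hs : ENNReal.ofReal ε = ENNReal.ofReal √ε ^ 2 := by
    rw [← ENNReal.ofReal_pow (Real.sqrt_nonneg ε), Real.sq_sqrt hε.le]
  calc _ ≤ ((ENNReal.ofReal √ε * (2 * ENNReal.ofReal B)) ^ 2) ^ (1 / 2 : ℝ) := by
        gcongr
        rw [mul_pow, hs]
        simp only [ne_eq, OfNat.ofNat_ne_zero, not_false_eq_true, zero_pow, zero_add]
        gcongr
    _ = ENNReal.ofReal √ε * (2 * ENNReal.ofReal B) := by
        rw [← ENNReal.rpow_natCast, ← ENNReal.rpow_mul]; norm_num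
    _ = ENNReal.ofReal (2 * √ε * B) := by
        rw [ENNReal.ofReal_mul (by positivity), ENNReal.ofReal_mul (by norm_num)]
        simp only [ENNReal.ofReal_ofNat]; ring

theorem normH_resolventError_le (hγ : Continuous γ) (hz : z.im ≠ 0) (hδ : 0 < δ) (hε : 0 < ε)
    (hf₁ : MemLp f₁ 2 (volume.restrict (Ioi 0))) (hf₂ : MemLp f₂ 2 (volume.restrict (Ioi 0)))
    {y y₁ : ℝ → ℂ} (hy : SolvesODE (shiftedPot γ ((ε : ℂ) ^ 2 * z)) y y₁)
    (hψ : ∀ s ∈ Ioo (-1 : ℝ) 1, ∀ u, (hatPsi γ ε z n f₁ f₂ q).2.2 (s, u) = y s * chi n u)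
    {C B : ℝ} (hC : ∀ s u : ℝ, s ∈ Icc (-1 : ℝ) 1 → u ∈ Icc (0 : ℝ) 1 →
      |1 - 1 / metricG γ (δ / ε) (s, u)| ≤ C * (δ / ε) ∧
      |deriv (fun t => 1 / metricG γ (δ / ε) (t, u)) s| ≤ C * (δ / ε) ∧
      |potW γ (δ / ε) (s, u) + γ s ^ 2 / 4| ≤ C * (δ / ε))
    (hB : ∀ s ∈ Icc (-1 : ℝ) 1, ‖y s‖ ≤ B ∧ ‖y₁ s‖ ≤ B ∧
      ‖shiftedPot γ ((ε : ℂ) ^ 2 * z) s * y s‖ ≤ B) :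
    normH ε (resolventError γ δ ε z n f₁ f₂ q) ≤
      ENNReal.ofReal (12 * C * B * (δ / ε ^ (5 / 2 : ℝ))) := by
  have hsq : √ε * √ε = ε := Real.mul_self_sqrt hε.le
  have hsq0 : 0 < √ε := Real.sqrt_pos.2 hε
  have hpow : ε ^ (5 / 2 : ℝ) = ε ^ 2 * √ε := by
    rw [Real.sqrt_eq_rpow, ← Real.rpow_natCast, ← Real.rpow_add hε]; norm_num
  have hB0 : 0 ≤ B := (norm_nonneg _).trans (hB 0 (by norm_num)).1
  have hβ : 0 < δ / ε := div_pos hδ hε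
  have hCβ : 0 ≤ C * (δ / ε) := (abs_nonneg _).trans (hC 0 0 (by norm_num) (by norm_num)).1
  -- Three coefficient terms, each at most Cβ times the profile bound, and the factor 2 from |χ_n| ≤
  -- 2, uniform in n. With the 2√ε of the norm this makes the constant 12.
  refine (normH_vertex_le hε (B := 1 / ε ^ 2 * (3 * (C * (δ / ε) * B)) * 2) ?_ ?_ ?_).trans
    (le_of_eq (congrArg ENNReal.ofReal ?_))
  · exact edge_error_eq_zero hz n hf₁ q.1 fun x => rfl
  · exact edge_error_eq_zero hz n hf₂ q.2 fun x => rfl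
  · filter_upwards [vertex_error_ae_eq hγ hδ hε n hy hψ,
      ae_restrict_mem (measurableSet_Ioo.prod measurableSet_Ioo)] with x hx hxV
    have hs := Ioo_subset_Icc_self hxV.1
    obtain ⟨c1, c2, c3⟩ := hC x.1 x.2 hs (Ioo_subset_Icc_self hxV.2)
    obtain ⟨b1, b2, b3⟩ := hB x.1 hs
    have hx' : (resolventError γ δ ε z n f₁ f₂ q).2.2 x =
        (1 / (ε : ℂ) ^ 2) * opL γ (δ / ε) (hatPsi γ ε z n f₁ f₂ q).2.2 x
          - (((n ^ 2 * Real.pi ^ 2 / δ ^ 2 : ℝ) : ℂ) + z) * (hatPsi γ ε z n f₁ f₂ q).2.2 x := by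
      simp [resolventError, hamiltonian, dataXi]
    rw [hx'.trans hx, norm_mul, norm_mul]
    refine mul_le_mul (mul_le_mul ?_ ?_ (norm_nonneg _) (by positivity)) (norm_chi_le n _)
      (norm_nonneg _) (by positivity)
    · rw [norm_div, norm_pow, Complex.norm_real, Real.norm_of_nonneg hε.le, norm_one]
    · refine (norm_add_le _ _).trans ?_
      refine (add_le_add_left (norm_sub_le _ _) _).trans ?_
      rw [norm_mul, norm_mul, norm_mul, norm_neg, Complex.norm_real, Complex.norm_real,
        Complex.norm_real]
      have m1 := mul_le_mul c1 b3 (norm_nonneg _) hCβ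
      have m2 := mul_le_mul c2 b2 (norm_nonneg _) hCβ
      have m3 := mul_le_mul c3 b1 (norm_nonneg _) hCβ
      simp only [Real.norm_eq_abs]
      linarith
  · rw [hpow]
    have : δ / ε = δ / (√ε * √ε) := by rw [hsq]
    rw [this]
    field_simp
    ring

/-- The data `p₁`, `p₂` are controlled by the norm of the right-hand side. -/
theorem exists_pConst_bound (hz : z.im ≠ 0) : ∃ N : ℝ, 0 < N ∧ ∀ (ε : ℝ) (n : ℕ) (f₁ f₂ : ℝ → ℂ),
    1 ≤ n → MemLp f₁ 2 (volume.restrict (Ioi 0)) → MemLp f₂ 2 (volume.restrict (Ioi 0)) →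
      ENNReal.ofReal (‖pConst z f₁‖ + ‖pConst z f₂‖) ≤
        ENNReal.ofReal N * normH ε (dataXi n f₁ f₂) := by
  have hκ := sqrtUp_im_pos hz
  set L := eLpNorm (expI (sqrtUp z)) 2 (volume.restrict (Ioi 0)) with hL
  have hLt : L ≠ ⊤ := (memLp_expI hκ).2.ne
  -- L is the L² norm of e^{i√z t}; the summand 1 ensures positivity and the factor 2 accounts for
  -- the two edges.
  refine ⟨2 * (L.toReal + 1), by positivity, fun ε n f₁ f₂ hn hf₁ hf₂ => ?_⟩
  have hχ := (lineH2_chi n).memLp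
  have hnorm : ∀ {f : ℝ → ℂ}, MemLp f 2 (volume.restrict (Ioi 0)) →
      eLpNorm (fun x : ℝ × ℝ => f x.1 * chi n x.2) 2 (volume.restrict E) =
        eLpNorm f 2 (volume.restrict (Ioi 0)) := fun {f} hf => by
    have := eLpNorm_tensor hf.1 hχ.1
    rw [eLpNorm_chi hn, mul_one] at this
    exact this
  have hroot : ∀ a : ℝ≥0∞, (a ^ 2) ^ (1 / 2 : ℝ) = a := fun a => by
    rw [← ENNReal.rpow_natCast, ← ENNReal.rpow_mul]; norm_num
  have g1 : eLpNorm f₁ 2 (volume.restrict (Ioi 0)) ≤ normH ε (dataXi n f₁ f₂) := by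
    rw [normH, ← hnorm hf₁, ← hroot (eLpNorm (fun x : ℝ × ℝ => f₁ x.1 * chi n x.2) 2 _)]
    gcongr
    exact le_add_right (le_add_right le_rfl)
  have g2 : eLpNorm f₂ 2 (volume.restrict (Ioi 0)) ≤ normH ε (dataXi n f₁ f₂) := by
    rw [normH, ← hnorm hf₂, ← hroot (eLpNorm (fun x : ℝ × ℝ => f₂ x.1 * chi n x.2) 2 _)]
    gcongr
    exact le_add_right (le_add_left le_rfl)
  have hp : ∀ {f : ℝ → ℂ}, MemLp f 2 (volume.restrict (Ioi 0)) →
      ENNReal.ofReal ‖pConst z f‖ ≤ L * eLpNorm f 2 (volume.restrict (Ioi 0)) := fun {f} hf => by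
    rw [ofReal_norm, pConst_eq hz hf]
    exact enorm_integral_expI_mul_le hκ hf
  have hLle : L ≤ ENNReal.ofReal (L.toReal + 1) := by
    rw [ENNReal.le_ofReal_iff_toReal_le hLt (by positivity)]; linarith
  rw [ENNReal.ofReal_add (norm_nonneg _) (norm_nonneg _), ENNReal.ofReal_mul (by norm_num),
    ENNReal.ofReal_ofNat, mul_assoc, two_mul]
  exact add_le_add ((hp hf₁).trans (mul_le_mul' hLle g1)) ((hp hf₂).trans (mul_le_mul' hLle g2))

end

end Waveguide

end

/-! ### Assembly of the estimates; the threshold ε₀ = 1 suffices in both cases. -/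

theorem theorem3p1 (γ : ℝ → ℝ) (hγ : ContDiff ℝ ∞ γ) (hγsupp : tsupport γ ⊆ Set.Ioo (-1) 1)
    (hγbound : ∀ s, |γ s| < 1) :
    -- the constants are well defined, and the approximate solution lies in the domain
    (∀ z : ℂ, z.im ≠ 0 → ∀ ε δ : ℝ, 0 < δ → δ ≤ ε → ∀ n : ℕ, 1 ≤ n → ∀ f₁ f₂ : ℝ → ℂ,
      MemLp f₁ 2 (volume.restrict (Set.Ioi 0)) → MemLp f₂ 2 (volume.restrict (Set.Ioi 0)) →
      (∃! q : ℂ × ℂ, IsCoupling γ ε z f₁ f₂ q) ∧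
      ∀ q : ℂ × ℂ, IsCoupling γ ε z f₁ f₂ q → MemDomain ε (hatPsi γ ε z n f₁ f₂ q)) ∧
    -- the estimates; `c` and `ε₀` depend on `γ` and `z` only
    (∀ z : ℂ, z.im ≠ 0 → ∃ ε₀ : ℝ, 0 < ε₀ ∧ ∃ c : ℝ, 0 < c ∧
      ∀ ε δ : ℝ, 0 < ε → ε < ε₀ → 0 < δ → δ ≤ ε → ∀ n : ℕ, 1 ≤ n → ∀ f₁ f₂ : ℝ → ℂ,
      MemLp f₁ 2 (volume.restrict (Set.Ioi 0)) → MemLp f₂ 2 (volume.restrict (Set.Ioi 0)) →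
      ∀ q : ℂ × ℂ, IsCoupling γ ε z f₁ f₂ q →
        (¬ IsNeumannEigenvalue γ 0 →
          normH ε (resolventError γ δ ε z n f₁ f₂ q) ≤
            ENNReal.ofReal (c * (δ / ε ^ (3 / 2 : ℝ))) * normH ε (dataXi n f₁ f₂)) ∧
        (IsNeumannEigenvalue γ 0 →
          normH ε (resolventError γ δ ε z n f₁ f₂ q) ≤
            ENNReal.ofReal (c * (δ / ε ^ (3 / 2 : ℝ) + δ / ε ^ (5 / 2 : ℝ))) *
              normH ε (dataXi n f₁ f₂))) := by
  have hγc : Continuous γ := hγ.continuous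
  refine ⟨fun z hz ε δ hδ hδε n _ f₁ f₂ hf₁ hf₂ => ?_, fun z hz => ?_⟩
  · have hε : 0 < ε := hδ.trans_le hδε
    exact ⟨existsUnique_coupling hγc hγbound hz hε f₁ f₂,
      fun q hq => hatPsi_memDomain hγc hγbound hz hε n hf₁ hf₂ hq⟩
  obtain ⟨C, hC0, hC⟩ := exists_coefficient_bound hγ hγbound
  obtain ⟨N, hN0, hN⟩ := exists_pConst_bound hz
  by_cases hev : IsNeumannEigenvalue γ 0
  · obtain ⟨D, hD0, hD⟩ := exists_profile_bound hγbound hz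
    refine ⟨1, one_pos, 12 * C * D * N, by positivity,
      fun ε δ hε hε1 hδ hδε n hn f₁ f₂ hf₁ hf₂ q hq => ⟨fun h => absurd hev h, fun _ => ?_⟩⟩
    obtain ⟨y, y₁, hy, hψ⟩ := exists_isProfile (n := n) hγc hγbound hz hε hq
    have hβ : δ / ε ≤ 1 := (div_le_one hε).2 hδε
    refine (normH_resolventError_le hγc hz hδ hε hf₁ hf₂ hy.solves hψ
      (fun s u hs hu => hC _ s u (div_pos hδ hε) hβ hs hu)
      (hD ε _ _ y y₁ hε hε1.le hy)).trans ?_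
    -- The estimate is already of order δ ε^(-5/2); the ε^(-3/2) term is nonnegative and simply
    -- added.
    have hle : 12 * C * (D * (‖pConst z f₁‖ + ‖pConst z f₂‖)) * (δ / ε ^ (5 / 2 : ℝ)) ≤
        12 * C * D * (δ / ε ^ (3 / 2 : ℝ) + δ / ε ^ (5 / 2 : ℝ)) *
          (‖pConst z f₁‖ + ‖pConst z f₂‖) := by
      have : 0 ≤ 12 * C * D * (δ / ε ^ (3 / 2 : ℝ)) * (‖pConst z f₁‖ + ‖pConst z f₂‖) := by
        positivity
      linarith
    refine (ENNReal.ofReal_le_ofReal hle).trans ?_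
    rw [ENNReal.ofReal_mul (by positivity)]
    refine (mul_le_mul_right (hN ε n f₁ f₂ hn hf₁ hf₂) _).trans (le_of_eq ?_)
    rw [← mul_assoc, ← ENNReal.ofReal_mul (by positivity)]
    congr 2; ring
  · obtain ⟨D, hD0, hD⟩ := exists_profile_bound_of_not_eigenvalue hγc hγbound hz hev
    refine ⟨1, one_pos, 12 * C * D * N, by positivity,
      fun ε δ hε hε1 hδ hδε n hn f₁ f₂ hf₁ hf₂ q hq => ⟨fun _ => ?_, fun h => absurd h hev⟩⟩
    obtain ⟨y, y₁, hy, hψ⟩ := exists_isProfile (n := n) hγc hγbound hz hε hq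
    have hβ : δ / ε ≤ 1 := (div_le_one hε).2 hδε
    refine (normH_resolventError_le hγc hz hδ hε hf₁ hf₂ hy.solves hψ
      (fun s u hs hu => hC _ s u (div_pos hδ hε) hβ hs hu)
      (hD ε _ _ y y₁ hε hε1.le hy)).trans ?_
    have hpow : ε ^ (5 / 2 : ℝ) = ε * ε ^ (3 / 2 : ℝ) := by
      rw [← Real.rpow_one_add' hε.le (by norm_num)]; norm_num
    -- The extra ε in the profile bound lowers the exponent 5/2 to 3/2.
    have heq : 12 * C * (D * (ε * (‖pConst z f₁‖ + ‖pConst z f₂‖))) * (δ / ε ^ (5 / 2 : ℝ)) =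
        12 * C * D * (δ / ε ^ (3 / 2 : ℝ)) * (‖pConst z f₁‖ + ‖pConst z f₂‖) := by
      have : 0 < ε ^ (3 / 2 : ℝ) := by positivity
      rw [hpow]; field_simp
    rw [heq, ENNReal.ofReal_mul (by positivity)]
    refine (mul_le_mul_right (hN ε n f₁ f₂ hn hf₁ hf₂) _).trans (le_of_eq ?_)
    rw [← mul_assoc, ← ENNReal.ofReal_mul (by positivity)]
    congr 2; ring
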